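/- Let $k$ be a field of characteristic $0$. A variety over $k$ is a geometrically integral separated scheme of finite type over $k$, and a surface is a variety of dimension $2$. Let $X$ be a smooth projective surface over $k$, and let $\pi_1,\pi_2\colon X\to\mathbb{P}^1_k$ be two conic fibrations, that is, $k$-morphisms such that every scheme-theoretic fiber is isomorphic to a plane conic (the zero scheme in $\mathbb{P}^2$ of a nonzero quadratic form over the residue field). Assume that for all $P,Q\in\mathbb{P}^1(\overline{k})$ the fibers have positive intersection number $\pi_1^{-1}(P)\cdot\pi_2^{-1}(Q)>0$ on $X_{\overline{k}}$. Let $P_0\in X(k)$ be a rational point such that the fiber $\pi_1^{-1}(\pi_1(P_0))$ is smooth over $k$. Define $k$-schemes $C_n$ with morphisms $f_n\colon C_n\to X$ as follows: $C_0=\operatorname{Spec} k$ and $f_0$ is the inclusion of the point $P_0$; for $n\ge 1$ let $i=1$ if $n$ is odd and $i=2$ if $n$ is even, let $C_n = C_{n-1}\times_{\mathbb{P}^1_k} X$ be the fiber product of $\pi_i\circ f_{n-1}\colon C_{n-1}\to\mathbb{P}^1_k$ and $\pi_i\colon X\to\mathbb{P}^1_k$, and let $f_n\colon C_n\to X$ be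 the second projection. Then: (i) for every $n\ge 2$, the morphism $f_n\colon C_n\to X$ is flat, projective and surjective; (ii) for every $n\ge 0$, the scheme $C_n$ is geometrically integral over $k$ of dimension $n$; (iii) for every $n\ge 0$, $C_n$ is a projective variety over $k$ which is rational, i.e. birational over $k$ to $\mathbb{A}^n_k$. -/

import Mathlib

open AlgebraicGeometry CategoryTheory Limits

universe u

noncomputable section

namespace ConicFibrations

attribute [local instance] MvPolynomial.gradedAlgebra

/-! ### Projective space over a field -/

/-- The standard grading of the polynomial ring `F[x₀, …, x_N]`. -/
abbrev stdGrading (N : ℕ) (F : Type u) [Field F] :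
    ℕ → Submodule F (MvPolynomial (Fin (N + 1)) F) :=
  MvPolynomial.homogeneousSubmodule (Fin (N + 1)) F

/-- Projective `N`-space over the field `F`, i.e. `Proj F[x₀, …, x_N]`. -/
def ProjSpace (N : ℕ) (F : Type u) [Field F] : Scheme.{u} :=
  Proj (stdGrading N F)

/-- The structure morphism of projective `N`-space over `F`. -/
def ProjSpace.toSpec (N : ℕ) (F : Type u) [Field F] : ProjSpace N F ⟶ Spec (.of F) :=
  Proj.toSpecZero (stdGrading N F) ≫
    Spec.map (CommRingCat.ofHom (algebraMap F (stdGrading N F 0)))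

theorem X_mem_stdGrading (N : ℕ) (F : Type u) [Field F] (j : Fin (N + 1)) :
    (MvPolynomial.X j : MvPolynomial (Fin (N + 1)) F) ∈ stdGrading N F 1 :=
  MvPolynomial.isHomogeneous_X F j

/-- The standard affine chart `D₊(x_j)` of projective space. -/
def ProjSpace.chart (N : ℕ) (F : Type u) [Field F] (j : Fin (N + 1)) :
    (ProjSpace N F).affineOpens :=
  ⟨Proj.basicOpen (stdGrading N F) (MvPolynomial.X j),
    Proj.isAffineOpen_basicOpen (stdGrading N F) (MvPolynomial.X j)
      (X_mem_stdGrading N F j) Nat.one_pos⟩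

/-- The function `q / x_j ^ d` on the chart `D₊(x_j)`, for a form `q` of degree `d`. -/
def ProjSpace.dehomogenize (N : ℕ) (F : Type u) [Field F] (d : ℕ)
    (q : MvPolynomial (Fin (N + 1)) F) (hq : q.IsHomogeneous d) (j : Fin (N + 1)) :
    Γ(ProjSpace N F, (ProjSpace.chart N F j).1) :=
  (Proj.awayToSection (stdGrading N F) (MvPolynomial.X j)).hom
    (HomogeneousLocalization.Away.mk (stdGrading N F) (X_mem_stdGrading N F j) d q
      (by simpa using hq))

/-! ### Projective morphisms, varieties, surfaces -/

/-- A scheme over the field `k` is projective if it is isomorphic over `k` to a closed subscheme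
of some projective space over `k`. -/
def IsProjectiveScheme {k : Type u} [Field k] {X : Scheme.{u}} (s : X ⟶ Spec (.of k)) : Prop :=
  ∃ (N : ℕ) (i : X ⟶ ProjSpace N k), IsClosedImmersion i ∧ i ≫ ProjSpace.toSpec N k = s

/-- A morphism `f : X ⟶ Y`, where `Y` is a `k`-scheme with structure morphism `s`, is projective if
it factors as a closed immersion into `Y ×ₖ ℙᴺₖ` (which is `ℙᴺ` over `Y`) for some `N`, followed by
the projection to `Y`. -/
def IsProjectiveMorphism {k : Type u} [Field k] {X Y : Scheme.{u}} (s : Y ⟶ Spec (.of k))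
    (f : X ⟶ Y) : Prop :=
  ∃ (N : ℕ) (i : X ⟶ pullback s (ProjSpace.toSpec N k)),
    IsClosedImmersion i ∧ i ≫ pullback.fst s (ProjSpace.toSpec N k) = f

/-- A variety over the field `k`: a geometrically integral separated scheme of finite type. -/
structure IsVariety {k : Type u} [Field k] {X : Scheme.{u}} (s : X ⟶ Spec (.of k)) : Prop where
  geometricallyIntegral : GeometricallyIntegral s
  isSeparated : IsSeparated s
  locallyOfFiniteType : LocallyOfFiniteType s
  quasiCompact : QuasiCompact s

/-- A smooth projective surface over the field `k`. -/
structure IsSmoothProjectiveSurface {k : Type u} [Field k] {X : Scheme.{u}}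
    (s : X ⟶ Spec (.of k)) : Prop where
  isVariety : IsVariety s
  dim_eq : topologicalKrullDim X = 2
  smooth : Smooth s
  projective : IsProjectiveScheme s

/-- A `k`-scheme of dimension `n` is rational if it is birational over `k` to affine `n`-space. -/
def IsRationalOfDim {k : Type u} [Field k] {X : Scheme.{u}} (s : X ⟶ Spec (.of k)) (n : ℕ) :
    Prop :=
  Scheme.BirationalOver s (𝔸(ULift.{u} (Fin n); Spec (.of k)) ↘ Spec (.of k))

/-! ### Conic fibrations -/

/-- An `F`-scheme is isomorphic to a plane conic if it is isomorphic over `F` to the closed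
subscheme `q = 0` of `ℙ²` for a nonzero quadratic form `q`. -/
def IsPlaneConic {F : Type u} [Field F] {Z : Scheme.{u}} (s : Z ⟶ Spec (.of F)) : Prop :=
  ∃ (q : MvPolynomial (Fin 3) F) (hq : q.IsHomogeneous 2) (i : Z ⟶ ProjSpace 2 F),
    q ≠ 0 ∧ IsClosedImmersion i ∧ i ≫ ProjSpace.toSpec 2 F = s ∧
    ∀ j : Fin 3, i.ker.ideal (ProjSpace.chart 2 F j) =
      Ideal.span {ProjSpace.dehomogenize 2 F 2 q hq j}

/-- A conic fibration of the `k`-scheme `X`: a `k`-morphism to the projective line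
all of whose scheme-theoretic fibers are plane conics (over the residue fields). -/
structure IsConicFibration {k : Type u} [Field k] {X : Scheme.{u}} (s : X ⟶ Spec (.of k))
    (π : X ⟶ ProjSpace 1 k) : Prop where
  comp_toSpec : π ≫ ProjSpace.toSpec 1 k = s
  fiber_isPlaneConic : ∀ y : ProjSpace 1 k,
    IsPlaneConic (F := (ProjSpace 1 k).residueField y) (π.fiberToSpecResidueField y)

/-! ### Intersection numbers -/

/-- `e` is a local equation at the point `x` of the effective Cartier divisor `i : E ⟶ S`: on some
affine open neighbourhood of `x` the ideal of `E` is generated by a nonzerodivisor whose germ at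
`x` is `e`. -/
def IsLocalEquation {E S : Scheme.{u}} (i : E ⟶ S) (x : S) (e : S.presheaf.stalk x) : Prop :=
  ∃ (U : S.affineOpens) (hx : x ∈ U.1) (t : Γ(S, U.1)),
    t ∈ nonZeroDivisors Γ(S, U.1) ∧ i.ker.ideal U = Ideal.span {t} ∧
    (S.presheaf.germ U.1 x hx).hom t = e

/-- `d` is the degree on the integral curve `j : V ⟶ S` of the line bundle `𝒪(E)`, where
`i : E ⟶ S` is an effective Cartier divisor and `V` is proper over an algebraically closed field.

Let `ξ` be the generic point of `V` and let `e` be a local equation of `E` at `ξ`. A local equation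
of `E` at a point `x` of `V` has the form `u x * e` in the local ring of `S` at `ξ`, with a unit
`u x`. The restrictions of the `u x` to the function field of `V` are the local equations of the
divisor on `V` of a nonzero rational section of `𝒪(E)|_V`, and `d` is the degree of this divisor.
(If `V` is not contained in `E`, one may take `e = 1`, and `d` is the number of points of `V ∩ E`
with multiplicities.) -/
def IsDegreeOnCurve {E S V : Scheme.{u}} (i : E ⟶ S) (j : V ⟶ S) [IsIntegral V]
    [IsLocallyNoetherian V] (d : ℤ) : Prop :=
  ∃ (e : S.presheaf.stalk (j (genericPoint V)))
    (u : V → (S.presheaf.stalk (j (genericPoint V)))ˣ),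
    IsLocalEquation i (j (genericPoint V)) e ∧
    (∀ x : V, ∃ e' : S.presheaf.stalk (j x), IsLocalEquation i (j x) e' ∧
      (S.presheaf.stalkSpecializes
        ((genericPoint_specializes x).map j.continuous)).hom e' = u x * e) ∧
    d = ∑ᶠ x : V, V.ord ((j.stalkMap (genericPoint V)).hom (u x : S.presheaf.stalk _)) x

/-- `n` is the intersection number `D · E` of two effective Cartier divisors `i₁ : D ⟶ S` and
`i₂ : E ⟶ S` on a surface `S` which is proper over an algebraically closed field: the sum, over the
irreducible components `V` of `D` (with their reduced structure), of the multiplicity of `V` in `D`,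
i.e. the length of the local ring of `D` at the generic point of `V`, times the degree of `𝒪(E)`
on `V`. -/
def IsIntersectionNumber {D E S : Scheme.{u}} (i₁ : D ⟶ S) (i₂ : E ⟶ S) (n : ℤ) : Prop :=
  ∃ m : irreducibleComponents D → ℤ,
    (∀ Z : irreducibleComponents D,
      ∃ (V : Scheme.{u}) (_ : IsIntegral V) (_ : IsLocallyNoetherian V) (j : V ⟶ D) (d : ℤ),
        IsClosedImmersion j ∧ Set.range j = (Z : Set D) ∧ IsDegreeOnCurve i₂ (j ≫ i₁) d ∧
        m Z = ((Module.length (D.presheaf.stalk (j (genericPoint V)))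
          (D.presheaf.stalk (j (genericPoint V)))).toNat : ℤ) * d) ∧
    n = ∑ᶠ Z : irreducibleComponents D, m Z

/-- The morphism `Spec k̄ ⟶ Spec k`. -/
def specAlgClosure (k : Type u) [Field k] : Spec (.of (AlgebraicClosure k)) ⟶ Spec (.of k) :=
  Spec.map (CommRingCat.ofHom (algebraMap k (AlgebraicClosure k)))

/-- The base change `π_{k̄}` of a `k`-morphism `π : X ⟶ Y` to an algebraic closure of `k`. -/
def geomMap {k : Type u} [Field k] {X Y : Scheme.{u}} (s : X ⟶ Spec (.of k))
    (t : Y ⟶ Spec (.of k)) (π : X ⟶ Y) (h : π ≫ t = s) :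
    pullback s (specAlgClosure k) ⟶ pullback t (specAlgClosure k) :=
  pullback.map s (specAlgClosure k) t (specAlgClosure k) π (𝟙 _) (𝟙 _) (by simp [h]) (by simp)

/-- Any two geometric fibers of the two conic fibrations have positive intersection number on
`X_{k̄}`. The points of `ℙ¹(k̄)` are the closed points of `ℙ¹` over `k̄`. The intersection number
is unique, hence the quantification over its values `n`. -/
def FibersMeetPositively {k : Type u} [Field k] {X : Scheme.{u}} {s : X ⟶ Spec (.of k)}
    {π₁ π₂ : X ⟶ ProjSpace 1 k} (h₁ : IsConicFibration s π₁) (h₂ : IsConicFibration s π₂) : Prop :=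
  ∀ P Q : ↥(pullback (ProjSpace.toSpec 1 k) (specAlgClosure k)),
    IsClosed {P} → IsClosed {Q} →
    ∀ n : ℤ, IsIntersectionNumber
      ((geomMap s (ProjSpace.toSpec 1 k) π₁ h₁.comp_toSpec).fiberι P)
      ((geomMap s (ProjSpace.toSpec 1 k) π₂ h₂.comp_toSpec).fiberι Q) n → 0 < n

/-! ### The iterated fiber products -/

/-- The schemes `C_n` with the morphisms `f_n : C_n ⟶ X`, as objects over `X`: `f_0` is the given
point, and `C_{n+1}` is the fiber product of `π_i ∘ f_n : C_n ⟶ B` and `π_i : X ⟶ B`, where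
`i = 1` if `n + 1` is odd and `i = 2` if `n + 1` is even; `f_{n+1}` is the projection to `X`. -/
def iteratedFiberProduct {X B C₀ : Scheme.{u}} (π₁ π₂ : X ⟶ B) (P₀ : C₀ ⟶ X) : ℕ → Over X
  | 0 => Over.mk P₀
  | n + 1 =>
    let π := if Odd (n + 1) then π₁ else π₂
    Over.mk (pullback.snd ((iteratedFiberProduct π₁ π₂ P₀ n).hom ≫ π) π)

/-- The scheme `C_n`. -/
abbrev auxC {X B C₀ : Scheme.{u}} (π₁ π₂ : X ⟶ B) (P₀ : C₀ ⟶ X) (n : ℕ) : Scheme.{u} :=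
  (iteratedFiberProduct π₁ π₂ P₀ n).left

/-- The morphism `f_n : C_n ⟶ X`. -/
abbrev auxF {X B C₀ : Scheme.{u}} (π₁ π₂ : X ⟶ B) (P₀ : C₀ ⟶ X) (n : ℕ) :
    auxC π₁ π₂ P₀ n ⟶ X :=
  (iteratedFiberProduct π₁ π₂ P₀ n).hom

end ConicFibrations

end

noncomputable section

namespace ConicFibrations

attribute [local instance] MvPolynomial.gradedAlgebra

/-! Write `f` for `f_n` and `π` for the fibration used in the next step. The projection from
`C_{n+1}` to `C_n` is the base change of `π` along `f ≫ π`, and it has a tautological section,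
because `f` itself lifts `f ≫ π` to `X`. Suppose that the fibre of `π` over the image of the generic
point of `C_n` is a smooth conic. Then the generic fibre of `C_{n+1}` over `C_n` is a smooth conic
with a rational point, and projecting from that point makes its function field purely transcendental
of degree one over that of `C_n` (`TernaryForm.exists_fractionRing_equiv`,
`HasSmoothConicFiber.exists_flat_mono_pullback`). Inductively `C_n` has function field `k(x₁, …,
x_n)`, which gives rationality and, by Noether normalization, the dimension.

Geometric integrality follows from the same smooth fibre: `π` is flat, a flat scheme over an
integral base is integral once its generic fibre is (`isIntegral_of_flat`), and a conic with nonzero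
discriminant stays integral after every field extension. Projectivity of fibre products comes from
the Segre embedding.

It remains to see that the relevant fibre is smooth. For `n = 0` this is the hypothesis on `P₀`. For
`n ≥ 1` the map `f ≫ π` is dominant, so the fibre in question is the generic fibre of `π`. Its local
rings are local rings of the smooth surface `X`, hence normal, whereas a degenerate conic is not
normal at its vertex (`TernaryForm.disc_ne_zero_of_isNormalInRegular`); the vertex exists because 2
is invertible.

Dominance for `n = 1` is where the intersection numbers enter. The image of `C_1` in `X` is a closed
fibre of `π₁`; were it not dominant over the base of `π₂`, some closed geometric fibre of `π₂` would
be disjoint from a geometric fibre of `π₁`, and the intersection number would be 0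
(`FibersMeetPositively.isDominant`). For `n ≥ 2` the map `f` is even surjective: a dominant morphism
from an integral scheme to `ℙ¹` is flat because the local rings of `ℙ¹` are Dedekind domains, a
proper dominant morphism is surjective, and `f_{n+1}` is the base change of `f_n ≫ π` along `π`.
This also proves the first assertion.

Two devices run through the proof. Normality is used in the form `IsNormalInRegular`, which makes
sense without assuming a domain. Function fields are carried as flat monomorphisms from spectra of
fields; these compose well with base change and automatically hit the generic point of an integral
scheme. -/

/-! ### Local rings of smooth algebras over fields -/

/-- A commutative ring is von Neumann regular if every element has a quasi-inverse. -/
def IsVonNeumannRegular (T : Type*) [CommRing T] : Prop := ∀ t : T, ∃ u, t * u * t = t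

/-- The ring `O` embeds as an integrally closed subring into a von Neumann regular ring. -/
def IsNormalInRegular (O : Type u) [CommRing O] : Prop :=
  ∃ (T : Type u) (_ : CommRing T) (_ : Algebra O T), Function.Injective (algebraMap O T) ∧
    (∀ t : T, IsIntegral O t → t ∈ Set.range (algebraMap O T)) ∧ IsVonNeumannRegular T

/-- An étale algebra over a field is a finite product of fields. The quasi-inverse is taken
componentwise, with the convention `0⁻¹ = 0`. -/
theorem isVonNeumannRegular_of_etale (K A : Type u) [Field K] [CommRing A] [Algebra K A]
    [Algebra.Etale K A] : IsVonNeumannRegular A := by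
  obtain ⟨I, _, Ai, _, _, e, -⟩ := (Algebra.Etale.iff_exists_algEquiv_prod K A).mp inferInstance
  intro t
  refine ⟨e.symm fun i => (e t i)⁻¹, e.injective ?_⟩
  ext i
  simp [mul_inv_mul_cancel]

theorem IsVonNeumannRegular.of_ringEquiv {T T' : Type*} [CommRing T] [CommRing T']
    (h : IsVonNeumannRegular T) (e : T ≃+* T') : IsVonNeumannRegular T' := fun t => by
  obtain ⟨r, hr⟩ := h (e.symm t)
  refine ⟨e r, e.symm.injective ?_⟩
  rw [map_mul, map_mul, e.symm_apply_apply, hr]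

theorem IsNormalInRegular.of_ringEquiv {O O' : Type u} [CommRing O] [CommRing O']
    (h : IsNormalInRegular O) (e : O ≃+* O') : IsNormalInRegular O' := by
  obtain ⟨T, _, _, hi, hint, hT⟩ := h
  let _ : Algebra O' T := ((algebraMap O T).comp e.symm.toRingHom).toAlgebra
  refine ⟨T, inferInstance, inferInstance, hi.comp e.symm.injective, fun t ht => ?_, hT⟩
  have : IsIntegral O t := by
    obtain ⟨p, hp, hpt⟩ := ht
    refine ⟨p.map e.symm.toRingHom, hp.map _, ?_⟩
    rw [Polynomial.eval₂_map]
    exact hpt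
  obtain ⟨x, hx⟩ := hint t this
  exact ⟨e x, by rw [← hx]; simp [RingHom.algebraMap_toAlgebra]⟩

-- Up to a unit `s ⊗ 1` with `s` in `N`, every element of `O ⊗ K` comes from `A ⊗ K`, and a
-- quasi-inverse found there can be corrected by that unit.
open TensorProduct in
theorem isVonNeumannRegular_tensorProduct_of_isLocalization {P A O K : Type u} [CommRing P]
    [CommRing A] [CommRing O] [CommRing K] [Algebra P A] [Algebra A O] [Algebra P O]
    [IsScalarTower P A O] [Algebra P K] (N : Submonoid A) [IsLocalization N O]
    (h : IsVonNeumannRegular (A ⊗[P] K)) : IsVonNeumannRegular (O ⊗[P] K) := by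
  let φ : A ⊗[P] K →ₐ[P] O ⊗[P] K :=
    Algebra.TensorProduct.map (IsScalarTower.toAlgHom P A O) (AlgHom.id P K)
  have key : ∀ t : O ⊗[P] K, ∃ s : N, ∃ r, algebraMap A O s ⊗ₜ[P] (1 : K) * t = φ r := by
    intro t
    induction t with
    | zero => exact ⟨1, 0, by simp⟩
    | tmul a b =>
      obtain ⟨⟨x, s⟩, hx⟩ := IsLocalization.surj N a
      refine ⟨s, x ⊗ₜ b, ?_⟩
      simp only [φ, Algebra.TensorProduct.tmul_mul_tmul, one_mul, Algebra.TensorProduct.map_tmul,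
        AlgHom.coe_id, id_eq, IsScalarTower.coe_toAlgHom']
      rw [mul_comm, hx]
    | add x y hx hy =>
      obtain ⟨s, r, hr⟩ := hx
      obtain ⟨s', r', hr'⟩ := hy
      refine ⟨s * s', (s'.1 ⊗ₜ 1) * r + (s.1 ⊗ₜ 1) * r', ?_⟩
      have e (s : A) : φ (s ⊗ₜ 1) = algebraMap A O s ⊗ₜ[P] (1 : K) := by simp [φ]
      have e' : algebraMap A O (s * s' : N) ⊗ₜ[P] (1 : K) =
          (algebraMap A O s ⊗ₜ 1) * (algebraMap A O s' ⊗ₜ 1) := by simp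
      rw [map_add, map_mul, map_mul, ← hr, ← hr', e, e, e']
      ring
  intro t
  obtain ⟨s, r, hr⟩ := key t
  obtain ⟨r', hr'⟩ := h r
  have hs : IsUnit (algebraMap A O s ⊗ₜ[P] (1 : K)) :=
    (IsLocalization.map_units O s).map
      (Algebra.TensorProduct.includeLeft (R := P) (S := P) (B := K))
  refine ⟨algebraMap A O s ⊗ₜ[P] (1 : K) * φ r', hs.mul_left_cancel ?_⟩
  have := congrArg φ hr'
  rw [map_mul, map_mul, ← hr] at this
  rw [← this]
  ring

open TensorProduct in
/-- The local rings of a smooth algebra over a field are integrally closed in a von Neumann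
regular ring. -/
theorem isNormalInRegular_of_smooth (k B : Type u) [Field k] [CommRing B] [Algebra k B]
    [Algebra.Smooth k B] (p : Ideal B) [p.IsPrime] :
    IsNormalInRegular (Localization.AtPrime p) := by
  -- Near `p`, a smooth algebra is étale over a polynomial ring `P`. With `K` the fraction field of
  -- `P`, the overring will be `O ⊗[P] K`, a localization of an étale `K`-algebra.
  obtain ⟨f, hf, n, _, _, _⟩ :=
    Algebra.IsSmoothAt.exists_isStandardEtale_mvPolynomial (R := k) (p := p)
  let P := MvPolynomial (Fin n) k
  let A := Localization.Away f
  let O := Localization.AtPrime p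
  let K := FractionRing P
  have hle : Submonoid.powers f ≤ p.primeCompl := by
    rw [Submonoid.powers_le]; exact hf
  let _ : Algebra A O := IsLocalization.localizationAlgebraOfSubmonoidLe A O _ _ hle
  have : IsScalarTower B A O :=
    IsLocalization.localization_isScalarTower_of_submonoid_le A O _ _ hle
  let N : Submonoid A := p.primeCompl.map (algebraMap B A)
  have : IsLocalization N O := IsLocalization.isLocalization_of_submonoid_le A O _ _ hle
  let _ : Algebra P O := ((algebraMap A O).comp (algebraMap P A)).toAlgebra
  have : IsScalarTower P A O := .of_algebraMap_eq fun _ => rfl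
  have hA : Algebra.Etale P A := inferInstance
  have hAf : Module.Flat P A := inferInstance
  have hOf : Module.Flat A O := IsLocalization.flat O N
  have hPf : Module.Flat P O := .trans P A O
  -- Integral closure commutes with smooth base change and with localization. Since `P` is
  -- integrally closed in `K`, the integral closure of `O` in `O ⊗[P] K` is therefore the image of
  -- `O ⊗[P] P`, which is `O`.
  have hbij : Function.Bijective (TensorProduct.toIntegralClosure P O K) :=
    TensorProduct.toIntegralClosure_bijective_of_tower (S := A)
      TensorProduct.toIntegralClosure_bijective_of_smooth
      (TensorProduct.toIntegralClosure_bijective_of_isLocalization N)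
  refine ⟨O ⊗[P] K, inferInstance, inferInstance, ?_, ?_, ?_⟩
  · exact Algebra.TensorProduct.includeLeft_injective (R := P) (S := P) (A := O) (B := K)
      (IsFractionRing.injective P K)
  · intro t ht
    obtain ⟨y, hy⟩ := hbij.2 ⟨t, ht⟩
    have hy' : (TensorProduct.toIntegralClosure P O K y : O ⊗[P] K) = t := by rw [hy]
    rw [← hy']
    clear hy hy' ht
    induction y with
    | zero => exact ⟨0, by simp⟩
    | add x y hx hy =>
      obtain ⟨a, ha⟩ := hx
      obtain ⟨b, hb⟩ := hy
      exact ⟨a + b, by simp [ha, hb]⟩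
    | tmul a b =>
      obtain ⟨b, hb⟩ := b
      obtain ⟨c, rfl⟩ := IsIntegrallyClosed.isIntegral_iff.mp hb
      refine ⟨c • a, ?_⟩
      change (c • a) ⊗ₜ[P] (1 : K) = a ⊗ₜ[P] (algebraMap P K c)
      rw [Algebra.algebraMap_eq_smul_one, TensorProduct.smul_tmul]
  · refine isVonNeumannRegular_tensorProduct_of_isLocalization (A := A) N ?_
    exact (isVonNeumannRegular_of_etale K (K ⊗[P] A)).of_ringEquiv
      (Algebra.TensorProduct.comm P K A).toRingEquiv

/-- Quadratic relations between `x` and `y` in a von Neumann regular ring make `x` a multiple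
of `y`, with a quotient which satisfies a quadratic equation. -/
theorem quadratic_relation_of_quasiInverse {T : Type*} [CommRing T] (hT : IsVonNeumannRegular T)
    (a a' b c x y y' : T) (hy' : y * y' * y = y) (ha : a * a' = 1)
    (e : a * x ^ 2 + b * (x * y) + c * y ^ 2 = 0) :
    x = y * (x * y') ∧ (x * y') ^ 2 + a' * b * (x * y') + a' * c * (y * y') = 0 := by
  have idem : (y * y') * (y * y') = y * y' := by linear_combination y' * hy'
  -- The idempotent `y * y'` splits the ring. On the complementary factor `y` vanishes, so the
  -- relation with invertible `a` forces `x ^ 2 = 0` there, and a von Neumann regular ring is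
  -- reduced.
  have sq : ((1 - y * y') * x) ^ 2 = 0 := by
    have h0 : (1 - y * y') * y = 0 := by linear_combination - hy'
    linear_combination (1 - y * y') ^ 2 * a' * e - (1 - y * y') ^ 2 * x ^ 2 * ha -
      a' * (1 - y * y') * (b * x + c * y) * h0
  have hx0 : (1 - y * y') * x = 0 := by
    obtain ⟨z, hz⟩ := hT ((1 - y * y') * x)
    rw [← hz]
    linear_combination z * sq
  refine ⟨by linear_combination hx0, ?_⟩
  linear_combination y' ^ 2 * a' * e - y' ^ 2 * x ^ 2 * ha + y' * a' * b * hx0 - a' * c * idem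

/-- The equation is monic over the integral closure of `O` in `T`, which contains `c`; transitivity
of integrality does the rest. -/
theorem isIntegral_of_sq_add {O T : Type*} [CommRing O] [CommRing T] [Algebra O T] {w c : T}
    (b : O) (hc : IsIntegral O c) (h : w ^ 2 + algebraMap O T b * w + c = 0) : IsIntegral O w := by
  refine isIntegral_trans (R := O) (A := integralClosure O T) _ ?_
  refine ⟨Polynomial.X ^ 2 + (Polynomial.C (algebraMap O _ b) * Polynomial.X +
    Polynomial.C (⟨c, hc⟩ : integralClosure O T)), ?_, ?_⟩
  · refine Polynomial.monic_X_pow_add (lt_of_le_of_lt Polynomial.degree_linear_le ?_)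
    norm_num
  · simp only [Polynomial.eval₂_add, Polynomial.eval₂_pow, Polynomial.eval₂_X,
      Polynomial.eval₂_mul, Polynomial.eval₂_C]
    rw [← IsScalarTower.algebraMap_apply O (integralClosure O T) T, ← add_assoc]
    exact h

theorem isIntegral_of_mul_self_eq {O T : Type*} [CommRing O] [CommRing T] [Algebra O T] {t : T}
    (h : t * t = t) : IsIntegral O t := by
  refine isIntegral_of_sq_add (c := 0) (-1) isIntegral_zero ?_
  rw [map_neg, map_one]
  linear_combination h

/-- A ring that is integrally closed in a von Neumann regular ring has no point at which it looks
like the vertex of the cone `a x² + b x y + c y² = 0`. -/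
theorem IsNormalInRegular.quadratic_coeff_eq_zero {O : Type u} [CommRing O]
    (h : IsNormalInRegular O) {F : Type u} [Field F] (φ : O →+* TrivSqZeroExt F (F × F))
    (ι : F →+* O) (x y : O) (hx : φ x = .inr (1, 0)) (hy : φ y = .inr (0, 1)) (a b c : F)
    (hφ : ∀ r, φ (ι r) = .inl r)
    (e : ι a * x ^ 2 + ι b * (x * y) + ι c * y ^ 2 = 0) : a = 0 ∧ b = 0 ∧ c = 0 := by
  obtain ⟨T, _, _, hi, hint, hT⟩ := h
  obtain ⟨y', hy'⟩ := hT (algebraMap O T y)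
  have idem : (algebraMap O T y * y') * (algebraMap O T y * y') = algebraMap O T y * y' := by
    linear_combination y' * hy'
  have heint : IsIntegral O (algebraMap O T y * y') := isIntegral_of_mul_self_eq idem
  have eT : algebraMap O T (ι a) * algebraMap O T x ^ 2 +
      algebraMap O T (ι b) * (algebraMap O T x * algebraMap O T y) +
      algebraMap O T (ι c) * algebraMap O T y ^ 2 = 0 := by
    simpa using congrArg (algebraMap O T) e
  -- If `a` is invertible, then `x = y * w` with `w` integral, hence `w` in `O`. But `φ` records
  -- first-order terms, where `x` and `y` are independent, so `x` is no multiple of `y`.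
  have ha : a = 0 := by
    by_contra ha
    have hua : algebraMap O T (ι a) * algebraMap O T (ι a⁻¹) = 1 := by
      rw [← map_mul, ← map_mul, mul_inv_cancel₀ ha, map_one, map_one]
    obtain ⟨h1, h2⟩ := quadratic_relation_of_quasiInverse hT _ _ _ _ _ _ _ hy' hua eT
    rw [← map_mul (algebraMap O T) (ι a⁻¹) (ι b)] at h2
    obtain ⟨w, hw⟩ := hint _ (isIntegral_of_sq_add _
      ((isIntegral_algebraMap.mul isIntegral_algebraMap).mul heint) h2)
    have hxw : x = y * w := hi (by rw [map_mul, hw]; exact h1)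
    have := congrArg φ hxw
    rw [map_mul, hx, hy] at this
    have := congrArg (fun t => (TrivSqZeroExt.snd t).1) this
    simp [TrivSqZeroExt.snd_mul] at this
  subst ha
  simp only [map_zero, zero_mul, zero_add] at e eT
  obtain ⟨ε, hε⟩ := hint _ heint
  have hεy : ε * y = y := hi (by rw [map_mul, hε]; exact hy')
  have hεz : ε * (ι b * x + ι c * y) = 0 := hi (by
    rw [map_mul, hε, map_zero, map_add, map_mul, map_mul]
    linear_combination y' * eT)
  have h2 := congrArg (fun t => (TrivSqZeroExt.snd (φ t))) hεy
  have h3 := congrArg (fun t => (TrivSqZeroExt.snd (φ t))) hεz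
  simp only [map_mul, map_add, map_zero, hx, hy, hφ, TrivSqZeroExt.snd_mul, TrivSqZeroExt.fst_mul,
    TrivSqZeroExt.snd_add, TrivSqZeroExt.fst_add, TrivSqZeroExt.fst_inr, TrivSqZeroExt.snd_inr,
    TrivSqZeroExt.fst_inl, TrivSqZeroExt.snd_inl, TrivSqZeroExt.snd_zero, Prod.ext_iff,
    Prod.fst_add, Prod.snd_add, Prod.smul_fst, Prod.smul_snd, smul_eq_mul, Prod.fst_zero,
    Prod.snd_zero, MulOpposite.op_zero, zero_smul, smul_zero, add_zero, zero_add, mul_one,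
    mul_zero] at h2 h3
  have h4 : TrivSqZeroExt.fst (φ ε) = 1 := h2.2
  rw [h4, one_mul, one_mul] at h3
  exact ⟨rfl, h3⟩

/-! ### Ternary quadratic forms and their dehomogenizations -/

/-- The coefficients of `a x₀² + b x₁² + c x₂² + d x₁ x₂ + e x₀ x₂ + f x₀ x₁`. -/
structure TernaryForm (F : Type*) where
  a : F
  b : F
  c : F
  d : F
  e : F
  f : F

namespace TernaryForm

open MvPolynomial

section

variable {R : Type*} [CommRing R]

/-- The dehomogenization with respect to the last variable. -/
def poly (Q : TernaryForm R) : MvPolynomial (Fin 2) R :=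
  C Q.a * X 0 ^ 2 + C Q.f * (X 0 * X 1) + C Q.b * X 1 ^ 2 + C Q.e * X 0 + C Q.d * X 1 + C Q.c

/-- The discriminant. -/
def disc (Q : TernaryForm R) : R :=
  4 * Q.a * Q.b * Q.c + Q.d * Q.e * Q.f - Q.a * Q.d ^ 2 - Q.b * Q.e ^ 2 - Q.c * Q.f ^ 2

/-- Renaming of the variables such that the last variable of `Q.chart j` is the `j`-th variable
of `Q` and the order of the other two variables is kept. -/
def chart (Q : TernaryForm R) : Fin 3 → TernaryForm R :=
  ![⟨Q.b, Q.c, Q.a, Q.e, Q.f, Q.d⟩, ⟨Q.a, Q.c, Q.b, Q.d, Q.f, Q.e⟩, Q]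

/-- Base change of a form. -/
def map {S : Type*} (φ : R → S) (Q : TernaryForm R) : TernaryForm S :=
  ⟨φ Q.a, φ Q.b, φ Q.c, φ Q.d, φ Q.e, φ Q.f⟩

/-- The form is zero. -/
def IsZero (Q : TernaryForm R) : Prop :=
  Q.a = 0 ∧ Q.b = 0 ∧ Q.c = 0 ∧ Q.d = 0 ∧ Q.e = 0 ∧ Q.f = 0

theorem disc_chart (Q : TernaryForm R) (j : Fin 3) : (Q.chart j).disc = Q.disc := by
  fin_cases j <;> simp [chart, disc] <;> ring

theorem isZero_chart (Q : TernaryForm R) (j : Fin 3) : (Q.chart j).IsZero ↔ Q.IsZero := by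
  fin_cases j <;> simp [chart, IsZero] <;> tauto

theorem disc_map {S : Type*} [CommRing S] (φ : R →+* S) (Q : TernaryForm R) :
    (Q.map φ).disc = φ Q.disc := by
  simp [disc, map, map_ofNat]

theorem poly_map {S : Type*} [CommRing S] (φ : R →+* S) (Q : TernaryForm R) :
    (Q.map φ).poly = MvPolynomial.map φ Q.poly := by
  simp [poly, map]

theorem coeff_poly (Q : TernaryForm R) :
    coeff (Finsupp.single 0 2) Q.poly = Q.a ∧
    coeff (Finsupp.single 1 2) Q.poly = Q.b ∧
    coeff 0 Q.poly = Q.c ∧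
    coeff (Finsupp.single 1 1) Q.poly = Q.d ∧
    coeff (Finsupp.single 0 1) Q.poly = Q.e ∧
    coeff (Finsupp.single 0 1 + Finsupp.single 1 1) Q.poly = Q.f := by
  have h : (X 0 * X 1 : MvPolynomial (Fin 2) R) =
      monomial (Finsupp.single 0 1 + Finsupp.single 1 1) 1 := by
    simp [X, monomial_mul]
  simp only [poly, coeff_add, coeff_C_mul, h, coeff_monomial, coeff_X_pow, coeff_X, coeff_C]
  simp [Finsupp.ext_iff, Fin.forall_fin_two, Finsupp.single_apply]

theorem isZero_of_poly_eq_zero {Q : TernaryForm R} (h : Q.poly = 0) : Q.IsZero := by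
  obtain ⟨h1, h2, h3, h4, h5, h6⟩ := Q.coeff_poly
  rw [h] at *
  exact ⟨h1.symm, h2.symm, h3.symm, h4.symm, h5.symm, h6.symm⟩

theorem coeff_eq_zero_of_poly_eq_C {Q : TernaryForm R} {r : R} (h : Q.poly = C r) :
    Q.a = 0 ∧ Q.b = 0 ∧ Q.d = 0 ∧ Q.e = 0 ∧ Q.f = 0 := by
  have h0 : (⟨Q.a, Q.b, Q.c - r, Q.d, Q.e, Q.f⟩ : TernaryForm R).poly = 0 := by
    have : (⟨Q.a, Q.b, Q.c - r, Q.d, Q.e, Q.f⟩ : TernaryForm R).poly = Q.poly - C r := by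
      simp only [poly, C_sub]; ring
    rw [this, h, sub_self]
  obtain ⟨h1, h2, h3, h4, h5, h6⟩ := isZero_of_poly_eq_zero h0
  exact ⟨h1, h2, h4, h5, h6⟩

theorem totalDegree_poly_le (Q : TernaryForm R) : Q.poly.totalDegree ≤ 2 := by
  unfold poly
  have hX (i : Fin 2) : (X i : MvPolynomial (Fin 2) R).totalDegree ≤ 1 := by
    rcases subsingleton_or_nontrivial R with h | h
    · simp [Subsingleton.elim (X i : MvPolynomial (Fin 2) R) 0]
    · simp
  have hC (r : R) (p : MvPolynomial (Fin 2) R) {n} (h : p.totalDegree ≤ n) :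
      (C r * p).totalDegree ≤ n := by
    refine (totalDegree_mul _ _).trans ?_
    simpa using h
  refine (totalDegree_add _ _).trans (max_le ?_ (by simp))
  refine (totalDegree_add _ _).trans (max_le ?_ (hC _ _ ((hX 1).trans (by norm_num))))
  refine (totalDegree_add _ _).trans (max_le ?_ (hC _ _ ((hX 0).trans (by norm_num))))
  refine (totalDegree_add _ _).trans (max_le ?_ (hC _ _
    ((totalDegree_pow _ _).trans (by have := hX 1; lia))))
  refine (totalDegree_add _ _).trans (max_le (hC _ _
    ((totalDegree_pow _ _).trans (by have := hX 0; lia))) (hC _ _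
    ((totalDegree_mul _ _).trans (by have := hX 0; have := hX 1; lia))))

theorem exists_linear_of_totalDegree_le_one {g : MvPolynomial (Fin 2) R}
    (hg : g.totalDegree ≤ 1) : ∃ p q r, g = C p * X 0 + C q * X 1 + C r := by
  refine ⟨coeff (Finsupp.single 0 1) g, coeff (Finsupp.single 1 1) g, coeff 0 g, ?_⟩
  ext m
  by_cases hm : m ∈ g.support
  · have h1 : m 0 + m 1 ≤ 1 := by
      have := (le_totalDegree hm).trans hg
      rwa [Finsupp.sum_fintype _ _ (by simp), Fin.sum_univ_two] at this
    have : m = 0 ∨ m = Finsupp.single 0 1 ∨ m = Finsupp.single 1 1 := by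
      simp only [Finsupp.ext_iff, Fin.forall_fin_two, Finsupp.single_apply, Finsupp.coe_zero,
        Pi.zero_apply]
      simp
      lia
    rcases this with rfl | rfl | rfl <;>
      simp [coeff_X, coeff_C, Finsupp.ext_iff, Fin.forall_fin_two, Finsupp.single_apply]
  · have h0 := notMem_support_iff.mp hm
    simp only [coeff_add, coeff_C_mul, coeff_X, coeff_C, h0]
    have e1 : (if Finsupp.single 0 1 = m then 1 else 0) * coeff (Finsupp.single 0 1) g = 0 := by
      split_ifs with h
      · rw [h, h0, mul_zero]
      · simp
    have e2 : (if Finsupp.single 1 1 = m then 1 else 0) * coeff (Finsupp.single 1 1) g = 0 := by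
      split_ifs with h
      · rw [h, h0, mul_zero]
      · simp
    have e3 : (if 0 = m then coeff 0 g else 0) = 0 := by
      split_ifs with h
      · rw [h, h0]
      · rfl
    rw [mul_comm, e1, mul_comm, e2, e3]; simp

end

variable {F : Type u} [Field F]

/-- A proper factorization would be into two factors of degree one, and the discriminant vanishes
identically on products of two linear forms. -/
theorem irreducible_poly (Q : TernaryForm F) (hQ : Q.disc ≠ 0) : Irreducible Q.poly := by
  have hnC (r : F) : Q.poly ≠ C r := fun h => by
    obtain ⟨h1, h2, h3, h4, h5⟩ := coeff_eq_zero_of_poly_eq_C h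
    exact hQ (by simp [disc, h1, h2, h3, h4, h5])
  have hunit {g : MvPolynomial (Fin 2) F} (hg0 : g ≠ 0) (hg : g.totalDegree = 0) : IsUnit g := by
    rw [totalDegree_eq_zero_iff_eq_C] at hg
    rw [hg] at hg0 ⊢
    exact (isUnit_iff_ne_zero.mpr fun h => hg0 (by rw [h, C_0])).map C
  refine ⟨fun h => ?_, fun g h hgh => ?_⟩
  · obtain ⟨r, -, hr⟩ := isUnit_iff_eq_C_of_isReduced.mp h
    exact hnC r hr
  · have hQ0 : Q.poly ≠ 0 := by rw [← C_0]; exact hnC 0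
    have hg0 : g ≠ 0 := fun h0 => hQ0 (by rw [hgh, h0, zero_mul])
    have hh0 : h ≠ 0 := fun h0 => hQ0 (by rw [hgh, h0, mul_zero])
    by_contra hcon
    rw [not_or] at hcon
    have h1 : g.totalDegree ≠ 0 := fun h0 => hcon.1 (hunit hg0 h0)
    have h2 : h.totalDegree ≠ 0 := fun h0 => hcon.2 (hunit hh0 h0)
    have h3 := Q.totalDegree_poly_le
    rw [hgh, totalDegree_mul_of_isDomain hg0 hh0] at h3
    obtain ⟨p, q, r, rfl⟩ := exists_linear_of_totalDegree_le_one (g := g) (by lia)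
    obtain ⟨p', q', r', rfl⟩ := exists_linear_of_totalDegree_le_one (g := h) (by lia)
    -- The six coefficients of the product are compared by packing the differences into one form
    -- with zero dehomogenization.
    have hz : (⟨Q.a - p * p', Q.b - q * q', Q.c - r * r', Q.d - (q * r' + q' * r),
        Q.e - (p * r' + p' * r), Q.f - (p * q' + p' * q)⟩ : TernaryForm F).poly = 0 := by
      have : Q.poly - (C p * X 0 + C q * X 1 + C r) * (C p' * X 0 + C q' * X 1 + C r') = 0 := by
        rw [hgh, sub_self]
      rw [← this]
      simp only [poly, C_sub, C_add, C_mul]; ring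
    obtain ⟨h1, h2, h3, h4, h5, h6⟩ := isZero_of_poly_eq_zero hz
    simp only [sub_eq_zero] at h1 h2 h3 h4 h5 h6
    refine hQ ?_
    rw [disc, h1, h2, h3, h4, h5, h6]
    ring

theorem isPrime_span_poly (Q : TernaryForm F) (hQ : Q.disc ≠ 0) :
    (Ideal.span {Q.poly}).IsPrime :=
  (Ideal.span_singleton_prime (Q.irreducible_poly hQ).ne_zero).mpr (Q.irreducible_poly hQ).prime

/-- A nonzero ternary form has a dehomogenization which is not a unit. -/
theorem exists_not_isUnit_poly (Q : TernaryForm F) (hQ : ¬ Q.IsZero) :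
    ∃ j, ¬ IsUnit (Q.chart j).poly := by
  by_contra! h
  -- Two charts suffice: constancy in the last one kills every coefficient except `c`, and constancy
  -- in the middle one kills `c`.
  have h0 := h 2
  have h1 := h 1
  obtain ⟨r, -, hr⟩ := isUnit_iff_eq_C_of_isReduced.mp h0
  obtain ⟨s, -, hs⟩ := isUnit_iff_eq_C_of_isReduced.mp h1
  have h2 := coeff_eq_zero_of_poly_eq_C hr
  have h3 := coeff_eq_zero_of_poly_eq_C hs
  simp [chart] at h2 h3
  exact hQ (by simp [IsZero, h2, h3])

/-- The hypotheses say that `(x, y, 1)` lies in the kernel of the Hessian matrix, so the Taylor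
expansion at `(x, y)` has only its quadratic part. The condition on the constant term comes out
doubled, hence the assumption on 2. -/
theorem poly_eq_of_vertex [NeZero (2 : F)] (Q : TernaryForm F) (x y : F)
    (h₁ : 2 * Q.a * x + Q.f * y + Q.e = 0) (h₂ : Q.f * x + 2 * Q.b * y + Q.d = 0)
    (h₃ : Q.e * x + Q.d * y + 2 * Q.c = 0) :
    Q.poly = C Q.a * (X 0 - C x) ^ 2 + C Q.f * ((X 0 - C x) * (X 1 - C y)) +
      C Q.b * (X 1 - C y) ^ 2 := by
  have h4 : Q.a * x ^ 2 + Q.f * (x * y) + Q.b * y ^ 2 = Q.c :=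
    mul_left_cancel₀ (two_ne_zero : (2 : F) ≠ 0) (by linear_combination x * h₁ + y * h₂ - h₃)
  have hf1 := congrArg (C (σ := Fin 2)) (eq_neg_of_add_eq_zero_right h₁)
  have hf2 := congrArg (C (σ := Fin 2)) (eq_neg_of_add_eq_zero_right h₂)
  have hf4 := congrArg (C (σ := Fin 2)) h4
  simp only [C_add, C_mul, C_neg, C_pow, map_ofNat] at hf1 hf2 hf4
  rw [poly, hf1, hf2, ← hf4]
  ring

/-- A degenerate conic has a vertex, in some affine chart. -/
theorem exists_vertex [NeZero (2 : F)] (Q : TernaryForm F) (hQ : Q.disc = 0) :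
    ∃ (j : Fin 3) (x y : F), (Q.chart j).poly =
      C (Q.chart j).a * (X 0 - C x) ^ 2 + C (Q.chart j).f * ((X 0 - C x) * (X 1 - C y)) +
        C (Q.chart j).b * (X 1 - C y) ^ 2 := by
  -- The Hessian matrix of the form. A kernel vector is a singular point of the projective conic,
  -- and a nonzero coordinate of it selects the chart.
  let M : Matrix (Fin 3) (Fin 3) F := !![2 * Q.a, Q.f, Q.e; Q.f, 2 * Q.b, Q.d; Q.e, Q.d, 2 * Q.c]
  have hM : M.det = 0 := by
    have : M.det = 2 * Q.disc := by
      simp only [M, Matrix.det_fin_three, disc, Matrix.of_apply, Matrix.cons_val]; ring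
    rw [this, hQ, mul_zero]
  obtain ⟨v, hv0, hv⟩ := Matrix.exists_mulVec_eq_zero_iff.mpr hM
  have e (i) := congrFun hv i
  have e0 := e 0
  have e1 := e 1
  have e2 := e 2
  simp [M, Matrix.mulVec, dotProduct, Fin.sum_univ_three] at e0 e1 e2
  obtain ⟨j, hj⟩ := Function.ne_iff.mp hv0
  rw [Pi.zero_apply] at hj
  refine ⟨j, v (j.succAbove 0) / v j, v (j.succAbove 1) / v j, poly_eq_of_vertex _ _ _ ?_ ?_ ?_⟩
  all_goals
    fin_cases j <;> simp [chart, Fin.succAbove] at hj ⊢ <;> field_simp <;> grind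

end TernaryForm

/-! ### Parametrization of a nondegenerate conic by lines through a rational point -/

namespace TernaryForm
open MvPolynomial

/-- The coordinate ring of the affine conic `Q.poly = 0`. -/
abbrev CoordRing {F : Type u} [Field F] (Q : TernaryForm F) : Type u :=
  MvPolynomial (Fin 2) F ⧸ Ideal.span {Q.poly}

section Parametrization

variable {K : Type u} [Field K] (Q : TernaryForm K)

/-- Both polynomials are irreducible, so divisibility would make them associated. Then the
dehomogenization has no quadratic part, and the discriminant vanishes when `a`, `b` and `f` do. -/
theorem X_sub_C_notMem_span_poly (hQ : Q.disc ≠ 0) (i : Fin 2) (x : K) :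
    (X i - C x : MvPolynomial (Fin 2) K) ∉ Ideal.span {Q.poly} := by
  intro h
  rw [Ideal.mem_span_singleton] at h
  have hirr : Irreducible (X i - C x : MvPolynomial (Fin 2) K) := by
    have hdeg : (X i - C x : MvPolynomial (Fin 2) K).totalDegree ≤ 1 :=
      (totalDegree_sub _ _).trans (by simp)
    exact (irreducible_of_totalDegree_eq_one (by
      refine le_antisymm hdeg (Nat.one_le_iff_ne_zero.mpr fun h0 => ?_)
      rw [totalDegree_eq_zero_iff_eq_C] at h0
      have := congrArg (coeff (Finsupp.single i 1)) h0
      simp [coeff_X, coeff_C, Finsupp.single_eq_zero, eq_comm] at this) (by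
      intro r hr
      have := hr (Finsupp.single i 1)
      simpa [coeff_X, coeff_C, Finsupp.single_eq_zero, eq_comm, isUnit_iff_dvd_one] using this))
  have hassoc := (Q.irreducible_poly hQ).associated_of_dvd hirr h
  obtain ⟨u, hu⟩ := hassoc.symm
  obtain ⟨r, -, hr⟩ := isUnit_iff_eq_C_of_isReduced.mp u.isUnit
  rw [hr] at hu
  obtain ⟨h1, h2, -, -, -, h6⟩ := Q.coeff_poly
  rw [← hu] at h1 h2 h6
  have hz : ∀ m : Fin 2 →₀ ℕ, m 0 + m 1 = 2 → coeff m ((X i - C x) * C r) = 0 := by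
    intro m hm
    rw [mul_comm, coeff_C_mul, coeff_sub, coeff_X, coeff_C, if_neg, if_neg, sub_zero, mul_zero]
    · rintro rfl; simp at hm
    · rintro rfl; fin_cases i <;> simp at hm
  rw [hz _ (by simp)] at h1 h2 h6
  refine hQ ?_
  simp [disc, ← h1, ← h2, ← h6]

/-- A conic with nonzero discriminant and a rational point is parametrized by the slope of the
lines through the point. -/
theorem exists_fractionRing_equiv (hQ : Q.disc ≠ 0) (x y : K) (hxy : eval ![x, y] Q.poly = 0)
    (L : Type u) [Field L] [Algebra Q.CoordRing L] [IsFractionRing Q.CoordRing L] [Algebra K L]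
    [IsScalarTower K Q.CoordRing L] :
    Nonempty (FractionRing (Polynomial K) ≃ₐ[K] L) := by
  have hp := Q.isPrime_span_poly hQ
  let mk : MvPolynomial (Fin 2) K →ₐ[K] Q.CoordRing := Ideal.Quotient.mkₐ K _
  let g : MvPolynomial (Fin 2) K →ₐ[K] L := (IsScalarTower.toAlgHom K Q.CoordRing L).comp mk
  have hg (p) : g p = algebraMap Q.CoordRing L (mk p) := rfl
  have hinj : Function.Injective (algebraMap Q.CoordRing L) := IsFractionRing.injective _ _
  have hmk (p) : mk p = 0 ↔ p ∈ Ideal.span {Q.poly} := Ideal.Quotient.eq_zero_iff_mem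
  let u : L := g (X 0 - C x)
  let v : L := g (X 1 - C y)
  have hu0 : u ≠ 0 := fun h => Q.X_sub_C_notMem_span_poly hQ 0 x
    ((hmk _).mp (hinj (by rw [map_zero, ← hg]; exact h)))
  have hgC (r : K) : g (C r) = algebraMap K L r := g.commutes r
  -- `δ` and `ε` are the partial derivatives at the point `(x, y)`. In the coordinates centred
  -- there, the conic has linear part `δ u + ε v`.
  let δ : K := 2 * Q.a * x + Q.f * y + Q.e
  let ε : K := Q.f * x + 2 * Q.b * y + Q.d
  have hφ : Q.a * x ^ 2 + Q.f * (x * y) + Q.b * y ^ 2 + Q.e * x + Q.d * y + Q.c = 0 := by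
    simpa [poly] using hxy
  have hdisc : Q.disc = δ * ε * Q.f - Q.a * ε ^ 2 - Q.b * δ ^ 2 := by
    simp only [disc, δ, ε]
    linear_combination (4 * Q.a * Q.b - Q.f ^ 2) * hφ
  have hrel : algebraMap K L Q.a * u ^ 2 + algebraMap K L Q.f * (u * v) +
      algebraMap K L Q.b * v ^ 2 + algebraMap K L δ * u + algebraMap K L ε * v = 0 := by
    have h1 : g Q.poly = 0 := by
      rw [hg, (hmk _).mpr (Ideal.mem_span_singleton_self _), map_zero]
    have h2 := congrArg (algebraMap K L) hφ
    simp only [map_add, map_mul, map_pow, map_zero] at h2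
    simp only [poly, map_add, map_mul, map_pow, hgC] at h1
    simp only [u, v, δ, ε, map_add, map_sub, map_mul, hgC, map_ofNat]
    linear_combination h1 - h2
  -- The slope of the line through the point. Dividing the equation by `u` makes it linear in `u`,
  -- so `u` is a rational function of `t`.
  let t : L := v / u
  have hv : v = t * u := by simp only [t]; field_simp
  have hrel' : u * (algebraMap K L Q.a + algebraMap K L Q.f * t + algebraMap K L Q.b * t ^ 2) =
      - (algebraMap K L δ + algebraMap K L ε * t) := by
    refine mul_left_cancel₀ hu0 ?_
    rw [hv] at hrel
    linear_combination hrel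
  -- If the denominator vanishes, so does the numerator. Up to sign the discriminant is the
  -- resultant of `δ + ε t` and `a + f t + b t²`, so it would vanish as well.
  have hden : algebraMap K L Q.a + algebraMap K L Q.f * t + algebraMap K L Q.b * t ^ 2 ≠ 0 := by
    intro h0
    have h1 : algebraMap K L δ + algebraMap K L ε * t = 0 := by
      rw [h0, mul_zero] at hrel'
      linear_combination hrel'
    have h2 : algebraMap K L Q.disc = 0 := by
      rw [hdisc]
      simp only [map_sub, map_mul, map_pow]
      linear_combination (algebraMap K L ε * algebraMap K L Q.f - algebraMap K L Q.b *
        (algebraMap K L δ - algebraMap K L ε * t)) * h1 - algebraMap K L ε ^ 2 * h0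
    exact hQ ((map_eq_zero _).mp h2)
  have hu : u = - (algebraMap K L δ + algebraMap K L ε * t) /
      (algebraMap K L Q.a + algebraMap K L Q.f * t + algebraMap K L Q.b * t ^ 2) := by
    rw [eq_div_iff hden, hrel']
  -- Used twice: for the algebraic closure of `K` in `L`, to prove `t` transcendental, and for the
  -- image of `K(t)`, to prove surjectivity.
  have hgen (E : IntermediateField K L) (ht : t ∈ E) : E = ⊤ := by
    have hC (r : K) : algebraMap K L r ∈ E := E.algebraMap_mem r
    have huE : u ∈ E := by
      rw [hu]
      exact E.div_mem (E.neg_mem (E.add_mem (hC _) (E.mul_mem (hC _) ht)))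
        (E.add_mem (E.add_mem (hC _) (E.mul_mem (hC _) ht)) (E.mul_mem (hC _) (pow_mem ht _)))
    have hvE : v ∈ E := by rw [hv]; exact E.mul_mem ht huE
    have hX : ∀ i, g (X i) ∈ E := by
      intro i
      fin_cases i
      · have : g (X 0) = u + algebraMap K L x := by simp [u, hgC]
        simp only [Fin.zero_eta]
        rw [this]
        exact E.add_mem huE (hC _)
      · have : g (X 1) = v + algebraMap K L y := by simp [v, hgC]
        simp only [Fin.mk_one]
        rw [this]
        exact E.add_mem hvE (hC _)
    have hgE (p : MvPolynomial (Fin 2) K) : g p ∈ E := by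
      induction p using MvPolynomial.induction_on with
      | C r => rw [hgC]; exact hC r
      | add p q hp hq => rw [map_add]; exact E.add_mem hp hq
      | mul_X p i hp => rw [map_mul]; exact E.mul_mem hp (hX i)
    rw [eq_top_iff]
    intro z _
    obtain ⟨a, b, -, rfl⟩ := IsFractionRing.div_surjective (A := Q.CoordRing) z
    obtain ⟨a, rfl⟩ := Ideal.Quotient.mk_surjective a
    obtain ⟨b, rfl⟩ := Ideal.Quotient.mk_surjective b
    exact E.div_mem (hgE a) (hgE b)
  have htr : Transcendental K t := by
    intro halg
    have halgL : Algebra.IsAlgebraic K L := by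
      have := hgen (algebraicClosure K L) ((mem_algebraicClosure_iff).mpr halg)
      exact ⟨fun z => mem_algebraicClosure_iff.mp (this ▸ IntermediateField.mem_top)⟩
    -- If `t` were algebraic, the coordinate ring would be a domain integral over `K`, hence a
    -- field; but evaluation at the rational point has the nonzero element `X 0 - C x` in its
    -- kernel.
    have hA : Algebra.IsIntegral K Q.CoordRing := ⟨fun z => by
      have := (halgL.isAlgebraic (algebraMap _ L z)).isIntegral
      exact (isIntegral_algHom_iff (IsScalarTower.toAlgHom K Q.CoordRing L) hinj).mp this⟩
    have hF : IsField Q.CoordRing := isField_of_isIntegral_of_isField' (Field.toIsField K)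
    let _ := hF.toField
    let ev : Q.CoordRing →+* K := Ideal.Quotient.lift _ (eval ![x, y]) (fun p hp => by
      rw [Ideal.mem_span_singleton] at hp
      obtain ⟨r, rfl⟩ := hp
      rw [map_mul, hxy, zero_mul])
    have h0 : ev (mk (X 0 - C x)) = 0 := by
      change eval ![x, y] (X 0 - C x) = 0
      simp
    exact Q.X_sub_C_notMem_span_poly hQ 0 x ((hmk _).mp ((map_eq_zero ev).mp h0))
  have htinj : Function.Injective (Polynomial.aeval t : Polynomial K →ₐ[K] L) :=
    transcendental_iff_injective.mp htr
  let Ψ : FractionRing (Polynomial K) →ₐ[K] L := IsFractionRing.liftAlgHom htinj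
  have hΨ : Function.Surjective Ψ := by
    have := hgen Ψ.fieldRange ⟨algebraMap (Polynomial K) _ Polynomial.X, by
      simp [Ψ, IsFractionRing.liftAlgHom_apply]⟩
    intro z
    have hz : z ∈ Ψ.fieldRange := this ▸ IntermediateField.mem_top
    exact hz
  exact ⟨AlgEquiv.ofBijective Ψ ⟨RingHom.injective _, hΨ⟩⟩

end Parametrization

/-! ### Base change of affine conics -/

section BaseChange

variable {F K : Type u} [Field F] [Field K] (φ : F →+* K) (Q : TernaryForm F)

/-- The map of coordinate rings induced by a field extension. -/
def coordRingMap : Q.CoordRing →+* (Q.map φ).CoordRing :=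
  Ideal.Quotient.lift _ ((Ideal.Quotient.mk _).comp (MvPolynomial.map φ)) (fun p hp => by
    rw [Ideal.mem_span_singleton] at hp
    obtain ⟨r, rfl⟩ := hp
    rw [RingHom.comp_apply, map_mul, map_mul, ← poly_map,
      Ideal.Quotient.eq_zero_iff_mem.mpr (Ideal.mem_span_singleton_self _), zero_mul])

theorem coordRingMap_mk (p : MvPolynomial (Fin 2) F) :
    Q.coordRingMap φ (Ideal.Quotient.mk _ p) = Ideal.Quotient.mk _ (MvPolynomial.map φ p) := rfl

theorem isPushout_coordRing :
    IsPushout (CommRingCat.ofHom (algebraMap F Q.CoordRing)) (CommRingCat.ofHom φ)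
      (CommRingCat.ofHom (Q.coordRingMap φ))
      (CommRingCat.ofHom (algebraMap K (Q.map φ).CoordRing)) := by
  have w : CommRingCat.ofHom (algebraMap F Q.CoordRing) ≫ CommRingCat.ofHom (Q.coordRingMap φ) =
      CommRingCat.ofHom φ ≫ CommRingCat.ofHom (algebraMap K (Q.map φ).CoordRing) := by
    ext r
    change Q.coordRingMap φ (Ideal.Quotient.mk _ (C r)) = Ideal.Quotient.mk _ (C (φ r))
    rw [coordRingMap_mk, map_C]
  refine ⟨⟨w⟩, ⟨PushoutCocone.IsColimit.mk w
    (fun s => CommRingCat.ofHom (Ideal.Quotient.lift _ (eval₂Hom s.inr.hom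
      (fun i => s.inl.hom (Ideal.Quotient.mk _ (X i)))) ?_)) ?_ ?_ ?_⟩⟩
  · intro p hp
    rw [Ideal.mem_span_singleton] at hp
    obtain ⟨r, rfl⟩ := hp
    have hs : (eval₂Hom s.inr.hom (fun i => s.inl.hom (Ideal.Quotient.mk _ (X i)))).comp
        (MvPolynomial.map φ) = s.inl.hom.comp (Ideal.Quotient.mk (Ideal.span {Q.poly})) := by
      refine MvPolynomial.ringHom_ext (fun r => ?_) (fun i => by simp)
      rw [RingHom.comp_apply, map_C, coe_eval₂Hom, eval₂_C]
      exact (ConcreteCategory.congr_hom s.condition r).symm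
    have := RingHom.congr_fun hs Q.poly
    rw [RingHom.comp_apply, RingHom.comp_apply,
      Ideal.Quotient.eq_zero_iff_mem.mpr (Ideal.mem_span_singleton_self _), map_zero] at this
    rw [map_mul, poly_map, this, zero_mul]
  · intro s
    refine CommRingCat.hom_ext (RingHom.ext fun x => ?_)
    obtain ⟨x, rfl⟩ := Ideal.Quotient.mk_surjective x
    have hs : (eval₂Hom s.inr.hom (fun i => s.inl.hom (Ideal.Quotient.mk _ (X i)))).comp
        (MvPolynomial.map φ) = s.inl.hom.comp (Ideal.Quotient.mk (Ideal.span {Q.poly})) := by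
      refine MvPolynomial.ringHom_ext (fun r => ?_) (fun i => by simp)
      rw [RingHom.comp_apply, map_C, coe_eval₂Hom, eval₂_C]
      exact (ConcreteCategory.congr_hom s.condition r).symm
    exact RingHom.congr_fun hs x
  · intro s
    ext r
    exact eval₂_C _ _ r
  · intro s m h₁ h₂
    refine CommRingCat.hom_ext (RingHom.ext fun x => ?_)
    obtain ⟨x, rfl⟩ := Ideal.Quotient.mk_surjective x
    have : m.hom.comp (Ideal.Quotient.mk _) =
        eval₂Hom s.inr.hom (fun i => s.inl.hom (Ideal.Quotient.mk _ (X i))) := by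
      refine MvPolynomial.ringHom_ext (fun r => ?_) (fun i => ?_)
      · rw [coe_eval₂Hom, eval₂_C]
        exact ConcreteCategory.congr_hom h₂ r
      · have := ConcreteCategory.congr_hom h₁ (Ideal.Quotient.mk _ (X i))
        simp only [CommRingCat.hom_comp, CommRingCat.hom_ofHom, RingHom.comp_apply,
          coordRingMap_mk, map_X] at this
        simpa using this
    exact RingHom.congr_fun this x

end BaseChange

/-! ### Homogeneous quadratic forms in three variables -/

section Homogeneous

variable {F : Type u} [Field F]

/-- The polynomial `a x₀² + b x₁² + c x₂² + d x₁ x₂ + e x₀ x₂ + f x₀ x₁`. -/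
def homogenization (Q : TernaryForm F) : MvPolynomial (Fin 3) F :=
  C Q.a * X 0 ^ 2 + C Q.b * X 1 ^ 2 + C Q.c * X 2 ^ 2 + C Q.d * (X 1 * X 2) +
    C Q.e * (X 0 * X 2) + C Q.f * (X 0 * X 1)

theorem exists_eq_homogenization {q : MvPolynomial (Fin 3) F} (hq : q.IsHomogeneous 2) :
    ∃ Q : TernaryForm F, q = Q.homogenization := by
  let s (i j : Fin 3) : Fin 3 →₀ ℕ := Finsupp.single i 1 + Finsupp.single j 1
  have hs (i j : Fin 3) : (X i * X j : MvPolynomial (Fin 3) F) = monomial (s i j) 1 := by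
    simp [X, monomial_mul, s]
  refine ⟨⟨coeff (s 0 0) q, coeff (s 1 1) q, coeff (s 2 2) q, coeff (s 1 2) q, coeff (s 0 2) q,
    coeff (s 0 1) q⟩, ?_⟩
  simp only [homogenization, pow_two, hs]
  ext m
  simp only [coeff_add, coeff_C_mul, coeff_monomial]
  by_cases hm : m 0 + m 1 + m 2 = 2
  · have : m = s 0 0 ∨ m = s 1 1 ∨ m = s 2 2 ∨ m = s 1 2 ∨ m = s 0 2 ∨ m = s 0 1 := by
      simp only [s, Finsupp.ext_iff, Fin.forall_fin_succ, Finsupp.add_apply, Finsupp.single_apply]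
      simp
      lia
    rcases this with rfl | rfl | rfl | rfl | rfl | rfl <;>
      simp [s, Finsupp.ext_iff, Fin.forall_fin_succ, Finsupp.single_apply]
  · have h0 : coeff m q = 0 := by
      by_contra h
      have := hq h
      rw [Finsupp.weight_apply, Finsupp.sum_fintype _ _ (by simp)] at this
      simp [Fin.sum_univ_three] at this
      exact hm this
    have hne (i j) : s i j ≠ m := by
      rintro rfl
      apply hm
      fin_cases i <;> fin_cases j <;> simp [s]
    simp [h0, hne]

theorem aeval_insertNth_homogenization (Q : TernaryForm F) (j : Fin 3) :
    aeval (j.insertNth (α := fun _ => MvPolynomial (Fin 2) F) 1 X) Q.homogenization =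
      (Q.chart j).poly := by
  have e (j : Fin 3) (i : Fin 2) :
      j.insertNth (α := fun _ => MvPolynomial (Fin 2) F) 1 X (j.succAbove i) = X i :=
    Fin.insertNth_apply_succAbove ..
  have e' (j : Fin 3) : j.insertNth (α := fun _ => MvPolynomial (Fin 2) F) 1 X j = 1 :=
    Fin.insertNth_apply_same ..
  simp only [homogenization, poly, map_add, map_mul, map_pow, aeval_X, algHom_C, algebraMap_eq]
  fin_cases j
  · have h0 := e' 0
    have h1 : Fin.insertNth (α := fun _ => MvPolynomial (Fin 2) F) 0 1 X 1 = X 0 := e 0 0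
    have h2 : Fin.insertNth (α := fun _ => MvPolynomial (Fin 2) F) 0 1 X 2 = X 1 := e 0 1
    simp only [Fin.zero_eta, h0, h1, h2]
    simp [chart]
    ring
  · have h0 : Fin.insertNth (α := fun _ => MvPolynomial (Fin 2) F) 1 1 X 0 = X 0 := e 1 0
    have h1 := e' 1
    have h2 : Fin.insertNth (α := fun _ => MvPolynomial (Fin 2) F) 1 1 X 2 = X 1 := e 1 1
    simp only [Fin.mk_one, h0, h1, h2]
    simp [chart]
    ring
  · have h0 : Fin.insertNth (α := fun _ => MvPolynomial (Fin 2) F) 2 1 X 0 = X 0 := e 2 0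
    have h1 : Fin.insertNth (α := fun _ => MvPolynomial (Fin 2) F) 2 1 X 1 = X 1 := e 2 1
    have h2 := e' 2
    simp only [Fin.reduceFinMk, h0, h1, h2]
    simp [chart]
    ring

theorem homogenization_eq_zero {Q : TernaryForm F} (h : Q.IsZero) : Q.homogenization = 0 := by
  obtain ⟨h1, h2, h3, h4, h5, h6⟩ := h
  simp [homogenization, h1, h2, h3, h4, h5, h6]

end Homogeneous

/-! ### Failure of normality at the vertex of a degenerate conic -/

section Vertex

variable {F : Type u} [Field F] (Q : TernaryForm F)

/-- If the local rings of all affine charts of a conic are integrally closed in von Neumann regular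
rings, then the conic is nondegenerate. -/
theorem disc_ne_zero_of_isNormalInRegular [NeZero (2 : F)] (hQ : ¬ Q.IsZero)
    (h : ∀ (j : Fin 3) (p : Ideal (Q.chart j).CoordRing) [p.IsPrime],
      IsNormalInRegular (Localization.AtPrime p)) : Q.disc ≠ 0 := by
  intro hdisc
  obtain ⟨j, x, y, hv⟩ := Q.exists_vertex hdisc
  rw [← Q.isZero_chart j] at hQ
  specialize h j
  generalize Q.chart j = Q' at *
  -- The first-order Taylor expansion at the vertex. It kills the equation of the conic, which is
  -- purely quadratic there, so it descends to the coordinate ring and then to the local ring of the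
  -- vertex.
  let ψ : MvPolynomial (Fin 2) F →+* TrivSqZeroExt F (F × F) :=
    eval₂Hom (TrivSqZeroExt.inlHom F (F × F)) ![.inl x + .inr (1, 0), .inl y + .inr (0, 1)]
  have hψC (r : F) : ψ (C r) = .inl r := eval₂_C _ _ r
  have hψ0 : ψ (X 0 - C x) = .inr (1, 0) := by rw [map_sub, hψC]; simp [ψ]
  have hψ1 : ψ (X 1 - C y) = .inr (0, 1) := by rw [map_sub, hψC]; simp [ψ]
  have hψ : ψ Q'.poly = 0 := by
    rw [hv]
    simp only [map_add, map_mul, hψ0, hψ1, pow_two, TrivSqZeroExt.inr_mul_inr, mul_zero,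
      add_zero]
  let φ : Q'.CoordRing →+* TrivSqZeroExt F (F × F) := Ideal.Quotient.lift _ ψ (fun p hp => by
    rw [Ideal.mem_span_singleton] at hp
    obtain ⟨r, rfl⟩ := hp
    rw [map_mul, hψ, zero_mul])
  let p : Ideal Q'.CoordRing := RingHom.ker ((TrivSqZeroExt.fstHom F F (F × F)).toRingHom.comp φ)
  have : p.IsPrime := RingHom.ker_isPrime _
  have hunit (z : p.primeCompl) : IsUnit (φ z) := by
    rw [TrivSqZeroExt.isUnit_iff_isUnit_fst, isUnit_iff_ne_zero]
    exact z.2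
  let Φ : Localization.AtPrime p →+* TrivSqZeroExt F (F × F) := IsLocalization.lift hunit
  let g : MvPolynomial (Fin 2) F →+* Localization.AtPrime p :=
    (algebraMap Q'.CoordRing _).comp (Ideal.Quotient.mk _)
  have hΦ (z) : Φ (g z) = ψ z := IsLocalization.lift_eq hunit _
  obtain ⟨h1, h2, h3⟩ := (h p).quadratic_coeff_eq_zero Φ (g.comp C) (g (X 0 - C x)) (g (X 1 - C y))
    (by rw [hΦ, hψ0]) (by rw [hΦ, hψ1]) Q'.a Q'.f Q'.b
    (fun r => by rw [RingHom.comp_apply, hΦ, hψC]) (by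
      simp only [RingHom.comp_apply g C]
      rw [← map_pow, ← map_pow, ← map_mul, ← map_mul, ← map_mul, ← map_mul, ← map_add, ← map_add,
        ← hv]
      simp only [g, RingHom.comp_apply]
      rw [Ideal.Quotient.eq_zero_iff_mem.mpr (Ideal.mem_span_singleton_self _), map_zero])
  refine hQ (isZero_of_poly_eq_zero ?_)
  rw [hv, h1, h2, h3]
  simp

end Vertex

end TernaryForm

/-! ### Standard charts of projective space -/

theorem eval₂_mul_of_isHomogeneous {σ R S : Type*} [Fintype σ] [CommSemiring R] [CommSemiring S]
    (f : R →+* S) (u : S) (g : σ → S) {n : ℕ} {a : MvPolynomial σ R} (ha : a.IsHomogeneous n) :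
    a.eval₂ f (fun l => u * g l) = u ^ n * a.eval₂ f g := by
  rw [MvPolynomial.eval₂_eq', MvPolynomial.eval₂_eq', Finset.mul_sum]
  refine Finset.sum_congr rfl fun d hd => ?_
  have h := ha (MvPolynomial.mem_support_iff.mp hd)
  rw [Finsupp.weight_apply, Finsupp.sum_fintype _ _ (by simp)] at h
  simp only [Pi.one_apply, smul_eq_mul, mul_one] at h
  simp only [mul_pow, Finset.prod_mul_distrib, Finset.prod_pow_eq_pow_sum, h]
  ring

namespace ProjSpace

variable (N : ℕ) (F : Type u) [Field F]

/-- The coordinate ring of the standard chart `D₊(x_j)`. -/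
abbrev ChartRing (j : Fin (N + 1)) : Type u :=
  HomogeneousLocalization.Away (stdGrading N F) (MvPolynomial.X j)

/-- The constants in the coordinate ring of a standard chart. -/
def chartConst (j : Fin (N + 1)) : F →+* ChartRing N F j :=
  (HomogeneousLocalization.fromZeroRingHom (stdGrading N F) _).comp
    (algebraMap F (stdGrading N F 0))

/-- The function `x_l / x_j` on the chart `D₊(x_j)`. -/
def chartCoord (j l : Fin (N + 1)) : ChartRing N F j :=
  HomogeneousLocalization.Away.mk (stdGrading N F) (X_mem_stdGrading N F j) 1 (MvPolynomial.X l)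
    (by simpa using X_mem_stdGrading N F l)

theorem val_chartConst (j : Fin (N + 1)) (a : F) :
    (chartConst N F j a).val = algebraMap (MvPolynomial (Fin (N + 1)) F) _ (MvPolynomial.C a) :=
  rfl

theorem val_chartCoord (j l : Fin (N + 1)) :
    (chartCoord N F j l).val =
      Localization.mk (MvPolynomial.X l)
        (⟨MvPolynomial.X j ^ 1, 1, rfl⟩ :
          Submonoid.powers (MvPolynomial.X j : MvPolynomial (Fin (N + 1)) F)) :=
  HomogeneousLocalization.Away.val_mk _ _ _ _ _

theorem chartCoord_self (j : Fin (N + 1)) : chartCoord N F j j = 1 := by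
  apply HomogeneousLocalization.val_injective
  rw [val_chartCoord, HomogeneousLocalization.val_one]
  convert Localization.mk_self (⟨MvPolynomial.X j ^ 1, 1, rfl⟩ :
    Submonoid.powers (MvPolynomial.X j : MvPolynomial (Fin (N + 1)) F))
  simp

/-- In the localization `x_l / x_j` is `u * x_l` with `u = 1 / x_j`, and homogeneity pulls out `u ^
n`. Since fractions `a / x_j ^ n` exhaust the chart ring, it is generated by constants and
coordinates. -/
theorem eval₂_chartCoord (j : Fin (N + 1)) (n : ℕ) (a : MvPolynomial (Fin (N + 1)) F)
    (ha : a.IsHomogeneous n) :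
    a.eval₂ (chartConst N F j) (chartCoord N F j) =
      HomogeneousLocalization.Away.mk (stdGrading N F) (X_mem_stdGrading N F j) n a
        (by simpa using ha) := by
  apply HomogeneousLocalization.val_injective
  rw [HomogeneousLocalization.Away.val_mk]
  have h1 : (a.eval₂ (chartConst N F j) (chartCoord N F j)).val =
      algebraMap (ChartRing N F j) (Localization.Away (MvPolynomial.X j))
        (a.eval₂ (chartConst N F j) (chartCoord N F j)) := rfl
  rw [h1, MvPolynomial.hom_eval₂]
  let u : Localization.Away (MvPolynomial.X j : MvPolynomial (Fin (N + 1)) F) :=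
    Localization.mk 1 ⟨MvPolynomial.X j, 1, by simp⟩
  let ψ := algebraMap (MvPolynomial (Fin (N + 1)) F)
    (Localization.Away (MvPolynomial.X j : MvPolynomial (Fin (N + 1)) F))
  have h2 : (fun l => algebraMap (ChartRing N F j) (Localization.Away (MvPolynomial.X j))
      (chartCoord N F j l)) = fun l => u * ψ (MvPolynomial.X l) := by
    funext l
    change (chartCoord N F j l).val = _
    rw [val_chartCoord, mul_comm, ← Algebra.smul_def, Localization.smul_mk]
    simp
  have h3 : (algebraMap (ChartRing N F j) (Localization.Away (MvPolynomial.X j))).comp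
      (chartConst N F j) = ψ.comp MvPolynomial.C := rfl
  rw [h2, h3, eval₂_mul_of_isHomogeneous _ _ _ ha,
    ← MvPolynomial.hom_eval₂, MvPolynomial.eval₂_eta, mul_comm,
    ← Algebra.smul_def]
  simp only [u, Localization.mk_pow, Localization.smul_mk]
  simp only [one_pow, smul_eq_mul, mul_one]
  rfl

theorem exists_isHomogeneous_eval₂ (j : Fin (N + 1)) (z : ChartRing N F j) :
    ∃ (n : ℕ) (a : MvPolynomial (Fin (N + 1)) F), a.IsHomogeneous n ∧
      a.eval₂ (chartConst N F j) (chartCoord N F j) = z := by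
  obtain ⟨n, a, ha, rfl⟩ :=
    HomogeneousLocalization.Away.mk_surjective (stdGrading N F) (X_mem_stdGrading N F j) z
  have ha' : a.IsHomogeneous n := by simpa using ha
  exact ⟨n, a, ha', eval₂_chartCoord N F j n a ha'⟩

theorem chartRing_hom_ext {R : Type*} [CommRing R] {j : Fin (N + 1)} {φ ψ : ChartRing N F j →+* R}
    (h1 : φ.comp (chartConst N F j) = ψ.comp (chartConst N F j))
    (h2 : ∀ l, φ (chartCoord N F j l) = ψ (chartCoord N F j l)) : φ = ψ := by
  ext z
  obtain ⟨n, a, -, rfl⟩ := exists_isHomogeneous_eval₂ N F j z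
  rw [MvPolynomial.hom_eval₂, MvPolynomial.hom_eval₂, h1]
  congr 1
  funext l
  exact h2 l

/-- The ring homomorphism from the coordinate ring of `D₊(x_j)` given by the values of the
coordinates `x_l / x_j`. -/
def chartLift {R : Type*} [CommRing R] (j : Fin (N + 1)) (φ : F →+* R) (r : Fin (N + 1) → R)
    (hr : r j = 1) : ChartRing N F j →+* R :=
  (Localization.awayLift (MvPolynomial.eval₂Hom φ r) (MvPolynomial.X j) (by simp [hr])).comp
    (algebraMap (ChartRing N F j) (Localization.Away (MvPolynomial.X j)))

variable {N F}

theorem chartLift_chartConst {R : Type*} [CommRing R] (j : Fin (N + 1)) (φ : F →+* R)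
    (r : Fin (N + 1) → R) (hr : r j = 1) (a : F) :
    chartLift N F j φ r hr (chartConst N F j a) = φ a := by
  change Localization.awayLift (MvPolynomial.eval₂Hom φ r) _ (by simp [hr])
    (chartConst N F j a).val = _
  rw [val_chartConst]
  erw [IsLocalization.lift_eq]
  simp

theorem chartLift_chartCoord {R : Type*} [CommRing R] (j : Fin (N + 1)) (φ : F →+* R)
    (r : Fin (N + 1) → R) (hr : r j = 1) (l : Fin (N + 1)) :
    chartLift N F j φ r hr (chartCoord N F j l) = r l := by
  change Localization.awayLift (MvPolynomial.eval₂Hom φ r) _ (by simp [hr])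
    (chartCoord N F j l).val = _
  rw [val_chartCoord, Localization.awayLift_mk (v := 1) (hv := by simp [hr])]
  simp

variable (N F)

/-- The standard chart `D₊(x_j)` is affine space. -/
def chartEquiv (j : Fin (N + 1)) : MvPolynomial (Fin N) F ≃+* ChartRing N F j :=
  RingEquiv.ofRingHom
    (MvPolynomial.eval₂Hom (chartConst N F j) (fun i => chartCoord N F j (j.succAbove i)))
    (chartLift N F j MvPolynomial.C (j.insertNth (α := fun _ => MvPolynomial (Fin N) F)
      1 MvPolynomial.X) (by simp))
    (by
      apply chartRing_hom_ext
      · ext a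
        simp [chartLift_chartConst]
      · intro l
        rcases Fin.eq_self_or_eq_succAbove j l with rfl | ⟨i, rfl⟩
        · simp [chartCoord_self]
        · simp [chartLift_chartCoord])
    (by
      apply MvPolynomial.ringHom_ext
      · intro a
        simp [chartLift_chartConst]
      · intro i
        simp [chartLift_chartCoord])

theorem chartEquiv_C (j : Fin (N + 1)) (a : F) :
    chartEquiv N F j (MvPolynomial.C a) = chartConst N F j a := by
  simp [chartEquiv]

theorem chartEquiv_X (j : Fin (N + 1)) (i : Fin N) :
    chartEquiv N F j (MvPolynomial.X i) = chartCoord N F j (j.succAbove i) := by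
  simp [chartEquiv]

theorem chartEquiv_aeval_insertNth (j : Fin (N + 1)) (n : ℕ) (a : MvPolynomial (Fin (N + 1)) F)
    (ha : a.IsHomogeneous n) :
    chartEquiv N F j (MvPolynomial.aeval
        (j.insertNth (α := fun _ => MvPolynomial (Fin N) F) 1 MvPolynomial.X) a) =
      HomogeneousLocalization.Away.mk (stdGrading N F) (X_mem_stdGrading N F j) n a
        (by simpa using ha) := by
  rw [← eval₂_chartCoord N F j n a ha, MvPolynomial.aeval_def, MvPolynomial.algebraMap_eq]
  have := MvPolynomial.hom_eval₂ a MvPolynomial.C (chartEquiv N F j).toRingHom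
    (j.insertNth (α := fun _ => MvPolynomial (Fin N) F) 1 MvPolynomial.X)
  refine Eq.trans this ?_
  congr 1
  · ext a
    exact congrArg _ (chartEquiv_C N F j a)
  · funext l
    rcases Fin.eq_self_or_eq_succAbove j l with rfl | ⟨i, rfl⟩
    · simp [chartCoord_self]
    · simpa using chartEquiv_X N F j i

/-- The inclusion of the standard chart `D₊(x_j)`. -/
def chartι (j : Fin (N + 1)) : Spec (.of (ChartRing N F j)) ⟶ ProjSpace N F :=
  Proj.awayι (stdGrading N F) (MvPolynomial.X j) (X_mem_stdGrading N F j) Nat.one_pos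

instance (j : Fin (N + 1)) : IsOpenImmersion (chartι N F j) :=
  inferInstanceAs (IsOpenImmersion (Proj.awayι _ _ _ _))

theorem opensRange_chartι (j : Fin (N + 1)) : (chartι N F j).opensRange = (chart N F j).1 :=
  Proj.opensRange_awayι _ _ _ _

theorem chartι_toSpec (j : Fin (N + 1)) :
    chartι N F j ≫ toSpec N F = Spec.map (CommRingCat.ofHom (chartConst N F j)) := by
  unfold chartι toSpec
  erw [Proj.awayι_toSpecZero_assoc]
  rw [← Spec.map_comp]
  rfl

theorem exists_mem_chart (x : ProjSpace N F) : ∃ j, x ∈ (chart N F j).1 := by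
  have h : ⨆ j, Proj.basicOpen (stdGrading N F) (MvPolynomial.X j) = ⊤ := by
    apply Proj.iSup_basicOpen_eq_top'
    · intro j
      exact ⟨1, X_mem_stdGrading N F j⟩
    · rw [eq_top_iff]
      intro p _
      have := MvPolynomial.adjoin_range_X (R := F) (σ := Fin (N + 1))
      have hp : p ∈ Algebra.adjoin F (Set.range (MvPolynomial.X (R := F) (σ := Fin (N + 1)))) := by
        rw [this]; trivial
      induction hp using Algebra.adjoin_induction with
      | mem x hx => exact Algebra.subset_adjoin hx
      | algebraMap r =>
        exact Subalgebra.algebraMap_mem _ (algebraMap F (stdGrading N F 0) r)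
      | add x y _ _ hx hy => exact add_mem (hx trivial) (hy trivial)
      | mul x y _ _ hx hy => exact mul_mem (hx trivial) (hy trivial)
  have hx : x ∈ ⨆ j, Proj.basicOpen (stdGrading N F) (MvPolynomial.X j) := by
    rw [h]; trivial
  exact TopologicalSpace.Opens.mem_iSup.mp hx

theorem exists_chartι_eq (x : ProjSpace N F) : ∃ j z, chartι N F j z = x := by
  obtain ⟨j, hj⟩ := exists_mem_chart N F x
  rw [← opensRange_chartι] at hj
  obtain ⟨z, hz⟩ := hj
  exact ⟨j, z, hz⟩

/-- The cover of projective space by its standard charts. -/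
def chartCover : (ProjSpace N F).AffineOpenCover where
  I₀ := Fin (N + 1)
  X j := .of (ChartRing N F j)
  f j := chartι N F j
  idx x := (exists_chartι_eq N F x).choose
  covers x := (exists_chartι_eq N F x).choose_spec

instance : Algebra.FiniteType (stdGrading N F 0) (MvPolynomial (Fin (N + 1)) F) :=
  have : IsScalarTower F (stdGrading N F 0) (MvPolynomial (Fin (N + 1)) F) :=
    ⟨fun a b c => smul_assoc a b.1 c⟩
  Algebra.FiniteType.of_restrictScalars_finiteType F _ _

theorem algebraMap_stdGrading_bijective :
    Function.Bijective (algebraMap F (stdGrading N F 0)) := by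
  constructor
  · intro a b h
    exact MvPolynomial.C_injective _ _ (congrArg Subtype.val h)
  · rintro ⟨p, hp⟩
    refine ⟨MvPolynomial.coeff 0 p, Subtype.ext ?_⟩
    exact (MvPolynomial.totalDegree_eq_zero_iff_eq_C.mp
      ((MvPolynomial.totalDegree_zero_iff_isHomogeneous _).mpr hp)).symm

instance : IsProper (toSpec N F) := by
  -- `Proj` is proper over the spectrum of the degree-zero part, which is just `F`.
  have : IsIso (CommRingCat.ofHom (algebraMap F (stdGrading N F 0))) := by
    exact (RingEquiv.ofBijective _ (algebraMap_stdGrading_bijective N F)).toCommRingCatIso.isIso_hom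
  unfold toSpec
  exact inferInstanceAs (IsProper (Proj.toSpecZero (stdGrading N F) ≫ _))

end ProjSpace

/-! ### Morphisms to affine schemes as ring homomorphisms -/

/-- The ring homomorphism corresponding to a morphism to an affine scheme. -/
def toΓ {T : Scheme.{u}} {R : Type u} [CommRing R] (a : T ⟶ Spec (.of R)) : R →+* Γ(T, ⊤) :=
  ((Scheme.ΓSpecIso (.of R)).inv ≫ a.appTop).hom

/-- The morphism to an affine scheme corresponding to a ring homomorphism. -/
def ofΓ {T : Scheme.{u}} {R : Type u} [CommRing R] (ψ : R →+* Γ(T, ⊤)) : T ⟶ Spec (.of R) :=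
  T.toSpecΓ ≫ Spec.map (CommRingCat.ofHom ψ)

theorem ofΓ_toΓ {T : Scheme.{u}} {R : Type u} [CommRing R] (a : T ⟶ Spec (.of R)) :
    ofΓ (toΓ a) = a := by
  unfold ofΓ toΓ
  rw [CommRingCat.ofHom_hom, Spec.map_comp, ← Scheme.toSpecΓ_naturality_assoc,
    ← SpecMap_ΓSpecIso_hom, ← Spec.map_comp]
  simp

theorem toΓ_ofΓ {T : Scheme.{u}} {R : Type u} [CommRing R] (ψ : R →+* Γ(T, ⊤)) :
    toΓ (ofΓ ψ) = ψ := by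
  unfold ofΓ toΓ
  rw [Scheme.Hom.comp_appTop, Scheme.toSpecΓ_appTop, Scheme.ΓSpecIso_naturality]
  simp

theorem toΓ_injective {T : Scheme.{u}} {R : Type u} [CommRing R] {a b : T ⟶ Spec (.of R)}
    (h : toΓ a = toΓ b) : a = b := by
  rw [← ofΓ_toΓ a, h, ofΓ_toΓ]

theorem toΓ_comp {T T' : Scheme.{u}} {R : Type u} [CommRing R] (g : T' ⟶ T)
    (a : T ⟶ Spec (.of R)) : toΓ (g ≫ a) = g.appTop.hom.comp (toΓ a) := rfl

theorem toΓ_comp_specMap {T : Scheme.{u}} {R S : Type u} [CommRing R] [CommRing S]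
    (a : T ⟶ Spec (.of S)) (f : R →+* S) :
    toΓ (a ≫ Spec.map (CommRingCat.ofHom f)) = (toΓ a).comp f := by
  unfold toΓ
  rw [Scheme.Hom.comp_appTop, ← Category.assoc, ← Scheme.ΓSpecIso_inv_naturality]
  rfl

theorem hom_ext_of_forall_exists {T Y : Scheme.{u}} {f g : T ⟶ Y}
    (H : ∀ t : T, ∃ (W : Scheme.{u}) (p : W ⟶ T) (_ : IsOpenImmersion p),
      t ∈ Set.range p ∧ p ≫ f = p ≫ g) : f = g := by
  choose W p hp ht h using H
  let 𝒰 : T.OpenCover := Scheme.openCoverOfIsOpenCover T (fun t => (p t).opensRange)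
    (.mk (eq_top_iff.mpr fun t _ => TopologicalSpace.Opens.mem_iSup.mpr ⟨t, ht t⟩))
  refine 𝒰.hom_ext _ _ fun (t : T) => ?_
  change (p t).opensRange.ι ≫ f = (p t).opensRange.ι ≫ g
  rw [← cancel_epi (p t).isoOpensRange.hom, Scheme.Hom.isoOpensRange_hom_ι_assoc,
    Scheme.Hom.isoOpensRange_hom_ι_assoc, h]

/-! ### Comparison of points of projective space given in different charts -/

namespace ProjSpace

variable {N : ℕ} {F : Type u} [Field F]

theorem awayMap_chartCoord (j j' l : Fin (N + 1)) :
    HomogeneousLocalization.awayMap (stdGrading N F) (X_mem_stdGrading N F j') rfl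
        (chartCoord N F j l) =
      HomogeneousLocalization.awayMap (stdGrading N F) (X_mem_stdGrading N F j') rfl
        (chartCoord N F j j') *
      HomogeneousLocalization.awayMap (stdGrading N F) (X_mem_stdGrading N F j)
        (mul_comm (MvPolynomial.X j) (MvPolynomial.X j')) (chartCoord N F j' l) := by
  unfold chartCoord
  rw [HomogeneousLocalization.awayMap_mk, HomogeneousLocalization.awayMap_mk,
    HomogeneousLocalization.awayMap_mk]
  apply HomogeneousLocalization.val_injective
  rw [HomogeneousLocalization.val_mul, HomogeneousLocalization.Away.val_mk,
    HomogeneousLocalization.Away.val_mk, HomogeneousLocalization.Away.val_mk,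
    Localization.mk_mul, Localization.mk_eq_mk_iff, Localization.r_iff_exists]
  refine ⟨1, ?_⟩
  simp only [OneMemClass.coe_one, Submonoid.coe_mul]
  ring

theorem awayMap_chartConst (j j' : Fin (N + 1)) (a : F) :
    HomogeneousLocalization.awayMap (stdGrading N F) (X_mem_stdGrading N F j') rfl
        (chartConst N F j a) =
      HomogeneousLocalization.awayMap (stdGrading N F) (X_mem_stdGrading N F j)
        (mul_comm (MvPolynomial.X j) (MvPolynomial.X j')) (chartConst N F j' a) := by
  unfold chartConst
  simp only [RingHom.comp_apply, HomogeneousLocalization.awayMap_fromZeroRingHom]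

/-- Proportionality of homogeneous coordinates: the scaling factor between the two charts is `x_{j'}
/ x_j`. This reduces gluing and injectivity for the Segre map to identities between coordinates. -/
theorem comp_chartι_eq_iff {T : Scheme.{u}} {j j' : Fin (N + 1)}
    (a : T ⟶ Spec (.of (ChartRing N F j))) (a' : T ⟶ Spec (.of (ChartRing N F j'))) :
    a ≫ chartι N F j = a' ≫ chartι N F j' ↔
      (toΓ a).comp (chartConst N F j) = (toΓ a').comp (chartConst N F j') ∧
      ∀ l, toΓ a (chartCoord N F j l) = toΓ a (chartCoord N F j j') *
        toΓ a' (chartCoord N F j' l) := by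
  let mL := HomogeneousLocalization.awayMap (stdGrading N F) (X_mem_stdGrading N F j')
    (rfl : (MvPolynomial.X j * MvPolynomial.X j' : MvPolynomial (Fin (N + 1)) F) = _)
  let mR := HomogeneousLocalization.awayMap (stdGrading N F) (X_mem_stdGrading N F j)
    (mul_comm (MvPolynomial.X j) (MvPolynomial.X j' : MvPolynomial (Fin (N + 1)) F))
  constructor
  · intro h
    let e := Proj.pullbackAwayιIso (stdGrading N F) (X_mem_stdGrading N F j) Nat.one_pos
      (X_mem_stdGrading N F j') Nat.one_pos rfl
    let c := pullback.lift (f := Proj.awayι (stdGrading N F) (MvPolynomial.X j) _ Nat.one_pos)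
      (g := Proj.awayι (stdGrading N F) (MvPolynomial.X j') _ Nat.one_pos) a a' h
    let b : T ⟶ Spec (.of (HomogeneousLocalization.Away (stdGrading N F)
      (MvPolynomial.X j * MvPolynomial.X j'))) := c ≫ e.hom
    have h1 : a = b ≫ Spec.map (CommRingCat.ofHom mL) := by
      refine Eq.trans ?_ (Category.assoc c e.hom _).symm
      refine Eq.trans (pullback.lift_fst a a' h).symm (congrArg (c ≫ ·) ?_)
      exact (Proj.pullbackAwayιIso_hom_SpecMap_awayMap_left ..).symm
    have h2 : a' = b ≫ Spec.map (CommRingCat.ofHom mR) := by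
      refine Eq.trans ?_ (Category.assoc c e.hom _).symm
      refine Eq.trans (pullback.lift_snd a a' h).symm (congrArg (c ≫ ·) ?_)
      exact (Proj.pullbackAwayιIso_hom_SpecMap_awayMap_right ..).symm
    rw [h1, h2, toΓ_comp_specMap, toΓ_comp_specMap]
    constructor
    · ext c
      exact congrArg (toΓ b) (awayMap_chartConst j j' c)
    · intro l
      simp only [RingHom.comp_apply]
      rw [← map_mul]
      exact congrArg (toΓ b) (awayMap_chartCoord j j' l)
  · rintro ⟨hc, hl⟩
    -- The relation for the index `j` shows that `x_{j'} / x_j` is a unit on `T`. Hence `a` extends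
    -- to the coordinate ring of the overlap, and `a'` is then determined by the other relations.
    have hu : toΓ a (chartCoord N F j j') * toΓ a' (chartCoord N F j' j) = 1 := by
      rw [← hl j, chartCoord_self, map_one]
    let := mL.toAlgebra
    have hloc := HomogeneousLocalization.Away.isLocalization_mul (X_mem_stdGrading N F j)
      (X_mem_stdGrading N F j') rfl one_ne_zero
    have helem : HomogeneousLocalization.Away.isLocalizationElem (X_mem_stdGrading N F j)
      (X_mem_stdGrading N F j') = chartCoord N F j j' := by
      simp [HomogeneousLocalization.Away.isLocalizationElem, chartCoord]
    rw [helem] at hloc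
    have hunit : IsUnit (toΓ a (chartCoord N F j j')) := IsUnit.of_mul_eq_one _ hu
    let ψ : HomogeneousLocalization.Away (stdGrading N F)
      (MvPolynomial.X j * MvPolynomial.X j') →+* Γ(T, ⊤) :=
      IsLocalization.Away.lift (chartCoord N F j j') hunit
    have hL : ψ.comp mL = toΓ a :=
      IsLocalization.Away.lift_comp (chartCoord N F j j') hunit
    have hR : ψ.comp mR = toΓ a' := by
      apply chartRing_hom_ext
      · rw [← hc, ← hL]
        ext c
        exact congrArg ψ (awayMap_chartConst j j' c).symm
      · intro l
        apply hunit.mul_left_cancel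
        rw [← hl l, ← hL]
        simp only [RingHom.comp_apply]
        rw [← map_mul]
        exact congrArg ψ (awayMap_chartCoord j j' l).symm
    have h1 : a = ofΓ ψ ≫ Spec.map (CommRingCat.ofHom mL) := by
      apply toΓ_injective
      rw [toΓ_comp_specMap, toΓ_ofΓ, hL]
    have h2 : a' = ofΓ ψ ≫ Spec.map (CommRingCat.ofHom mR) := by
      apply toΓ_injective
      rw [toΓ_comp_specMap, toΓ_ofΓ, hR]
    rw [h1, h2, Category.assoc, Category.assoc]
    congr 1
    have hA := Proj.SpecMap_awayMap_awayι (stdGrading N F) (X_mem_stdGrading N F j) Nat.one_pos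
      (X_mem_stdGrading N F j') (rfl : (MvPolynomial.X j * MvPolynomial.X j' : _) = _)
    have hB := Proj.SpecMap_awayMap_awayι (stdGrading N F) (X_mem_stdGrading N F j') Nat.one_pos
      (X_mem_stdGrading N F j) (mul_comm (MvPolynomial.X j) (MvPolynomial.X j'))
    exact hA.trans hB.symm

/-! ### The Segre embedding -/

section Segre

variable (N F) (M : ℕ)

/-- The product of two standard charts. -/
abbrev prodChart (j : Fin (N + 1)) (l : Fin (M + 1)) : Scheme.{u} :=
  pullback (chartι N F j ≫ toSpec N F) (chartι M F l ≫ toSpec M F)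

/-- The first projection on a product of standard charts. -/
def prodChartFst (j : Fin (N + 1)) (l : Fin (M + 1)) :
    prodChart N F M j l ⟶ Spec (.of (ChartRing N F j)) :=
  pullback.fst (chartι N F j ≫ toSpec N F) (chartι M F l ≫ toSpec M F)

/-- The second projection on a product of standard charts. -/
def prodChartSnd (j : Fin (N + 1)) (l : Fin (M + 1)) :
    prodChart N F M j l ⟶ Spec (.of (ChartRing M F l)) :=
  pullback.snd (chartι N F j ≫ toSpec N F) (chartι M F l ≫ toSpec M F)

/-- The inclusion of a product of standard charts. -/
def prodChartι (j : Fin (N + 1)) (l : Fin (M + 1)) :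
    prodChart N F M j l ⟶ pullback (toSpec N F) (toSpec M F) :=
  pullback.map _ _ _ _ (chartι N F j) (chartι M F l) (𝟙 _) (Category.comp_id _)
    (Category.comp_id _)

/-- The cover of `ℙᴺ × ℙᴹ` by products of standard charts. -/
def prodCover : (pullback (toSpec N F) (toSpec M F)).OpenCover :=
  Scheme.Pullback.openCoverOfLeftRight (chartCover N F).openCover (chartCover M F).openCover _ _

instance (j : Fin (N + 1)) (l : Fin (M + 1)) : IsOpenImmersion (prodChartι N F M j l) :=
  (prodCover N F M).map_prop (j, l)

theorem exists_prodChartι_eq (x : ↥(pullback (toSpec N F) (toSpec M F))) :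
    ∃ j l, x ∈ Set.range (prodChartι N F M j l) :=
  ⟨((prodCover N F M).idx x).1, ((prodCover N F M).idx x).2, (prodCover N F M).covers x⟩

theorem prodChartι_hom_ext {Y : Scheme.{u}} {f g : pullback (toSpec N F) (toSpec M F) ⟶ Y}
    (h : ∀ j l, prodChartι N F M j l ≫ f = prodChartι N F M j l ≫ g) : f = g :=
  (prodCover N F M).hom_ext _ _ fun x => h x.1 x.2

theorem exists_glue_prodChart {Y : Scheme.{u}} (f : ∀ j l, prodChart N F M j l ⟶ Y)
    (h : ∀ j l j' l', pullback.fst (prodChartι N F M j l) (prodChartι N F M j' l') ≫ f j l =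
      pullback.snd (prodChartι N F M j l) (prodChartι N F M j' l') ≫ f j' l') :
    ∃ g : pullback (toSpec N F) (toSpec M F) ⟶ Y, ∀ j l, prodChartι N F M j l ≫ g = f j l :=
  ⟨(prodCover N F M).glueMorphisms (fun x => f x.1 x.2) fun x y => h x.1 x.2 y.1 y.2,
    fun j l => (prodCover N F M).ι_glueMorphisms _ _ (j, l)⟩

theorem prodChartι_fst (j : Fin (N + 1)) (l : Fin (M + 1)) :
    prodChartι N F M j l ≫ pullback.fst (toSpec N F) (toSpec M F) =
      prodChartFst N F M j l ≫ chartι N F j :=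
  pullback.lift_fst _ _ _

theorem prodChartι_snd (j : Fin (N + 1)) (l : Fin (M + 1)) :
    prodChartι N F M j l ≫ pullback.snd (toSpec N F) (toSpec M F) =
      prodChartSnd N F M j l ≫ chartι M F l :=
  pullback.lift_snd _ _ _

theorem prodChart_const (j : Fin (N + 1)) (l : Fin (M + 1)) :
    (toΓ (prodChartFst N F M j l)).comp (chartConst N F j) =
      (toΓ (prodChartSnd N F M j l)).comp (chartConst M F l) := by
  rw [← toΓ_comp_specMap, ← toΓ_comp_specMap, ← chartι_toSpec, ← chartι_toSpec]
  exact congrArg toΓ pullback.condition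

variable {L : ℕ} (e : Fin (N + 1) × Fin (M + 1) ≃ Fin (L + 1))

/-- The Segre map on a product of standard charts. -/
def segreChart (j : Fin (N + 1)) (l : Fin (M + 1)) :
    prodChart N F M j l ⟶ Spec (.of (ChartRing L F (e (j, l)))) :=
  ofΓ (chartLift L F (e (j, l)) ((toΓ (prodChartFst N F M j l)).comp (chartConst N F j))
    (fun m => toΓ (prodChartFst N F M j l) (chartCoord N F j (e.symm m).1) *
      toΓ (prodChartSnd N F M j l) (chartCoord M F l (e.symm m).2))
    (by simp [chartCoord_self]))

theorem toΓ_comp_segreChart_const {T : Scheme.{u}} (j : Fin (N + 1)) (l : Fin (M + 1))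
    (a : T ⟶ prodChart N F M j l) :
    (toΓ (a ≫ segreChart N F M e j l)).comp (chartConst L F (e (j, l))) =
      (toΓ (a ≫ prodChartFst N F M j l)).comp (chartConst N F j) := by
  rw [toΓ_comp, toΓ_comp, segreChart, toΓ_ofΓ]
  ext c
  simp only [RingHom.comp_apply, chartLift_chartConst]

theorem toΓ_comp_segreChart_coord {T : Scheme.{u}} (j : Fin (N + 1)) (l : Fin (M + 1))
    (a : T ⟶ prodChart N F M j l) (p : Fin (N + 1)) (q : Fin (M + 1)) :
    toΓ (a ≫ segreChart N F M e j l) (chartCoord L F (e (j, l)) (e (p, q))) =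
      toΓ (a ≫ prodChartFst N F M j l) (chartCoord N F j p) *
      toΓ (a ≫ prodChartSnd N F M j l) (chartCoord M F l q) := by
  rw [toΓ_comp, toΓ_comp, toΓ_comp, segreChart, toΓ_ofΓ]
  simp only [RingHom.comp_apply, chartLift_chartCoord, map_mul, Equiv.symm_apply_apply]

/-- One direction makes the chartwise Segre maps glue, the other makes the glued map a monomorphism.
-/
theorem comp_segreChart_eq_iff {T : Scheme.{u}} (j j' : Fin (N + 1)) (l l' : Fin (M + 1))
    (a : T ⟶ prodChart N F M j l) (b : T ⟶ prodChart N F M j' l') :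
    a ≫ segreChart N F M e j l ≫ chartι L F (e (j, l)) =
        b ≫ segreChart N F M e j' l' ≫ chartι L F (e (j', l')) ↔
      a ≫ prodChartι N F M j l = b ≫ prodChartι N F M j' l' := by
  have key : a ≫ prodChartι N F M j l = b ≫ prodChartι N F M j' l' ↔
      (a ≫ prodChartFst N F M j l) ≫ chartι N F j =
        (b ≫ prodChartFst N F M j' l') ≫ chartι N F j' ∧
      (a ≫ prodChartSnd N F M j l) ≫ chartι M F l =
        (b ≫ prodChartSnd N F M j' l') ≫ chartι M F l' := by
    simp only [Category.assoc, ← prodChartι_fst, ← prodChartι_snd]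
    simp only [← Category.assoc]
    constructor
    · intro h
      simp only [h, and_self]
    · rintro ⟨h, h'⟩
      exact pullback.hom_ext h h'
  rw [key, ← Category.assoc, ← Category.assoc, comp_chartι_eq_iff, comp_chartι_eq_iff,
    comp_chartι_eq_iff]
  have hco : (toΓ (a ≫ prodChartSnd N F M j l)).comp (chartConst M F l) =
      (toΓ (a ≫ prodChartFst N F M j l)).comp (chartConst N F j) := by
    rw [toΓ_comp, toΓ_comp, RingHom.comp_assoc, RingHom.comp_assoc, prodChart_const]
  have hco' : (toΓ (b ≫ prodChartSnd N F M j' l')).comp (chartConst M F l') =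
      (toΓ (b ≫ prodChartFst N F M j' l')).comp (chartConst N F j') := by
    rw [toΓ_comp, toΓ_comp, RingHom.comp_assoc, RingHom.comp_assoc, prodChart_const]
  simp only [toΓ_comp_segreChart_const, hco, hco']
  have hall : ∀ P : Fin (L + 1) → Prop, (∀ m, P m) ↔ ∀ p q, P (e (p, q)) := fun P =>
    ⟨fun h p q => h _, fun h m => by
      obtain ⟨⟨p, q⟩, rfl⟩ := e.surjective m
      exact h p q⟩
  rw [hall]
  simp only [toΓ_comp_segreChart_coord]
  generalize hr : toΓ (a ≫ prodChartFst N F M j l) = r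
  generalize hs : toΓ (a ≫ prodChartSnd N F M j l) = s
  generalize hr' : toΓ (b ≫ prodChartFst N F M j' l') = r'
  generalize hs' : toΓ (b ≫ prodChartSnd N F M j' l') = s'
  constructor
  · rintro ⟨hc, h⟩
    have hr1 : r (chartCoord N F j j) = 1 := by rw [chartCoord_self, map_one]
    have hs1 : s (chartCoord M F l l) = 1 := by rw [chartCoord_self, map_one]
    have hr1' : r' (chartCoord N F j' j') = 1 := by rw [chartCoord_self, map_one]
    have hs1' : s' (chartCoord M F l' l') = 1 := by rw [chartCoord_self, map_one]
    -- Coordinates of a factor are recovered by fixing the other index at the chart index, where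
    -- that coordinate is 1. A second instance of the relation removes the remaining scaling factor.
    refine ⟨⟨hc, fun p => ?_⟩, hc, fun q => ?_⟩
    · have h1 := h p l
      have h2 := h j' l
      rw [hs1, mul_one] at h1 h2
      rw [hr1', one_mul] at h2
      linear_combination h1 - r' (chartCoord N F j' p) * h2
    · have h1 := h j q
      have h2 := h j l'
      rw [hr1, one_mul] at h1 h2
      rw [hs1', mul_one] at h2
      linear_combination h1 - s' (chartCoord M F l' q) * h2
  · rintro ⟨⟨hc, h1⟩, -, h2⟩
    refine ⟨hc, fun p q => ?_⟩
    rw [h1 p, h2 q]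
    ring

theorem exists_segre : ∃ g : pullback (toSpec N F) (toSpec M F) ⟶ ProjSpace L F,
    ∀ j l, prodChartι N F M j l ≫ g = segreChart N F M e j l ≫ chartι L F (e (j, l)) :=
  exists_glue_prodChart N F M (fun j l => segreChart N F M e j l ≫ chartι L F (e (j, l)))
    fun j l j' l' => (comp_segreChart_eq_iff N F M e j j' l l' _ _).mpr pullback.condition

/-- The Segre map. -/
def segre : pullback (toSpec N F) (toSpec M F) ⟶ ProjSpace L F :=
  (exists_segre N F M e).choose

theorem prodChartι_segre (j : Fin (N + 1)) (l : Fin (M + 1)) :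
    prodChartι N F M j l ≫ segre N F M e = segreChart N F M e j l ≫ chartι L F (e (j, l)) :=
  (exists_segre N F M e).choose_spec j l

theorem segre_toSpec :
    segre N F M e ≫ toSpec L F = pullback.fst (toSpec N F) (toSpec M F) ≫ toSpec N F := by
  apply prodChartι_hom_ext
  intro j l
  rw [← Category.assoc, prodChartι_segre, Category.assoc, chartι_toSpec, ← Category.assoc,
    prodChartι_fst, Category.assoc, chartι_toSpec]
  apply toΓ_injective
  rw [toΓ_comp_specMap, toΓ_comp_specMap]
  simpa using toΓ_comp_segreChart_const N F M e j l (𝟙 _)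

theorem exists_lift_prodChart {T : Scheme.{u}} (a : T ⟶ pullback (toSpec N F) (toSpec M F))
    (t : T) : ∃ (W : Scheme.{u}) (p : W ⟶ T) (_ : IsOpenImmersion p) (j : Fin (N + 1))
      (l : Fin (M + 1)) (α : W ⟶ prodChart N F M j l),
      t ∈ Set.range p ∧ p ≫ a = α ≫ prodChartι N F M j l := by
  obtain ⟨j, l, h⟩ := exists_prodChartι_eq N F M (a t)
  refine ⟨pullback a (prodChartι N F M j l), pullback.fst _ _, inferInstance, j, l,
    pullback.snd _ _, ?_, pullback.condition⟩
  rw [IsOpenImmersion.range_pullbackFst]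
  exact h

instance mono_segre : Mono (segre N F M e) := by
  constructor
  intro T a b h
  apply hom_ext_of_forall_exists
  intro t
  obtain ⟨W, p, _, j, l, α, ⟨w, rfl⟩, hα⟩ := exists_lift_prodChart N F M a t
  obtain ⟨W', p', _, j', l', β, ⟨w', rfl⟩, hβ⟩ := exists_lift_prodChart N F M (p ≫ b) w
  refine ⟨W', p' ≫ p, inferInstance, ⟨w', by simp⟩, ?_⟩
  rw [Category.assoc, Category.assoc, hα, hβ, ← Category.assoc]
  refine (comp_segreChart_eq_iff N F M e j j' l l' _ _).mp ?_
  rw [← prodChartι_segre, ← prodChartι_segre, Category.assoc, ← reassoc_of% hα,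
    ← reassoc_of% hβ, h]

/-- A proper monomorphism is a closed immersion; properness is inherited from the product of
projective spaces over the base field. -/
instance isClosedImmersion_segre : IsClosedImmersion (segre N F M e) := by
  rw [IsClosedImmersion.iff_isProper_and_mono]
  refine ⟨?_, inferInstance⟩
  have : IsProper (segre N F M e ≫ toSpec L F) := by
    rw [segre_toSpec]
    infer_instance
  exact IsProper.of_comp (segre N F M e) (toSpec L F)

end Segre

end ProjSpace

/-! ### Plane conics as unions of three affine conics -/

namespace ProjSpace

theorem isAffineOpen_chart (N : ℕ) (F : Type u) [Field F] (j : Fin (N + 1)) :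
    IsAffineOpen (chart N F j).1 :=
  (chart N F j).2

/-- The identification of the coordinate ring of a standard chart with the ring of sections. -/
def chartToSection (N : ℕ) (F : Type u) [Field F] (j : Fin (N + 1)) :
    CommRingCat.of (ChartRing N F j) ⟶ Γ(ProjSpace N F, (chart N F j).1) :=
  Proj.awayToSection (stdGrading N F) (MvPolynomial.X j)

instance (N : ℕ) (F : Type u) [Field F] (j : Fin (N + 1)) : IsIso (chartToSection N F j) :=
  (Proj.basicOpenIsoAway (stdGrading N F) _ (X_mem_stdGrading N F j) Nat.one_pos).isIso_hom

theorem fromSpec_chart (N : ℕ) (F : Type u) [Field F] (j : Fin (N + 1)) :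
    (isAffineOpen_chart N F j).fromSpec = Spec.map (chartToSection N F j) ≫ chartι N F j := by
  rw [← cancel_epi (isAffineOpen_chart N F j).isoSpec.hom, IsAffineOpen.isoSpec_hom,
    IsAffineOpen.toSpecΓ_fromSpec]
  have h : Proj.basicOpenToSpec (stdGrading N F) (MvPolynomial.X j) ≫
      Proj.awayι (stdGrading N F) _ (X_mem_stdGrading N F j) Nat.one_pos =
      (Proj.basicOpen (stdGrading N F) (MvPolynomial.X j)).ι := by
    rw [← Proj.basicOpenIsoSpec_inv_ι, ← Proj.basicOpenIsoSpec_hom _ _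
      (X_mem_stdGrading N F j) Nat.one_pos, Iso.hom_inv_id_assoc]
  rw [← Category.assoc]
  exact h.symm

theorem chartι_preimage_chart (N : ℕ) (F : Type u) [Field F] (j l : Fin (N + 1)) :
    chartι N F j ⁻¹ᵁ (chart N F l).1 = PrimeSpectrum.basicOpen (chartCoord N F j l) := by
  have h := Proj.awayι_preimage_basicOpen (stdGrading N F) (X_mem_stdGrading N F j) Nat.one_pos
    (X_mem_stdGrading N F l) Nat.one_pos
  have helem : HomogeneousLocalization.Away.isLocalizationElem (X_mem_stdGrading N F j)
      (X_mem_stdGrading N F l) = chartCoord N F j l := by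
    simp [HomogeneousLocalization.Away.isLocalizationElem, chartCoord]
  rw [helem] at h
  exact h

end ProjSpace

/-- The `F`-scheme `Z` is the union of the three affine conics given by a nonzero ternary quadratic
form. -/
structure IsConicAtlas {F : Type u} [Field F] {Z : Scheme.{u}} (s : Z ⟶ Spec (.of F))
    (Q : TernaryForm F) (ι : ∀ j : Fin 3, Spec (.of (Q.chart j).CoordRing) ⟶ Z) : Prop where
  not_isZero : ¬ Q.IsZero
  isOpenImmersion : ∀ j, IsOpenImmersion (ι j)
  ι_comp : ∀ j, ι j ≫ s = Spec.map (CommRingCat.ofHom (algebraMap F (Q.chart j).CoordRing))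
  exists_mem_range : ∀ z : Z, ∃ j, z ∈ Set.range (ι j)
  mem_range : ∀ (j : Fin 3) (i : Fin 2) (p : Spec (.of (Q.chart j).CoordRing)),
    Ideal.Quotient.mk (Ideal.span {(Q.chart j).poly}) (MvPolynomial.X i) ∉ p.asIdeal →
    ι j p ∈ Set.range (ι (j.succAbove i))

open ProjSpace in
/-- A plane conic is covered by the three affine conics in the standard charts of `ℙ²`. -/
theorem IsPlaneConic.exists_isConicAtlas {F : Type u} [Field F] {Z : Scheme.{u}}
    {s : Z ⟶ Spec (.of F)} (h : IsPlaneConic s) : ∃ Q ι, IsConicAtlas s Q ι := by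
  obtain ⟨q, hq, i, hq0, hi, his, hker⟩ := h
  obtain ⟨Q, rfl⟩ := TernaryForm.exists_eq_homogenization hq
  let V (j : Fin 3) : Z.Opens := i ⁻¹ᵁ (chart 2 F j).1
  have hV (j) : IsAffineOpen (V j) := (isAffineOpen_chart 2 F j).preimage i
  let a (j : Fin 3) : MvPolynomial (Fin 2) F →+* Γ(ProjSpace 2 F, (chart 2 F j).1) :=
    (chartToSection 2 F j).hom.comp (chartEquiv 2 F j : _ →+* _)
  have ha (j) : Function.Bijective (a j) := by
    have h1 := ConcreteCategory.bijective_of_isIso (chartToSection 2 F j)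
    exact h1.comp (chartEquiv 2 F j).bijective
  let φ (j : Fin 3) : MvPolynomial (Fin 2) F →+* Γ(Z, V j) := (i.app (chart 2 F j).1).hom.comp (a j)
  have hφs (j) : Function.Surjective (φ j) :=
    (i.app_surjective _ (isAffineOpen_chart 2 F j)).comp (ha j).2
  -- The ideal of the conic on the chart is generated by `q / x_j ^ 2`, and under the identification
  -- of the chart with affine space this is the dehomogenized form.
  have hφk (j) : RingHom.ker (φ j) = Ideal.span {(Q.chart j).poly} := by
    have h1 : RingHom.ker (φ j) = Ideal.comap (a j) (i.ker.ideal (chart 2 F j)) := by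
      rw [Scheme.Hom.ker_apply]
      rfl
    have h2 : dehomogenize 2 F 2 Q.homogenization hq j = a j (Q.chart j).poly := by
      change _ = (chartToSection 2 F j).hom
        (chartEquiv 2 F j (Q.chart j).poly)
      rw [← TernaryForm.aeval_insertNth_homogenization, chartEquiv_aeval_insertNth 2 F j 2 _ hq]
      rfl
    rw [h1, hker j, h2, ← Set.image_singleton, ← Ideal.map_span]
    exact Ideal.comap_map_of_bijective _ (ha j)
  let e (j : Fin 3) : (Q.chart j).CoordRing ≃+* Γ(Z, V j) :=
    (Ideal.quotEquivOfEq (hφk j).symm).trans (RingHom.quotientKerEquivOfSurjective (hφs j))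
  have he (j) (p) : e j (Ideal.Quotient.mk _ p) = φ j p := rfl
  let ι (j : Fin 3) : Spec (.of (Q.chart j).CoordRing) ⟶ Z :=
    Spec.map (e j).symm.toCommRingCatIso.hom ≫ (hV j).fromSpec
  let ψ (j : Fin 3) : ChartRing 2 F j →+* (Q.chart j).CoordRing :=
    (Ideal.Quotient.mk _).comp ((chartEquiv 2 F j).symm : _ →+* _)
  have hιi (j) : ι j ≫ i = Spec.map (CommRingCat.ofHom (ψ j)) ≫ chartι 2 F j := by
    simp only [ι, Category.assoc]
    rw [← (isAffineOpen_chart 2 F j).SpecMap_appLE_fromSpec i (hV j) le_rfl, fromSpec_chart,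
      ← Spec.map_comp_assoc, ← Spec.map_comp_assoc]
    congr 2
    ext z
    obtain ⟨p, rfl⟩ := (chartEquiv 2 F j).surjective z
    have : (e j).symm (φ j p) = Ideal.Quotient.mk _ p := by
      rw [← he, RingEquiv.symm_apply_apply]
    have happ : i.appLE (chart 2 F j).1 (V j) le_rfl = i.app (chart 2 F j).1 :=
      Scheme.Hom.appLE_eq_app i
    rw [happ]
    refine Eq.trans this ?_
    simp [ψ]
  have hrange (j) : Set.range (ι j) = V j := by
    have : (ι j).opensRange = V j := by
      simp only [ι]
      rw [Scheme.Hom.opensRange_comp_of_isIso, IsAffineOpen.opensRange_fromSpec]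
    rw [← this]
    rfl
  refine ⟨Q, ι, fun hQ => hq0 (TernaryForm.homogenization_eq_zero hQ), fun j => inferInstance,
    fun j => ?_, fun z => ?_, fun j l p hp => ?_⟩
  · rw [← his, ← Category.assoc, hιi, Category.assoc, chartι_toSpec, ← Spec.map_comp]
    congr 1
    ext c
    change Ideal.Quotient.mk _ ((chartEquiv 2 F j).symm (chartConst 2 F j c)) = _
    rw [← chartEquiv_C, RingEquiv.symm_apply_apply]
    rfl
  · obtain ⟨j, hj⟩ := exists_mem_chart 2 F (i z)
    exact ⟨j, by rw [hrange]; exact hj⟩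
  · rw [hrange]
    change i (ι j p) ∈ (chart 2 F (j.succAbove l)).1
    rw [← Scheme.Hom.comp_apply, hιi, Scheme.Hom.comp_apply]
    change Spec.map (CommRingCat.ofHom (ψ j)) p ∈ chartι 2 F j ⁻¹ᵁ (chart 2 F (j.succAbove l)).1
    rw [chartι_preimage_chart, ← chartEquiv_X]
    change ψ j (chartEquiv 2 F j (MvPolynomial.X l)) ∉ p.asIdeal
    simpa [ψ] using hp

/-! ### Integrality by gluing and by flatness -/

theorem isIntegral_of_iso {X Y : Scheme.{u}} (e : X ≅ Y) [IsIntegral X] : IsIntegral Y := by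
  have : Nonempty Y := ⟨e.hom (Classical.arbitrary X)⟩
  exact isIntegral_of_isOpenImmersion e.inv

/-- Reducedness is local. For irreducibility, an open set meeting the chart `j` also meets the
overlap with the chart `l`, and inside the irreducible chart `l` it then meets every other nonempty
open set. -/
theorem isIntegral_of_forall_exists {Z : Scheme.{u}} {I : Type*} [Nonempty I] {U : I → Scheme.{u}}
    (g : ∀ j, U j ⟶ Z) [∀ j, IsOpenImmersion (g j)] [∀ j, IsIntegral (U j)]
    (hcov : ∀ z : Z, ∃ j, z ∈ Set.range (g j))
    (hmeet : ∀ j l, (Set.range (g j) ∩ Set.range (g l)).Nonempty) : IsIntegral Z := by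
  have hred : IsReduced Z := by
    have : ∀ z : Z, _root_.IsReduced (Z.presheaf.stalk z) := by
      intro z
      obtain ⟨j, u, rfl⟩ := hcov z
      exact isReduced_of_injective _
        (ConcreteCategory.bijective_of_isIso ((g j).stalkMap u)).1
    exact isReduced_of_isReduced_stalk Z
  have hne : Nonempty Z := by
    obtain ⟨z, -⟩ := hmeet (Classical.arbitrary I) (Classical.arbitrary I)
    exact ⟨z⟩
  have hpre : IsPreirreducible (Set.univ : Set Z) := by
    rintro A B hA hB ⟨a, -, ha⟩ ⟨b, -, hb⟩
    obtain ⟨j, a, rfl⟩ := hcov a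
    obtain ⟨l, b, rfl⟩ := hcov b
    have h1 : (g j ⁻¹' A ∩ g j ⁻¹' Set.range (g l)).Nonempty := by
      apply nonempty_preirreducible_inter
      · exact hA.preimage (g j).continuous
      · exact (g l).opensRange.2.preimage (g j).continuous
      · exact ⟨a, ha⟩
      · obtain ⟨_, ⟨u, rfl⟩, hu⟩ := hmeet j l
        exact ⟨u, hu⟩
    obtain ⟨u, hu, v, hv⟩ := h1
    have h2 : (g l ⁻¹' A ∩ g l ⁻¹' B).Nonempty := by
      apply nonempty_preirreducible_inter
      · exact hA.preimage (g l).continuous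
      · exact hB.preimage (g l).continuous
      · exact ⟨v, by rw [Set.mem_preimage, hv]; exact hu⟩
      · exact ⟨b, hb⟩
    obtain ⟨w, hw⟩ := h2
    exact ⟨g l w, trivial, hw⟩
  have : IrreducibleSpace Z := { toPreirreducibleSpace := ⟨hpre⟩, toNonempty := hne }
  exact isIntegral_of_irreducibleSpace_of_isReduced Z

theorem quasiCompact_of_finite {X Y : Scheme.{u}} [Finite X] (f : X ⟶ Y) : QuasiCompact f :=
  ⟨fun _ _ _ => (Set.toFinite _).isCompact⟩

/-- A flat monomorphism induces isomorphisms of local rings. -/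
theorem isIso_stalkMap_of_flat_of_mono {Y S : Scheme.{u}} (f : Y ⟶ S) [Flat f] [Mono f] (y : Y) :
    IsIso (f.stalkMap y) := by
  have hflat : (f.stalkMap y).hom.Flat := Flat.stalkMap f y
  have : Flat (Spec.map (f.stalkMap y)) := (Flat.SpecMap_iff).mpr hflat
  -- A flat local homomorphism is faithfully flat. So the map of spectra is flat, surjective and a
  -- monomorphism, hence an isomorphism.
  have : Surjective (Spec.map (f.stalkMap y)) := by
    constructor
    algebraize [(f.stalkMap y).hom]
    have : IsLocalHom (algebraMap (S.presheaf.stalk (f y)) (Y.presheaf.stalk y)) :=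
      inferInstanceAs (IsLocalHom (f.stalkMap y).hom)
    have := Module.FaithfullyFlat.of_flat_of_isLocalHom (A := S.presheaf.stalk (f y))
      (B := Y.presheaf.stalk y)
    exact PrimeSpectrum.comap_surjective_of_faithfullyFlat
  have : Mono (Spec.map (f.stalkMap y)) := by
    have h := Scheme.SpecMap_stalkMap_fromSpecStalk f (x := y)
    have : Mono (Spec.map (f.stalkMap y) ≫ S.fromSpecStalk (f y)) := by
      rw [h]; infer_instance
    exact mono_of_mono _ (S.fromSpecStalk (f y))
  have hiso := Flat.isIso_of_surjective_of_mono (Spec.map (f.stalkMap y))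
  rw [isIso_SpecMap_iff] at hiso
  exact (ConcreteCategory.isIso_iff_bijective _).mpr hiso

/-- A flat scheme over an integral scheme is integral if its generic fibre is. -/
theorem isIntegral_of_flat {Y S : Scheme.{u}} (f : Y ⟶ S) [Flat f] [IsReduced S]
    {L : Type u} [Field L] (g : Spec (.of L) ⟶ S) [IsDominant g] [IsIntegral (pullback f g)] :
    IsIntegral Y := by
  have : QuasiCompact g := quasiCompact_of_finite g
  -- Scheme-theoretic dominance survives flat base change, so `Y` inherits reducedness from the
  -- fibre, and density of the fibre gives irreducibility.
  have : IsSchemeTheoreticallyDominant g := .of_isDominant g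
  have : IsReduced Y := IsSchemeTheoreticallyDominant.isReduced (pullback.fst f g)
  have hd : IsDominant (pullback.fst f g) := inferInstance
  have hne : Nonempty Y := ⟨pullback.fst f g (Classical.arbitrary _)⟩
  have hirr : IsIrreducible (Set.univ : Set Y) := by
    rw [← (Scheme.Hom.denseRange (pullback.fst f g)).closure_range, isIrreducible_iff_closure,
      ← Set.image_univ]
    exact (IrreducibleSpace.isIrreducible_univ _).image _
      (pullback.fst f g).continuous.continuousOn
  have : IrreducibleSpace Y := { toPreirreducibleSpace := ⟨hirr.2⟩, toNonempty := hne }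
  exact isIntegral_of_irreducibleSpace_of_isReduced Y

theorem isNormalInRegular_stalk_of_smooth {k : Type u} [Field k] {X : Scheme.{u}}
    (s : X ⟶ Spec (.of k)) [Smooth s] (x : X) : IsNormalInRegular (X.presheaf.stalk x) := by
  obtain ⟨_, ⟨U, hU, rfl⟩, hxU, -⟩ := X.isBasis_affineOpens.exists_subset_of_mem_open
    (Set.mem_univ x) isOpen_univ
  have hsm : ((Scheme.ΓSpecIso (.of k)).inv ≫ s.appLE ⊤ U le_top).hom.Smooth :=
    RingHom.Smooth.respectsIso.2 _ (Scheme.ΓSpecIso (.of k)).symm.commRingCatIsoToRingEquiv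
      (s.smooth_appLE (isAffineOpen_top _) hU le_top)
  let φ : k →+* Γ(X, U) := ((Scheme.ΓSpecIso (.of k)).inv ≫ s.appLE ⊤ U le_top).hom
  algebraize [φ]
  have hsm' : Algebra.Smooth k Γ(X, U) := hsm
  let := TopCat.Presheaf.algebra_section_stalk X.presheaf (⟨x, hxU⟩ : U)
  have hloc := hU.isLocalization_stalk ⟨x, hxU⟩
  exact (isNormalInRegular_of_smooth k Γ(X, U) (hU.primeIdealOf ⟨x, hxU⟩).asIdeal).of_ringEquiv
    (IsLocalization.algEquiv (hU.primeIdealOf ⟨x, hxU⟩).asIdeal.primeCompl _ _).toRingEquiv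

theorem nonempty_stalk_equiv_localization (R : Type u) [CommRing R] (p : Ideal R) [hp : p.IsPrime] :
    Nonempty ((Spec (.of R)).presheaf.stalk ⟨p, hp⟩ ≃+* Localization.AtPrime p) :=
  have : IsLocalization p.primeCompl
      ((Spec.structureSheaf R).presheaf.stalk (⟨p, hp⟩ : PrimeSpectrum R)) :=
    StructureSheaf.IsLocalization.to_stalk R ⟨p, hp⟩
  let e := IsLocalization.algEquiv p.primeCompl
    ((Spec.structureSheaf R).presheaf.stalk (⟨p, hp⟩ : PrimeSpectrum R)) (Localization.AtPrime p)
  ⟨e.toRingEquiv⟩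

/-! ### Smooth conics: discriminant and geometric integrality -/

namespace IsConicAtlas

variable {F : Type u} [Field F] {Z : Scheme.{u}} {s : Z ⟶ Spec (.of F)} {Q : TernaryForm F}
  {ι : ∀ j : Fin 3, Spec (.of (Q.chart j).CoordRing) ⟶ Z}

theorem disc_ne_zero (hA : IsConicAtlas s Q ι) [NeZero (2 : F)]
    (h : ∀ z : Z, IsNormalInRegular (Z.presheaf.stalk z)) : Q.disc ≠ 0 := by
  apply TernaryForm.disc_ne_zero_of_isNormalInRegular _ hA.not_isZero
  intro j p hp
  let y : Spec (.of (Q.chart j).CoordRing) := ⟨p, hp⟩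
  have := hA.isOpenImmersion j
  have e1 := (asIso ((ι j).stalkMap y)).commRingCatIsoToRingEquiv
  obtain ⟨e2⟩ := nonempty_stalk_equiv_localization (Q.chart j).CoordRing p
  exact (h (ι j y)).of_ringEquiv (e1.trans e2)

/-- The generic point of each chart lies in all charts, because no coordinate vanishes identically
on a nondegenerate conic. -/
theorem range_inter_range_nonempty (hA : IsConicAtlas s Q ι) (hQ : Q.disc ≠ 0) (j l : Fin 3) :
    (Set.range (ι j) ∩ Set.range (ι l)).Nonempty := by
  have hd : (Q.chart j).disc ≠ 0 := by rwa [TernaryForm.disc_chart]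
  have := (Q.chart j).isPrime_span_poly hd
  let p : Spec (.of (Q.chart j).CoordRing) := ⟨⊥, Ideal.isPrime_bot⟩
  rcases Fin.eq_self_or_eq_succAbove j l with rfl | ⟨i, rfl⟩
  · exact ⟨ι l p, ⟨p, rfl⟩, ⟨p, rfl⟩⟩
  · refine ⟨ι j p, ⟨p, rfl⟩, hA.mem_range j i p fun h => ?_⟩
    have h0 : Ideal.Quotient.mk (Ideal.span {(Q.chart j).poly}) (MvPolynomial.X i) = 0 := h
    rw [Ideal.Quotient.eq_zero_iff_mem] at h0
    exact (Q.chart j).X_sub_C_notMem_span_poly hd i 0 (by simpa using h0)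

theorem nonempty (hA : IsConicAtlas s Q ι) : Nonempty Z := by
  obtain ⟨j, hj⟩ := Q.exists_not_isUnit_poly hA.not_isZero
  have : Nontrivial (Q.chart j).CoordRing := by
    apply Ideal.Quotient.nontrivial_iff.mpr
    rwa [Ne, Ideal.span_singleton_eq_top]
  exact ⟨ι j (Classical.arbitrary (PrimeSpectrum (Q.chart j).CoordRing))⟩

/-- The base change of an affine conic. -/
theorem isPullback_chart (hA : IsConicAtlas s Q ι) {K : Type u} [Field K] (φ : F →+* K)
    (j : Fin 3) :
    IsPullback (Spec.map (CommRingCat.ofHom ((Q.chart j).coordRingMap φ)))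
      (Spec.map (CommRingCat.ofHom (algebraMap K ((Q.chart j).map φ).CoordRing)))
      (ι j ≫ s) (Spec.map (CommRingCat.ofHom φ)) := by
  rw [hA.ι_comp]
  exact isPullback_SpecMap_of_isPushout _ _ _ _ ((Q.chart j).isPushout_coordRing φ)

/-- The discriminant stays nonzero over every extension field, so the base-changed charts are
integral. They still meet pairwise, since base change of fields is surjective on points. -/
theorem geometricallyIntegral (hA : IsConicAtlas s Q ι) (hQ : Q.disc ≠ 0) :
    GeometricallyIntegral s := by
  constructor
  have : ObjectProperty.IsClosedUnderIsomorphisms (C := Scheme.{u}) (IsIntegral ·) :=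
    ⟨fun e _ => isIntegral_of_iso e⟩
  refine (geometrically_iff_of_commRing_of_isClosedUnderIsomorphisms
    (P := (IsIntegral ·))).mpr fun K _ _ => ?_
  have := hA.isOpenImmersion
  let t := Spec.map (CommRingCat.ofHom (algebraMap F K))
  let g (j : Fin 3) : pullback (ι j ≫ s) t ⟶ pullback s t :=
    pullback.map _ _ _ _ (ι j) (𝟙 _) (𝟙 _) (by simp) (by simp)
  have hg (j) : IsPullback (g j) (pullback.fst _ _) (pullback.fst s t) (ι j) := by
    refine IsPullback.of_right ?_ (pullback.lift_fst _ _ _) (IsPullback.of_hasPullback s t).flip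
    simp only [g, pullback.map, pullback.lift_snd, Category.comp_id]
    exact (IsPullback.of_hasPullback (ι j ≫ s) t).flip
  have hgo (j) : IsOpenImmersion (g j) := MorphismProperty.of_isPullback (hg j).flip inferInstance
  have hgi (j) : IsIntegral (pullback (ι j ≫ s) t) := by
    have := ((Q.chart j).map (algebraMap F K)).isPrime_span_poly (by
      rw [TernaryForm.disc_map, TernaryForm.disc_chart]
      simpa using hQ)
    exact isIntegral_of_iso (hA.isPullback_chart (algebraMap F K) j).isoPullback
  have hr (j) : Set.range (g j) = pullback.fst s t ⁻¹' Set.range (ι j) := by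
    have h := IsOpenImmersion.range_pullbackFst (ι j) (pullback.fst s t)
    refine Eq.trans ?_ h
    rw [← (hg j).isoPullback_hom_fst, Scheme.Hom.comp_base, TopCat.coe_comp,
      Set.range_comp, Set.range_eq_univ.mpr (hg j).isoPullback.hom.surjective, Set.image_univ]
  refine isIntegral_of_forall_exists g (fun z => ?_) fun j l => ?_
  · obtain ⟨j, hj⟩ := hA.exists_mem_range (pullback.fst s t z)
    exact ⟨j, by rw [hr]; exact hj⟩
  · rw [hr, hr, ← Set.preimage_inter]
    exact (hA.range_inter_range_nonempty hQ j l).preimage (pullback.fst s t).surjective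

end IsConicAtlas

/-! ### Flat monomorphisms from spectra of fields, and birationality -/

theorem flat_fromSpecStalk (X : Scheme.{u}) (x : X) : Flat (X.fromSpecStalk x) := by
  obtain ⟨_, ⟨U, hU, rfl⟩, hxU, -⟩ := X.isBasis_affineOpens.exists_subset_of_mem_open
    (Set.mem_univ x) isOpen_univ
  have hU : IsAffineOpen U := hU
  rw [← hU.fromSpecStalk_eq_fromSpecStalk hxU]
  unfold IsAffineOpen.fromSpecStalk
  have : Flat (Spec.map (X.presheaf.germ U x hxU)) := by
    rw [Flat.SpecMap_iff]
    let := TopCat.Presheaf.algebra_section_stalk X.presheaf (⟨x, hxU⟩ : U)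
    have hloc := hU.isLocalization_stalk ⟨x, hxU⟩
    exact IsLocalization.flat _ (hU.primeIdealOf ⟨x, hxU⟩).asIdeal.primeCompl
  exact Flat.comp _ _

/-- As `U.ι` is a monomorphism, the map is the base change along `U.ι` of its own composite with
`U.ι`, which is flat. -/
theorem flat_fromSpecStalkOfMem {X : Scheme.{u}} (U : X.Opens) (x : X) (hxU : x ∈ U) :
    Flat (U.fromSpecStalkOfMem x hxU) := by
  have h := flat_fromSpecStalk X x
  rw [← U.fromSpecStalkOfMem_ι x hxU] at h
  have hpull : IsPullback (𝟙 _) (U.fromSpecStalkOfMem x hxU)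
      (U.fromSpecStalkOfMem x hxU ≫ U.ι) U.ι := by
    refine ⟨⟨by simp⟩, ⟨PullbackCone.IsLimit.mk _ (fun c => c.fst) (fun c => by simp)
      (fun c => ?_) (fun c m h1 _ => by simpa using h1)⟩⟩
    rw [← cancel_mono U.ι, Category.assoc, c.condition]
  exact MorphismProperty.of_isPullback hpull h

section Birational

variable {L : Type u} [Field L]

theorem isIso_fromSpecStalk_field (x : Spec (.of L)) : IsIso ((Spec (.of L)).fromSpecStalk x) := by
  have : Surjective ((Spec (.of L)).fromSpecStalk x) :=
    ⟨fun y => ⟨Classical.arbitrary _, Subsingleton.elim _ _⟩⟩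
  exact Flat.isIso_of_surjective_of_mono _

/-- Flat monomorphisms are isomorphisms on local rings, so `L` is itself the local ring of `X` at
the image point. This makes spreading out from stalks available for `g`. -/
theorem exists_iso_fromSpecStalk {X : Scheme.{u}} (g : Spec (.of L) ⟶ X) [Flat g] [Mono g] :
    ∃ (x : X) (e : Spec (.of L) ≅ Spec (X.presheaf.stalk x)), e.hom ≫ X.fromSpecStalk x = g := by
  let p : Spec (.of L) := Classical.arbitrary _
  have h1 := isIso_fromSpecStalk_field p
  have h2 := isIso_stalkMap_of_flat_of_mono g p
  refine ⟨g p, (asIso ((Spec (.of L)).fromSpecStalk p)).symm ≪≫ asIso (Spec.map (g.stalkMap p)), ?_⟩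
  simp [Scheme.SpecMap_stalkMap_fromSpecStalk]

theorem exists_spread_out {S X Y : Scheme.{u}} [IsIntegral X] (sX : X ⟶ S) (sY : Y ⟶ S)
    [LocallyOfFiniteType sX] [LocallyOfFiniteType sY] (gX : Spec (.of L) ⟶ X)
    [Flat gX] [Mono gX] (gY : Spec (.of L) ⟶ Y) (h : gX ≫ sX = gY ≫ sY) :
    ∃ (U : Scheme.{u}) (i : U ⟶ X) (_ : IsOpenImmersion i) (_ : IsIntegral U)
      (g : Spec (.of L) ⟶ U) (_ : Flat g) (_ : Mono g) (f : U ⟶ Y),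
      g ≫ i = gX ∧ g ≫ f = gY ∧ f ≫ sY = i ≫ sX := by
  obtain ⟨x, e, he⟩ := exists_iso_fromSpecStalk gX
  obtain ⟨U, hxU, f, hf, hfs⟩ := spread_out_of_isGermInjective' sX sY (x := x) (e.inv ≫ gY) (by
    rw [Category.assoc, ← h, ← he, Category.assoc, Iso.inv_hom_id_assoc])
  have : Nonempty U := ⟨⟨x, hxU⟩⟩
  have hg : (e.hom ≫ U.fromSpecStalkOfMem x hxU) ≫ U.ι = gX := by
    rw [Category.assoc, Scheme.Opens.fromSpecStalkOfMem_ι, he]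
  have : Mono (e.hom ≫ U.fromSpecStalkOfMem x hxU) := by
    have : Mono ((e.hom ≫ U.fromSpecStalkOfMem x hxU) ≫ U.ι) := by rw [hg]; infer_instance
    exact mono_of_mono _ U.ι
  have : Flat (e.hom ≫ U.fromSpecStalkOfMem x hxU) := by
    have := flat_fromSpecStalkOfMem U x hxU
    infer_instance
  refine ⟨U, U.ι, inferInstance, inferInstance, e.hom ≫ U.fromSpecStalkOfMem x hxU, this,
    inferInstance, f, hg, ?_, hfs⟩
  rw [Category.assoc, ← hf, Iso.hom_inv_id_assoc]

theorem exists_spread_out_unique {X Y : Scheme.{u}} [IsIntegral X] (gX : Spec (.of L) ⟶ X)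
    [Flat gX] [Mono gX] (f₁ f₂ : X ⟶ Y) (h : gX ≫ f₁ = gX ≫ f₂) :
    ∃ (U : Scheme.{u}) (i : U ⟶ X) (_ : IsOpenImmersion i) (_ : IsIntegral U)
      (g : Spec (.of L) ⟶ U) (_ : Flat g) (_ : Mono g), g ≫ i = gX ∧ i ≫ f₁ = i ≫ f₂ := by
  obtain ⟨x, e, he⟩ := exists_iso_fromSpecStalk gX
  obtain ⟨U, hxU, hU⟩ := spread_out_unique_of_isGermInjective' (x := x) f₁ f₂ (by
    rw [← cancel_epi e.hom, reassoc_of% he, reassoc_of% he, h])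
  have : Nonempty U := ⟨⟨x, hxU⟩⟩
  have hg : (e.hom ≫ U.fromSpecStalkOfMem x hxU) ≫ U.ι = gX := by
    rw [Category.assoc, Scheme.Opens.fromSpecStalkOfMem_ι, he]
  have : Mono (e.hom ≫ U.fromSpecStalkOfMem x hxU) := by
    have : Mono ((e.hom ≫ U.fromSpecStalkOfMem x hxU) ≫ U.ι) := by rw [hg]; infer_instance
    exact mono_of_mono _ U.ι
  have : Flat (e.hom ≫ U.fromSpecStalkOfMem x hxU) := by
    have := flat_fromSpecStalkOfMem U x hxU
    infer_instance
  exact ⟨U, U.ι, inferInstance, inferInstance, e.hom ≫ U.fromSpecStalkOfMem x hxU, this,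
    inferInstance, hg, hU⟩

theorem isDominant_of_isOpenImmersion {U X : Scheme.{u}} [Nonempty U] [IrreducibleSpace X]
    (i : U ⟶ X) [IsOpenImmersion i] : IsDominant i :=
  ⟨i.opensRange.2.dense ⟨i (Classical.arbitrary U), ⟨_, rfl⟩⟩⟩

/-- Integral schemes locally of finite type with a common generic point are birational. -/
theorem birationalOver_of_flat_mono {S X Y : Scheme.{u}} [IsIntegral X] [IsIntegral Y]
    (sX : X ⟶ S) (sY : Y ⟶ S) [LocallyOfFiniteType sX] [LocallyOfFiniteType sY]
    (gX : Spec (.of L) ⟶ X) [Flat gX] [Mono gX] (gY : Spec (.of L) ⟶ Y) [Flat gY] [Mono gY]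
    (h : gX ≫ sX = gY ≫ sY) : Scheme.BirationalOver sX sY := by
  obtain ⟨U, i, _, _, gU, _, _, f, hgi, hgf, hfs⟩ := exists_spread_out sX sY gX gY h
  obtain ⟨V, j, _, _, gV, _, _, p, hgj, hgp, hps⟩ := exists_spread_out sY (i ≫ sX) gY gU (by
    rw [reassoc_of% hgi, h])
  obtain ⟨V', j', _, _, gV', _, _, hgj', hp⟩ := exists_spread_out_unique gV (p ≫ f) j (by
    rw [reassoc_of% hgp, hgf, hgj])
  -- After shrinking, `p` followed by `f` is the inclusion into `Y`, so `p` is a monomorphism on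
  -- `V'`. A partial inverse `q` is spread out next, and shrinking again makes `q` followed by `p`
  -- the inclusion.
  have hm : Mono (j' ≫ p) := by
    have : Mono ((j' ≫ p) ≫ f) := by rw [Category.assoc, hp]; infer_instance
    exact mono_of_mono _ f
  obtain ⟨U', i', _, _, gU', _, _, q, hgi', hgq, hqs⟩ := exists_spread_out (i ≫ sX) (j' ≫ j ≫ sY)
    gU gV' (by rw [reassoc_of% hgi, reassoc_of% hgj', reassoc_of% hgj, h])
  obtain ⟨W, w, _, _, gW, _, _, hgw, hq⟩ := exists_spread_out_unique gU' (q ≫ j' ≫ p) i' (by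
    rw [reassoc_of% hgq, reassoc_of% hgj', hgp, hgi'])
  -- Since `j' ≫ p` is a monomorphism, `w ≫ q` is the base change of the open immersion `w ≫ i'`. So
  -- `W` is open both in `X` and in `Y`.
  have hpull : IsPullback (w ≫ q) (𝟙 W) (j' ≫ p) (w ≫ i') := by
    refine ⟨⟨by simpa using hq⟩, ⟨PullbackCone.IsLimit.mk _ (fun c => c.snd) (fun c => ?_)
      (fun c => by simp) (fun c m _ h2 => by simpa using h2)⟩⟩
    rw [← cancel_mono (j' ≫ p), c.condition]
    simp only [Category.assoc, hq]
  have : IsOpenImmersion (w ≫ q) := MorphismProperty.of_isPullback hpull.flip inferInstance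
  have := isDominant_of_isOpenImmersion (w ≫ i' ≫ i)
  have := isDominant_of_isOpenImmersion ((w ≫ q) ≫ j' ≫ j)
  have h1 := Scheme.Hom.birationalOver (w ≫ i' ≫ i) sX (w ≫ i' ≫ i ≫ sX) (by simp)
  have h2 := Scheme.Hom.birationalOver ((w ≫ q) ≫ j' ≫ j) sY (w ≫ i' ≫ i ≫ sX) (by
    simp only [Category.assoc, hqs])
  exact h1.symm.trans h2

end Birational

/-! ### Dimension as transcendence degree of the function field -/

/-- Incomparability gives one inequality, lying over together with going up the other. -/
theorem ringKrullDim_eq_of_isIntegral_of_injective {A B : Type*} [CommRing A] [CommRing B]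
    [Algebra A B] [Algebra.IsIntegral A B] (h : Function.Injective (algebraMap A B)) :
    ringKrullDim B = ringKrullDim A := by
  have : FaithfulSMul A B := (faithfulSMul_iff_algebraMap_injective _ _).mpr h
  apply le_antisymm
  · refine Order.krullDim_le_of_strictMono (PrimeSpectrum.comap (algebraMap A B)) ?_
    intro p q hpq
    exact Ideal.IsIntegral.comap_lt_comap (R := A) hpq
  · refine iSup_le fun l => ?_
    obtain ⟨P, hP⟩ := Algebra.IsIntegral.comap_surjective A B l.head
    have : P.asIdeal.LiesOver l.head.asIdeal := ⟨by rw [← hP]; rfl⟩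
    obtain ⟨M, hM, -⟩ := Ideal.exists_ltSeries_of_hasGoingUp l P.asIdeal
    rw [← hM]
    exact le_iSup (fun p : LTSeries (PrimeSpectrum B) => (p.length : WithBot ℕ∞)) M

/-- Noether normalization makes `A` integral over a polynomial ring in `s` variables. Additivity of
the transcendence degree gives `s = n`, and both rings have dimension `s`. -/
theorem ringKrullDim_eq_of_trdeg_eq {k A L : Type u} [Field k] [CommRing A] [IsDomain A]
    [Algebra k A] [Algebra.FiniteType k A] [Field L] [Algebra A L] [IsFractionRing A L]
    [Algebra k L] [IsScalarTower k A L] (n : ℕ) (hn : Algebra.trdeg k L = n) :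
    ringKrullDim A = n := by
  obtain ⟨s, g, hg, hint⟩ := exists_integral_inj_algHom_of_fg k A
  let := g.toAlgebra
  have hint' : Algebra.IsIntegral (MvPolynomial (Fin s) k) A := ⟨hint⟩
  have htower : IsScalarTower k (MvPolynomial (Fin s) k) A :=
    IsScalarTower.of_algebraMap_eq fun c => (g.commutes c).symm
  have hinj : Function.Injective (algebraMap (MvPolynomial (Fin s) k) A) := hg
  have hf : FaithfulSMul (MvPolynomial (Fin s) k) A :=
    (faithfulSMul_iff_algebraMap_injective _ _).mpr hinj
  have h1 := trdeg_add_eq k A (A := L)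
  have h2 := trdeg_add_eq k (MvPolynomial (Fin s) k) (A := A)
  have h3 : Algebra.trdeg A L = 0 := by
    have : Algebra.IsAlgebraic A L := IsLocalization.isAlgebraic L (nonZeroDivisors A)
    exact trdeg_eq_zero
  have h4 : Algebra.trdeg (MvPolynomial (Fin s) k) A = 0 := trdeg_eq_zero
  rw [MvPolynomial.trdeg_of_isDomain] at h2
  have hs : s = n := by
    have : (s : Cardinal.{u}) = n := by
      rw [← hn, ← h1, ← h2, h3, h4]
      simp
    exact_mod_cast this
  rw [ringKrullDim_eq_of_isIntegral_of_injective hinj,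
    MvPolynomial.ringKrullDim_of_isNoetherianRing,
    ringKrullDim_eq_zero_of_field, hs]
  simp

/-- The local ring at the image point is a field, so that point has codimension 0 and must be
generic. -/
theorem exists_iso_fromSpecStalk_genericPoint {L : Type u} [Field L] {X : Scheme.{u}} [IsIntegral X]
    (g : Spec (.of L) ⟶ X) [Flat g] [Mono g] :
    ∃ e : Spec (.of L) ≅ Spec (X.presheaf.stalk (genericPoint X)),
      e.hom ≫ X.fromSpecStalk (genericPoint X) = g := by
  obtain ⟨x, e, he⟩ := exists_iso_fromSpecStalk g
  suffices x = genericPoint X by subst this; exact ⟨e, he⟩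
  have h1 : ringKrullDim (X.presheaf.stalk x) = 0 := by
    rw [← ringKrullDim_eq_zero_of_field L]
    let e' : CommRingCat.of L ≅ X.presheaf.stalk x :=
      { hom := Spec.preimage e.inv
        inv := Spec.preimage e.hom
        hom_inv_id := by apply Spec.map_injective; simp
        inv_hom_id := by apply Spec.map_injective; simp }
    exact (ringKrullDim_eq_of_ringEquiv e'.commRingCatIsoToRingEquiv).symm
  rw [ringKrullDim_stalk_eq_coheight] at h1
  have h2 : Order.coheight x = 0 := by exact_mod_cast h1
  rw [Order.coheight_eq_zero] at h2
  have h3 := genericPoint_specializes x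
  exact (h3.antisymm (Scheme.le_iff_specializes.mp (h2 (Scheme.le_iff_specializes.mpr h3)))).symm.eq

theorem topologicalKrullDim_eq_of_flat_mono {k L : Type u} [Field k] [Field L] [Algebra k L]
    {X : Scheme.{u}} [IsIntegral X] (s : X ⟶ Spec (.of k)) [LocallyOfFiniteType s]
    (g : Spec (.of L) ⟶ X) [Flat g] [Mono g]
    (h : g ≫ s = Spec.map (CommRingCat.ofHom (algebraMap k L))) (n : ℕ)
    (hn : Algebra.trdeg k L = n) : topologicalKrullDim X = n := by
  obtain ⟨e, he⟩ := exists_iso_fromSpecStalk_genericPoint g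
  let e' : X.presheaf.stalk (genericPoint X) ≅ CommRingCat.of L :=
      { hom := Spec.preimage e.hom
        inv := Spec.preimage e.inv
        hom_inv_id := by apply Spec.map_injective; simp
        inv_hom_id := by apply Spec.map_injective; simp }
  have he' : Spec.map e'.hom = e.hom := Spec.map_preimage _
  -- Every nonempty affine open has fraction field `L`, so all of them have dimension `n`. The
  -- dimension of `X` is bounded above through its local rings and below by any one affine open.
  have key (U : X.Opens) (hU : IsAffineOpen U) (hne : (U : Set X).Nonempty) :
      ringKrullDim Γ(X, U) = n := by
    have hx : genericPoint X ∈ U :=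
      ((genericPoint_spec X).mem_open_set_iff U.2).mpr (by simpa using hne)
    have : Nonempty U := ⟨⟨_, hx⟩⟩
    let φ : k →+* Γ(X, U) := (Spec.preimage (hU.fromSpec ≫ s)).hom
    let ψ : Γ(X, U) →+* L := (X.presheaf.germ U (genericPoint X) hx ≫ e'.hom).hom
    let := φ.toAlgebra
    let := ψ.toAlgebra
    have hft : Algebra.FiniteType k Γ(X, U) := by
      have : LocallyOfFiniteType (Spec.map (Spec.preimage (hU.fromSpec ≫ s))) := by
        rw [Spec.map_preimage]; infer_instance
      exact (HasRingHomProperty.Spec_iff (P := @LocallyOfFiniteType)).mp this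
    have htow : IsScalarTower k Γ(X, U) L := by
      refine IsScalarTower.of_algebraMap_eq' (congrArg CommRingCat.Hom.hom
        (?_ : CommRingCat.ofHom (algebraMap k L) = Spec.preimage (hU.fromSpec ≫ s) ≫
          X.presheaf.germ U (genericPoint X) hx ≫ e'.hom))
      apply Spec.map_injective
      rw [← h, Spec.map_comp, Spec.map_comp, Spec.map_preimage, ← he, Category.assoc,
        Category.assoc, ← hU.fromSpecStalk_eq_fromSpecStalk hx, IsAffineOpen.fromSpecStalk,
        Category.assoc]
      exact congrArg (fun t => e.hom ≫ Spec.map (X.presheaf.germ U (genericPoint X) hx) ≫ t)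
        (Spec.map_preimage _).symm
    have hfrac : IsFractionRing Γ(X, U) L := by
      have := functionField_isFractionRing_of_isAffineOpen X U hU
      exact IsLocalization.isLocalization_of_algEquiv (nonZeroDivisors Γ(X, U))
        (S := X.functionField)
        { e'.commRingCatIsoToRingEquiv with commutes' := fun r => rfl }
    exact ringKrullDim_eq_of_trdeg_eq (A := Γ(X, U)) n hn
  apply le_antisymm
  · have h1 : topologicalKrullDim X = Order.krullDim X :=
      Order.krullDim_eq_of_orderIso irreducibleSetEquivPoints
    rw [h1, Order.krullDim_eq_iSup_coheight]
    refine iSup_le fun x => ?_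
    obtain ⟨_, ⟨U, hU, rfl⟩, hxU, -⟩ := X.isBasis_affineOpens.exists_subset_of_mem_open
      (Set.mem_univ x) isOpen_univ
    rw [← ringKrullDim_stalk_eq_coheight, ← key U hU ⟨x, hxU⟩]
    let := TopCat.Presheaf.algebra_section_stalk X.presheaf (⟨x, hxU⟩ : U)
    have hloc := hU.isLocalization_stalk ⟨x, hxU⟩
    rw [IsLocalization.AtPrime.ringKrullDim_eq_height (hU.primeIdealOf ⟨x, hxU⟩).asIdeal
      (X.presheaf.stalk x)]
    exact Ideal.height_le_ringKrullDim_of_ne_top (Ideal.IsPrime.ne_top inferInstance)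
  · obtain ⟨_, ⟨U, hU, rfl⟩, hxU, -⟩ := X.isBasis_affineOpens.exists_subset_of_mem_open
      (Set.mem_univ (genericPoint X)) isOpen_univ
    have hU : IsAffineOpen U := hU
    rw [← key U hU ⟨_, hxU⟩, ← PrimeSpectrum.topologicalKrullDim_eq_ringKrullDim]
    exact hU.fromSpec.isOpenEmbedding.isInducing.topologicalKrullDim_le

/-! ### Dominant morphisms to Dedekind bases are flat -/

theorem isDedekindDomain_of_ringEquiv {A B : Type*} [CommRing A] [CommRing B] [IsDedekindDomain A]
    (e : A ≃+* B) : IsDedekindDomain B := by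
  have : IsDomain B := MulEquiv.isDomain A e.symm.toMulEquiv
  let := e.toRingHom.toAlgebra
  have : IsLocalization (⊥ : Submonoid A) A := IsLocalization.self bot_le
  have : IsLocalization (⊥ : Submonoid A) B :=
    IsLocalization.isLocalization_of_algEquiv (S := A) ⊥ { e with commutes' := fun r => rfl }
  exact IsLocalization.isDedekindDomain A (M := ⊥) bot_le B

theorem apply_genericPoint_of_isDominant {Y S : Scheme.{u}} [IrreducibleSpace Y]
    [IrreducibleSpace S] (f : Y ⟶ S) [IsDominant f] : f (genericPoint Y) = genericPoint S := by
  have h := (genericPoint_spec Y).image f.continuous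
  rw [Set.image_univ, (Scheme.Hom.denseRange f).closure_range] at h
  exact h.eq (genericPoint_spec S)

/-- Dominance sends generic point to generic point. The local ring of `S` thus embeds in the
function field of `S` and from there in that of `Y`, and this embedding factors through the stalk
map. -/
theorem stalkMap_injective_of_isDominant {Y S : Scheme.{u}} [IsIntegral Y] [IsIntegral S]
    (f : Y ⟶ S) [IsDominant f] (y : Y) : Function.Injective (f.stalkMap y).hom := by
  have h := f.stalkSpecializes_stalkMap _ _ (genericPoint_specializes y)
  have h1 : Function.Injective (S.presheaf.stalkSpecializes
      ((genericPoint_specializes y).map f.continuous)).hom := by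
    have h0 : ∀ x, x = genericPoint S → ∀ hx : x ⤳ f y,
        Function.Injective (S.presheaf.stalkSpecializes hx).hom := by
      rintro x rfl hx
      exact FaithfulSMul.algebraMap_injective (S.presheaf.stalk (f y)) S.functionField
    exact h0 _ (apply_genericPoint_of_isDominant f) _
  have h2 : Function.Injective (f.stalkMap (genericPoint Y)).hom := by
    have h0 : IsField (S.presheaf.stalk (f (genericPoint Y))) := by
      rw [apply_genericPoint_of_isDominant f]
      exact Field.toIsField S.functionField
    let := h0.toField
    exact RingHom.injective (f.stalkMap (genericPoint Y)).hom
  have h3 := h2.comp h1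
  have h4 : (f.stalkMap (genericPoint Y)).hom ∘ (S.presheaf.stalkSpecializes
      ((genericPoint_specializes y).map f.continuous)).hom =
      (Y.presheaf.stalkSpecializes (genericPoint_specializes y)).hom ∘ (f.stalkMap y).hom := by
    funext t
    exact f.stalkSpecializes_stalkMap_apply _ _ (genericPoint_specializes y) t
  rw [h4] at h3
  exact h3.of_comp

/-- A domain containing a Dedekind domain is torsion-free over it, hence flat. -/
theorem flat_of_isDominant {Y S : Scheme.{u}} [IsIntegral Y] [IsIntegral S]
    (hS : ∀ z : S, IsDedekindDomain (S.presheaf.stalk z)) (f : Y ⟶ S) [IsDominant f] : Flat f := by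
  refine Flat.of_stalkMap f fun y => ?_
  have := hS (f y)
  let := (f.stalkMap y).hom.toAlgebra
  have : FaithfulSMul (S.presheaf.stalk (f y)) (Y.presheaf.stalk y) :=
    (faithfulSMul_iff_algebraMap_injective _ _).mpr (stalkMap_injective_of_isDominant f y)
  have : Module.Flat (S.presheaf.stalk (f y)) (Y.presheaf.stalk y) := inferInstance
  exact this

namespace ProjSpace

instance isDomain_chartRing (N : ℕ) (F : Type u) [Field F] (j : Fin (N + 1)) :
    IsDomain (ChartRing N F j) := MulEquiv.isDomain _ (chartEquiv N F j).symm.toMulEquiv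

theorem chartCoord_ne_zero (N : ℕ) (F : Type u) [Field F] (j l : Fin (N + 1)) :
    chartCoord N F j l ≠ 0 := by
  rcases Fin.eq_self_or_eq_succAbove j l with rfl | ⟨i, rfl⟩
  · rw [chartCoord_self]
    exact one_ne_zero
  · rw [← chartEquiv_X]
    exact (map_ne_zero_iff _ (chartEquiv N F j).injective).mpr (MvPolynomial.X_ne_zero i)

instance isIntegral (N : ℕ) (F : Type u) [Field F] : IsIntegral (ProjSpace N F) := by
  refine isIntegral_of_forall_exists (I := Fin (N + 1)) (fun j => chartι N F j) (fun z => ?_)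
    fun j l => ?_
  · obtain ⟨j, z, hz⟩ := exists_chartι_eq N F z
    exact ⟨j, z, hz⟩
  · let p : Spec (.of (ChartRing N F j)) := ⟨⊥, Ideal.isPrime_bot⟩
    refine ⟨chartι N F j p, ⟨p, rfl⟩, ?_⟩
    have h : p ∈ chartι N F j ⁻¹ᵁ (chart N F l).1 := by
      rw [chartι_preimage_chart]
      intro h0
      refine chartCoord_ne_zero N F j l ?_
      exact h0
    have h' : chartι N F j p ∈ (chart N F l).1 := h
    rw [← opensRange_chartι] at h'
    exact h'

theorem isDedekindDomain_stalk (F : Type u) [Field F] (z : ProjSpace 1 F) :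
    IsDedekindDomain ((ProjSpace 1 F).presheaf.stalk z) := by
  obtain ⟨j, z, rfl⟩ := exists_chartι_eq 1 F z
  have : IsDedekindDomain (ChartRing 1 F j) := isDedekindDomain_of_ringEquiv
    ((MvPolynomial.uniqueAlgEquiv F (Fin 1)).symm.toRingEquiv.trans (chartEquiv 1 F j))
  have e1 := (asIso ((chartι 1 F j).stalkMap z)).commRingCatIsoToRingEquiv
  obtain ⟨e2⟩ := nonempty_stalk_equiv_localization (ChartRing 1 F j) z.asIdeal (hp := z.isPrime)
  exact isDedekindDomain_of_ringEquiv (e1.trans e2).symm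

end ProjSpace

/-! ### Function fields of conics with a rational point -/

theorem mono_specMap_of_isLocalization {R S : Type u} [CommRing R] [CommRing S] [Algebra R S]
    (M : Submonoid R) [IsLocalization M S] :
    Mono (Spec.map (CommRingCat.ofHom (algebraMap R S))) := by
  have : Epi (CommRingCat.ofHom (algebraMap R S)) := IsLocalization.epi M S
  exact inferInstanceAs (Mono (Scheme.Spec.map (CommRingCat.ofHom (algebraMap R S)).op))

theorem flat_specMap_of_isLocalization {R S : Type u} [CommRing R] [CommRing S] [Algebra R S]
    (M : Submonoid R) [IsLocalization M S] :
    Flat (Spec.map (CommRingCat.ofHom (algebraMap R S))) := by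
  rw [Flat.SpecMap_iff, CommRingCat.hom_ofHom, RingHom.flat_algebraMap_iff]
  exact IsLocalization.flat S M

/-- The function field of a smooth conic with a rational point, as a flat monomorphism. -/
theorem IsConicAtlas.exists_flat_mono {F : Type u} [Field F] {Z : Scheme.{u}}
    {s : Z ⟶ Spec (.of F)} {Q : TernaryForm F}
    {ι : ∀ j : Fin 3, Spec (.of (Q.chart j).CoordRing) ⟶ Z} (hA : IsConicAtlas s Q ι)
    (hQ : Q.disc ≠ 0) {L : Type u} [Field L] (φ : F →+* L) {Z' : Scheme.{u}} {w : Z' ⟶ Z}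
    {s' : Z' ⟶ Spec (.of L)} (hP : IsPullback w s' s (Spec.map (CommRingCat.ofHom φ)))
    (σ : Spec (.of L) ⟶ Z') (hσ : σ ≫ s' = 𝟙 _) :
    ∃ g : Spec (.of (FractionRing (Polynomial L))) ⟶ Z', Flat g ∧ Mono g ∧
      g ≫ s' = Spec.map (CommRingCat.ofHom (algebraMap L (FractionRing (Polynomial L)))) := by
  obtain ⟨j, hj⟩ := hA.exists_mem_range ((σ ≫ w) (Classical.arbitrary (PrimeSpectrum L)))
  have := hA.isOpenImmersion j
  have hrange : Set.range (σ ≫ w) ⊆ Set.range (ι j) := by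
    rintro _ ⟨x, rfl⟩
    rwa [Subsingleton.elim x (Classical.arbitrary (PrimeSpectrum L))]
  let τ := IsOpenImmersion.lift (ι j) (σ ≫ w) hrange
  have hτ : τ ≫ ι j = σ ≫ w := IsOpenImmersion.lift_fac _ _ _
  have hpb := hA.isPullback_chart φ j
  let R := ((Q.chart j).map φ).CoordRing
  have hdisc : ((Q.chart j).map φ).disc ≠ 0 := by
    rw [TernaryForm.disc_map, TernaryForm.disc_chart]
    simpa using hQ
  have := ((Q.chart j).map φ).isPrime_span_poly hdisc
  -- The rational point lies in the `j`-th chart, hence gives an `L`-point of the base-changed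
  -- affine conic. Its coordinates feed the parametrization by slopes.
  let ρ : Spec (.of L) ⟶ Spec (.of R) := hpb.lift τ (𝟙 _) (by
    rw [reassoc_of% hτ, hP.w, reassoc_of% hσ, Category.id_comp])
  have hρ : ρ ≫ Spec.map (CommRingCat.ofHom (algebraMap L R)) = 𝟙 _ := hpb.lift_snd _ _ _
  let r : R →+* L := (Spec.preimage ρ).hom
  have hr (c : L) : r (algebraMap L R c) = c := by
    have h : CommRingCat.ofHom (algebraMap L R) ≫ Spec.preimage ρ = 𝟙 _ := by
      apply Spec.map_injective
      rw [Spec.map_comp, Spec.map_preimage, hρ, Spec.map_id]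
    exact DFunLike.congr_fun (CommRingCat.hom_ext_iff.mp h) c
  let mk : MvPolynomial (Fin 2) L →+* R := Ideal.Quotient.mk _
  have hxy : MvPolynomial.eval ![r (mk (MvPolynomial.X 0)), r (mk (MvPolynomial.X 1))]
      ((Q.chart j).map φ).poly = 0 := by
    have h1 : MvPolynomial.eval ![r (mk (MvPolynomial.X 0)), r (mk (MvPolynomial.X 1))] =
        r.comp mk := by
      refine MvPolynomial.ringHom_ext (fun c => ?_) fun i => ?_
      · rw [MvPolynomial.eval_C]
        exact (hr c).symm
      · fin_cases i <;> simp
    rw [h1, RingHom.comp_apply]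
    have h2 : mk ((Q.chart j).map φ).poly = 0 :=
      Ideal.Quotient.eq_zero_iff_mem.mpr (Ideal.mem_span_singleton_self _)
    rw [h2, map_zero]
  obtain ⟨e⟩ := TernaryForm.exists_fractionRing_equiv _ hdisc _ _ hxy (FractionRing R)
  let m : Spec (.of R) ⟶ Z' := hP.lift
    (Spec.map (CommRingCat.ofHom ((Q.chart j).coordRingMap φ)) ≫ ι j)
    (Spec.map (CommRingCat.ofHom (algebraMap L R))) (by rw [Category.assoc, hpb.w])
  have hms : m ≫ s' = Spec.map (CommRingCat.ofHom (algebraMap L R)) := hP.lift_snd _ _ _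
  have hmp : IsPullback m (Spec.map (CommRingCat.ofHom ((Q.chart j).coordRingMap φ))) w (ι j) := by
    refine IsPullback.of_right ?_ (hP.lift_fst _ _ _) hP.flip
    rw [hms]
    exact hpb.flip
  have hmo : IsOpenImmersion m := MorphismProperty.of_isPullback hmp.flip inferInstance
  let i : Spec (.of (FractionRing R)) ⟶ Spec (.of R) :=
    Spec.map (CommRingCat.ofHom (algebraMap R (FractionRing R)))
  have : Mono i := mono_specMap_of_isLocalization (nonZeroDivisors R)
  have : Flat i := flat_specMap_of_isLocalization (nonZeroDivisors R)
  let ε : Spec (.of (FractionRing (Polynomial L))) ⟶ Spec (.of (FractionRing R)) :=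
    Spec.map (RingEquiv.toCommRingCatIso e.symm.toRingEquiv).hom
  refine ⟨ε ≫ i ≫ m, inferInstance, inferInstance, ?_⟩
  rw [Category.assoc, Category.assoc, hms, ← Spec.map_comp, ← Spec.map_comp]
  congr 1
  ext c
  change e.symm (algebraMap R (FractionRing R) (algebraMap L R c)) = _
  rw [← IsScalarTower.algebraMap_apply, AlgEquiv.commutes]
  rfl

/-! ### Smooth conic fibres and their base changes -/

theorem exists_specMap_fromSpecResidueField_eq {L : Type u} [Field L] {S : Scheme.{u}}
    (g : Spec (.of L) ⟶ S) (x : Spec (.of L)) {y : S} (hy : g x = y) :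
    ∃ φ : S.residueField y ⟶ .of L, Spec.map φ ≫ S.fromSpecResidueField y = g := by
  obtain ⟨⟨z, φ⟩, rfl⟩ := (Scheme.SpecToEquivOfField _ _).symm.surjective g
  have : z = y := by
    rw [← hy]
    exact (Scheme.fromSpecResidueField_apply z (Spec.map φ x)).symm
  subst this
  exact ⟨φ, rfl⟩

theorem flat_fromSpecResidueField_genericPoint (S : Scheme.{u}) [IsIntegral S] :
    Flat (S.fromSpecResidueField (genericPoint S)) := by
  have : IsIso (S.residue (genericPoint S)) := by
    rw [ConcreteCategory.isIso_iff_bijective]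
    let : Field (S.presheaf.stalk (genericPoint S)) := inferInstanceAs (Field S.functionField)
    exact ⟨RingHom.injective (S.residue (genericPoint S)).hom, S.residue_surjective _⟩
  have := flat_fromSpecStalk S (genericPoint S)
  unfold Scheme.fromSpecResidueField
  infer_instance

/-- The fibre over `y` is a smooth plane conic. -/
def HasSmoothConicFiber {X S : Scheme.{u}} (π : X ⟶ S) (y : S) : Prop :=
  ∃ Q ι, IsConicAtlas (F := S.residueField y) (π.fiberToSpecResidueField y) Q ι ∧ Q.disc ≠ 0

section Fibers

variable {X S : Scheme.{u}} (π : X ⟶ S) (y : S)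

theorem hasSmoothConicFiber_of_isPlaneConic [NeZero (2 : S.residueField y)]
    (h : IsPlaneConic (F := S.residueField y) (π.fiberToSpecResidueField y))
    (hn : ∀ z : π.fiber y, IsNormalInRegular ((π.fiber y).presheaf.stalk z)) :
    HasSmoothConicFiber π y := by
  obtain ⟨Q, ι, hA⟩ := h.exists_isConicAtlas
  exact ⟨Q, ι, hA, hA.disc_ne_zero hn⟩

/-- A plane conic is never empty: a nonzero form has some chart whose equation is not a unit. -/
theorem surjective_of_isPlaneConic
    (h : ∀ y, IsPlaneConic (F := S.residueField y) (π.fiberToSpecResidueField y)) :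
    Surjective π := by
  refine ⟨fun y => ?_⟩
  obtain ⟨Q, ι, hA⟩ := (h y).exists_isConicAtlas
  obtain ⟨z⟩ := hA.nonempty
  have hz : π.fiberι y z ∈ π ⁻¹' {y} := by
    rw [← Scheme.Hom.range_fiberι]
    exact ⟨z, rfl⟩
  exact ⟨_, hz⟩

variable {π y}

theorem HasSmoothConicFiber.geometricallyIntegral (h : HasSmoothConicFiber π y) :
    GeometricallyIntegral (π.fiberToSpecResidueField y) := by
  obtain ⟨Q, ι, hA, hQ⟩ := h
  exact hA.geometricallyIntegral hQ

theorem isPullback_fiber {L : Type u} [Field L] {g : Spec (.of L) ⟶ S}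
    {φ : S.residueField y ⟶ .of L} (hφ : Spec.map φ ≫ S.fromSpecResidueField y = g)
    {P : Scheme.{u}} {fst : P ⟶ X} {snd : P ⟶ Spec (.of L)} (hP : IsPullback fst snd π g) :
    ∃ w : P ⟶ π.fiber y, IsPullback w snd (π.fiberToSpecResidueField y) (Spec.map φ) ∧
      w ≫ π.fiberι y = fst := by
  have hF : IsPullback (π.fiberι y) (π.fiberToSpecResidueField y) π (S.fromSpecResidueField y) :=
    IsPullback.of_hasPullback _ _
  let w : P ⟶ π.fiber y := hF.lift fst (snd ≫ Spec.map φ) (by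
    rw [hP.w, Category.assoc, hφ])
  refine ⟨w, ?_, hF.lift_fst _ _ _⟩
  refine IsPullback.of_right (h₁₂ := π.fiberι y) (v₁₃ := π)
    (h₂₂ := S.fromSpecResidueField y) ?_ ?_ hF
  · rw [hF.lift_fst, hφ]
    exact hP
  · exact hF.lift_snd _ _ _

theorem HasSmoothConicFiber.exists_flat_mono (h : HasSmoothConicFiber π y) {L : Type u} [Field L]
    {g : Spec (.of L) ⟶ S} (x : Spec (.of L)) (hy : g x = y) (σ : Spec (.of L) ⟶ X)
    (hσ : σ ≫ π = g) {P : Scheme.{u}} {fst : P ⟶ X} {snd : P ⟶ Spec (.of L)}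
    (hP : IsPullback fst snd π g) :
    ∃ g : Spec (.of (FractionRing (Polynomial L))) ⟶ P, Flat g ∧ Mono g ∧
      g ≫ snd = Spec.map (CommRingCat.ofHom (algebraMap L (FractionRing (Polynomial L)))) := by
  obtain ⟨Q, ι, hA, hQ⟩ := h
  obtain ⟨φ, hφ⟩ := exists_specMap_fromSpecResidueField_eq g x hy
  obtain ⟨w, hw, -⟩ := isPullback_fiber hφ hP
  exact hA.exists_flat_mono hQ φ.hom hw (hP.lift σ (𝟙 _) (by simp [hσ])) (hP.lift_snd _ _ _)

/-- The generic fibre over `T` is a field extension of a smooth conic and so integral; flatness over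
`T` passes this on to the whole fibre product. -/
theorem HasSmoothConicFiber.isIntegral_pullback {T : Scheme.{u}} [IsIntegral T] [Flat π]
    {t : T ⟶ S} (h : HasSmoothConicFiber π (t (genericPoint T))) : IsIntegral (pullback t π) := by
  let γ : Spec (.of (T.residueField (genericPoint T))) ⟶ T :=
    T.fromSpecResidueField (genericPoint T)
  have hγ (x) : γ x = genericPoint T := T.fromSpecResidueField_apply _ x
  have hd : IsDominant γ := by
    refine ⟨dense_iff_closure_eq.mpr (Set.eq_univ_of_univ_subset ?_)⟩
    rw [← genericPoint_closure (α := T)]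
    exact closure_mono (Set.singleton_subset_iff.mpr ⟨Classical.arbitrary (PrimeSpectrum _), hγ _⟩)
  let x : Spec (.of (T.residueField (genericPoint T))) := Classical.arbitrary (PrimeSpectrum _)
  obtain ⟨φ, hφ⟩ := exists_specMap_fromSpecResidueField_eq (γ ≫ t) x (y := t (genericPoint T)) (by
    rw [Scheme.Hom.comp_apply, hγ])
  have hP : IsPullback (pullback.fst (pullback.fst t π) γ ≫ pullback.snd t π)
      (pullback.snd (pullback.fst t π) γ) π (γ ≫ t) :=
    ((IsPullback.of_hasPullback (pullback.fst t π) γ).flip.paste_vert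
      (IsPullback.of_hasPullback t π)).flip
  obtain ⟨w, hw, -⟩ := isPullback_fiber hφ hP
  have := h.geometricallyIntegral
  have hi : IsIntegral (pullback (pullback.fst t π) γ) :=
    GeometricallyIntegral.geometrically_isIntegral (f := π.fiberToSpecResidueField _) _ _ _ hw
  exact isIntegral_of_flat (pullback.fst t π) γ

/-- Extending scalars replaces `T` by an integral scheme mapping onto `T`. Its generic point lies
over that of `T`, so the same fibre of `π` controls the extended fibre product. -/
theorem HasSmoothConicFiber.geometricallyIntegral_pullback {k : Type u} [Field k] {T : Scheme.{u}}
    (c : T ⟶ Spec (.of k)) [GeometricallyIntegral c] [IsIntegral T] [Flat π]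
    {t : T ⟶ S} (h : HasSmoothConicFiber π (t (genericPoint T))) :
    GeometricallyIntegral (pullback.fst t π ≫ c) := by
  constructor
  intro K _ z Y fst snd hY
  have hT : IsIntegral (pullback c z) :=
    pullback_of_geometrically GeometricallyIntegral.geometrically_isIntegral K z
  have hs : Surjective (pullback.fst c z) := by
    have : Surjective z := ⟨fun y => ⟨Classical.arbitrary (PrimeSpectrum K), Subsingleton.elim _ _⟩⟩
    infer_instance
  have hg := apply_genericPoint_of_isDominant (pullback.fst c z)
  have h' : HasSmoothConicFiber π ((pullback.fst c z ≫ t) (genericPoint ↥(pullback c z))) := by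
    rw [Scheme.Hom.comp_apply, hg]
    exact h
  have := h'.isIntegral_pullback
  let v : Y ⟶ pullback c z := pullback.lift (fst ≫ pullback.fst t π) snd (by
    rw [Category.assoc, hY.w])
  have hv : IsPullback fst v (pullback.fst t π) (pullback.fst c z) := by
    refine (IsPullback.of_right ?_ (pullback.lift_fst _ _ _)
      (IsPullback.of_hasPullback c z).flip).flip
    rw [pullback.lift_snd]
    exact hY.flip
  have hv' : IsPullback (fst ≫ pullback.snd t π) v π (pullback.fst c z ≫ t) :=
    (hv.flip.paste_vert (IsPullback.of_hasPullback t π)).flip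
  exact isIntegral_of_iso (hv'.flip.isoPullback).symm

end Fibers

theorem isNormalInRegular_stalk_of_flat_mono {Y S : Scheme.{u}} (f : Y ⟶ S) [Flat f] [Mono f]
    (hS : ∀ z : S, IsNormalInRegular (S.presheaf.stalk z)) (y : Y) :
    IsNormalInRegular (Y.presheaf.stalk y) := by
  have := isIso_stalkMap_of_flat_of_mono f y
  exact (hS (f y)).of_ringEquiv (asIso (f.stalkMap y)).commRingCatIsoToRingEquiv

theorem flat_fiberι_genericPoint {X S : Scheme.{u}} [IsIntegral S] (π : X ⟶ S) :
    Flat (π.fiberι (genericPoint S)) := by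
  have := flat_fromSpecResidueField_genericPoint S
  exact inferInstanceAs (Flat (pullback.fst π (S.fromSpecResidueField (genericPoint S))))

/-! ### Conic fibrations over the projective line -/

section

variable {k : Type u} [Field k] {X : Scheme.{u}} {s : X ⟶ Spec (.of k)}
  {π : X ⟶ ProjSpace 1 k}

theorem IsConicFibration.surjective (h : IsConicFibration s π) : Surjective π :=
  surjective_of_isPlaneConic π h.fiber_isPlaneConic

theorem IsConicFibration.flat (h : IsConicFibration s π) [IsIntegral X] : Flat π := by
  have := h.surjective
  exact flat_of_isDominant (ProjSpace.isDedekindDomain_stalk k) π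

variable [CharZero k]

theorem ProjSpace.neZero_two_residueField {N : ℕ} (y : ProjSpace N k) :
    NeZero (2 : (ProjSpace N k).residueField y) := by
  let φ : k →+* (ProjSpace N k).residueField y :=
    (Spec.preimage ((ProjSpace N k).fromSpecResidueField y ≫ ProjSpace.toSpec N k)).hom
  have : CharZero ((ProjSpace N k).residueField y) := charZero_of_injective_ringHom φ.injective
  infer_instance

/-- The generic fibre maps to `X` by a flat monomorphism, so its local rings are local rings of the
smooth scheme `X`, which excludes a degenerate conic. -/
theorem IsConicFibration.hasSmoothConicFiber_genericPoint (h : IsConicFibration s π) [Smooth s] :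
    HasSmoothConicFiber π (genericPoint (ProjSpace 1 k)) := by
  have := ProjSpace.neZero_two_residueField (genericPoint (ProjSpace 1 k))
  refine hasSmoothConicFiber_of_isPlaneConic π _ (h.fiber_isPlaneConic _) ?_
  have := flat_fiberι_genericPoint π
  exact isNormalInRegular_stalk_of_flat_mono (π.fiberι (genericPoint (ProjSpace 1 k)))
    (isNormalInRegular_stalk_of_smooth s)

/-- As `g` is a section, the residue field at its image is `k`. The scheme-theoretic fibre is then
isomorphic to the given smooth pullback. -/
theorem IsConicFibration.hasSmoothConicFiber_of_smooth (h : IsConicFibration s π)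
    (g : Spec (.of k) ⟶ ProjSpace 1 k) (hg : g ≫ ProjSpace.toSpec 1 k = 𝟙 _)
    (hsm : Smooth (pullback.snd π g)) (x : Spec (.of k)) : HasSmoothConicFiber π (g x) := by
  have := ProjSpace.neZero_two_residueField (g x)
  refine hasSmoothConicFiber_of_isPlaneConic π _ (h.fiber_isPlaneConic _) ?_
  obtain ⟨φ, hφ⟩ := exists_specMap_fromSpecResidueField_eq g x rfl
  have hiso : IsIso (Spec.map φ) := by
    have hφ' : Spec.map φ ≫ ((ProjSpace 1 k).fromSpecResidueField (g x) ≫ ProjSpace.toSpec 1 k) =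
        𝟙 _ := by rw [reassoc_of% hφ, hg]
    have h1 : Spec.preimage ((ProjSpace 1 k).fromSpecResidueField (g x) ≫
        ProjSpace.toSpec 1 k) ≫ φ = 𝟙 _ := by
      apply Spec.map_injective
      rw [Spec.map_comp, Spec.map_preimage, hφ', Spec.map_id]
    have : IsIso φ := by
      rw [ConcreteCategory.isIso_iff_bijective]
      exact ⟨RingHom.injective φ.hom, fun c => ⟨_, DFunLike.congr_fun (CommRingCat.hom_ext_iff.mp h1) c⟩⟩
    infer_instance
  obtain ⟨w, hw, -⟩ := isPullback_fiber hφ (IsPullback.of_hasPullback π g)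
  have hwi : IsIso w := hw.isIso_fst_of_isIso
  exact isNormalInRegular_stalk_of_flat_mono (inv w)
    (isNormalInRegular_stalk_of_smooth (pullback.snd π g))

end

/-! ### Rational function fields and affine space -/

section FunctionField

-- Denominators from `A` can be cleared in polynomials over `K`. This identifies the fraction fields
-- of `A[X]` and `K[X]`, so variables can be adjoined one at a time.
attribute [local instance] Polynomial.algebra Polynomial.isLocalization in
theorem isFractionRing_polynomial_fractionRing (A K : Type u) [CommRing A] [IsDomain A] [Field K]
    [Algebra A K] [IsFractionRing A K] (E : Type u) [Field E] [Algebra (Polynomial K) E]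
    [IsFractionRing (Polynomial K) E] [Algebra (Polynomial A) E]
    (h : ∀ p : Polynomial A, algebraMap (Polynomial A) E p =
      algebraMap (Polynomial K) E (p.map (algebraMap A K))) :
    IsFractionRing (Polynomial A) E := by
  have h' (p : Polynomial A) : algebraMap (Polynomial A) E p =
      algebraMap (Polynomial K) E (algebraMap (Polynomial A) (Polynomial K) p) := h p
  have hinj : Function.Injective (algebraMap (Polynomial A) E) := by
    intro p q hpq
    rw [h, h] at hpq
    exact Polynomial.map_injective _ (IsFractionRing.injective A K)
      (IsFractionRing.injective (Polynomial K) E hpq)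
  have : FaithfulSMul (Polynomial A) E := (faithfulSMul_iff_algebraMap_injective _ _).mpr hinj
  have hclear (p : Polynomial K) : ∃ x y : Polynomial A,
      algebraMap (Polynomial K) E p =
        algebraMap (Polynomial A) E x / algebraMap (Polynomial A) E y := by
    have := Polynomial.isLocalization (nonZeroDivisors A) K
    obtain ⟨⟨x, y, hy⟩, hxy⟩ := IsLocalization.surj ((nonZeroDivisors A).map Polynomial.C) p
    refine ⟨x, y, ?_⟩
    have hy0 : algebraMap (Polynomial A) E y ≠ 0 := by
      rw [Ne, map_eq_zero_iff _ hinj]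
      obtain ⟨a, ha, rfl⟩ := hy
      exact fun h => nonZeroDivisors.ne_zero ha (Polynomial.C_eq_zero.mp h)
    rw [eq_div_iff hy0, h', h', ← map_mul]
    exact congrArg _ hxy
  refine IsFractionRing.of_field _ _ fun z => ?_
  obtain ⟨p, q, -, rfl⟩ := IsFractionRing.div_surjective (A := Polynomial K) z
  obtain ⟨x, y, hxy⟩ := hclear p
  obtain ⟨x', y', hxy'⟩ := hclear q
  refine ⟨x * y', y * x', ?_⟩
  rw [hxy, hxy', map_mul, map_mul, div_div_div_eq]

/-- The field of rational functions in `n` variables. -/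
abbrev RatFunField (k : Type u) [Field k] (n : ℕ) : Type u :=
  FractionRing (MvPolynomial (Fin n) k)

variable (k : Type u) [Field k]

theorem exists_ratFunField_succ_equiv (n : ℕ) :
    ∃ e : RatFunField k (n + 1) ≃+* FractionRing (Polynomial (RatFunField k n)),
      ∀ c : k, e (algebraMap k _ c) = algebraMap (RatFunField k n) _ (algebraMap k _ c) := by
  let K := RatFunField k n
  let E := FractionRing (Polynomial K)
  let A := MvPolynomial (Fin n) k
  let : Algebra (Polynomial A) E :=
    ((algebraMap (Polynomial K) E).comp (Polynomial.mapRingHom (algebraMap A K))).toAlgebra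
  have : IsFractionRing (Polynomial A) E :=
    isFractionRing_polynomial_fractionRing A K E fun p => rfl
  refine ⟨IsFractionRing.ringEquivOfRingEquiv (MvPolynomial.finSuccEquiv k n).toRingEquiv,
    fun c => ?_⟩
  rw [IsScalarTower.algebraMap_apply k (MvPolynomial (Fin (n + 1)) k) (RatFunField k (n + 1)),
    IsFractionRing.ringEquivOfRingEquiv_algebraMap]
  change algebraMap (Polynomial A) E (MvPolynomial.finSuccEquiv k n (algebraMap k _ c)) = _
  rw [AlgEquiv.commutes]
  change algebraMap (Polynomial K) E
    (Polynomial.map (algebraMap A K) (algebraMap k (Polynomial A) c)) = _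
  rw [IsScalarTower.algebraMap_apply k A (Polynomial A), Polynomial.algebraMap_eq, Polynomial.map_C,
    ← IsScalarTower.algebraMap_apply k A K]
  rfl

theorem trdeg_ratFunField (n : ℕ) : Algebra.trdeg k (RatFunField k n) = n := by
  have h := trdeg_add_eq k (MvPolynomial (Fin n) k) (A := RatFunField k n)
  have : Algebra.IsAlgebraic (MvPolynomial (Fin n) k) (RatFunField k n) :=
    IsLocalization.isAlgebraic _ (nonZeroDivisors _)
  rw [trdeg_eq_zero (R := MvPolynomial (Fin n) k), MvPolynomial.trdeg_of_isDomain] at h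
  rw [← h]
  simp

theorem bijective_algebraMap_ratFunField_zero :
    Function.Bijective (algebraMap k (RatFunField k 0)) := by
  refine ⟨(algebraMap k _).injective, fun z => ?_⟩
  obtain ⟨p, q, -, rfl⟩ := IsFractionRing.div_surjective (A := MvPolynomial (Fin 0) k) z
  obtain ⟨a, rfl⟩ := MvPolynomial.C_surjective (Fin 0) p
  obtain ⟨b, rfl⟩ := MvPolynomial.C_surjective (Fin 0) q
  refine ⟨a / b, ?_⟩
  rw [map_div₀]
  rfl

theorem isIntegral_affineSpace (n : ℕ) : IsIntegral 𝔸(ULift.{u} (Fin n); Spec (.of k)) :=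
  isIntegral_of_iso (AffineSpace.SpecIso (ULift.{u} (Fin n)) (.of k)).symm

theorem exists_flat_mono_affineSpace (n : ℕ) :
    ∃ g : Spec (.of (RatFunField k n)) ⟶ 𝔸(ULift.{u} (Fin n); Spec (.of k)), Flat g ∧ Mono g ∧
      g ≫ (𝔸(ULift.{u} (Fin n); Spec (.of k)) ↘ Spec (.of k)) =
        Spec.map (CommRingCat.ofHom (algebraMap k (RatFunField k n))) := by
  let i : Spec (.of (RatFunField k n)) ⟶ Spec (.of (MvPolynomial (Fin n) k)) :=
    Spec.map (CommRingCat.ofHom (algebraMap _ _))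
  have : Mono i := mono_specMap_of_isLocalization (nonZeroDivisors _)
  have : Flat i := flat_specMap_of_isLocalization (nonZeroDivisors _)
  let e : Spec (.of (MvPolynomial (Fin n) k)) ⟶ Spec (.of (MvPolynomial (ULift.{u} (Fin n)) k)) :=
    Spec.map (RingEquiv.toCommRingCatIso
      (MvPolynomial.renameEquiv k Equiv.ulift.{u}).toRingEquiv).hom
  refine ⟨i ≫ e ≫ (AffineSpace.SpecIso (ULift.{u} (Fin n)) (.of k)).inv, inferInstance,
    inferInstance, ?_⟩
  rw [Category.assoc, Category.assoc, AffineSpace.SpecIso_inv_over, ← Spec.map_comp,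
    ← Spec.map_comp]
  congr 1
  ext c
  change algebraMap (MvPolynomial (Fin n) k) (RatFunField k n)
    (MvPolynomial.renameEquiv k Equiv.ulift.{u} (algebraMap k _ c)) = _
  rw [AlgEquiv.commutes, ← IsScalarTower.algebraMap_apply]
  rfl

end FunctionField

theorem apply_eq_genericPoint_of_flat_mono {L : Type u} [Field L] {X : Scheme.{u}} [IsIntegral X]
    (g : Spec (.of L) ⟶ X) [Flat g] [Mono g] (x : Spec (.of L)) : g x = genericPoint X := by
  obtain ⟨e, rfl⟩ := exists_iso_fromSpecStalk_genericPoint g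
  have : Subsingleton (Spec (X.presheaf.stalk (genericPoint X))) :=
    inferInstanceAs (Subsingleton (PrimeSpectrum X.functionField))
  rw [Scheme.Hom.comp_apply, Subsingleton.elim (e.hom x) (IsLocalRing.closedPoint _)]
  exact Scheme.fromSpecStalk_closedPoint

/-- The function field of a conic bundle with a rational section over a rational base. -/
theorem HasSmoothConicFiber.exists_flat_mono_pullback {k : Type u} [Field k] {X S T : Scheme.{u}}
    {π : X ⟶ S} (c : T ⟶ Spec (.of k)) [IsIntegral T] (f : T ⟶ X)
    (h : HasSmoothConicFiber π ((f ≫ π) (genericPoint T))) {n : ℕ}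
    (g : Spec (.of (RatFunField k n)) ⟶ T) [Flat g] [Mono g]
    (hg : g ≫ c = Spec.map (CommRingCat.ofHom (algebraMap k (RatFunField k n)))) :
    ∃ g' : Spec (.of (RatFunField k (n + 1))) ⟶ pullback (f ≫ π) π, Flat g' ∧ Mono g' ∧
      g' ≫ pullback.fst (f ≫ π) π ≫ c =
        Spec.map (CommRingCat.ofHom (algebraMap k (RatFunField k (n + 1)))) := by
  let t := f ≫ π
  have hP : IsPullback (pullback.fst (pullback.fst t π) g ≫ pullback.snd t π)
      (pullback.snd (pullback.fst t π) g) π (g ≫ t) :=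
    ((IsPullback.of_hasPullback (pullback.fst t π) g).flip.paste_vert
      (IsPullback.of_hasPullback t π)).flip
  let x : Spec (.of (RatFunField k n)) := Classical.arbitrary (PrimeSpectrum _)
  have hx : (g ≫ t) x = t (genericPoint T) := by
    rw [Scheme.Hom.comp_apply, apply_eq_genericPoint_of_flat_mono g]
  -- The rational point on the generic conic is tautological: `g ≫ f` lifts `g ≫ f ≫ π` through `π`.
  obtain ⟨γ, _, _, hγ⟩ := h.exists_flat_mono x hx (g ≫ f) (by simp [t]) hP
  obtain ⟨e, he⟩ := exists_ratFunField_succ_equiv k n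
  let ε : Spec (.of (RatFunField k (n + 1))) ⟶
      Spec (.of (FractionRing (Polynomial (RatFunField k n)))) :=
    Spec.map (RingEquiv.toCommRingCatIso e.symm).hom
  refine ⟨ε ≫ γ ≫ pullback.fst (pullback.fst t π) g, inferInstance, inferInstance, ?_⟩
  simp only [Category.assoc]
  rw [pullback.condition_assoc, reassoc_of% hγ, hg, ← Spec.map_comp, ← Spec.map_comp]
  congr 1
  ext a
  change e.symm (algebraMap (RatFunField k n) _ (algebraMap k _ a)) = algebraMap k _ a
  rw [← he, RingEquiv.symm_apply_apply]

theorem isRationalOfDim_and_topologicalKrullDim_eq {k : Type u} [Field k] {T : Scheme.{u}}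
    (c : T ⟶ Spec (.of k)) [IsIntegral T] [LocallyOfFiniteType c] {n : ℕ}
    (g : Spec (.of (RatFunField k n)) ⟶ T) [Flat g] [Mono g]
    (hg : g ≫ c = Spec.map (CommRingCat.ofHom (algebraMap k (RatFunField k n)))) :
    IsRationalOfDim c n ∧ topologicalKrullDim T = n := by
  refine ⟨?_, topologicalKrullDim_eq_of_flat_mono c g hg n (trdeg_ratFunField k n)⟩
  obtain ⟨g', _, _, hg'⟩ := exists_flat_mono_affineSpace k n
  have := isIntegral_affineSpace k n
  exact birationalOver_of_flat_mono c _ g g' (hg.trans hg'.symm)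

/-! ### Projectivity of fibre products -/

section Projective

variable {k : Type u} [Field k]

theorem IsProjectiveScheme.isProper {X : Scheme.{u}} {s : X ⟶ Spec (.of k)}
    (h : IsProjectiveScheme s) : IsProper s := by
  obtain ⟨N, i, hi, rfl⟩ := h
  infer_instance

theorem IsProjectiveScheme.comp_isClosedImmersion {X Y : Scheme.{u}} {s : X ⟶ Spec (.of k)}
    (h : IsProjectiveScheme s) (i : Y ⟶ X) [IsClosedImmersion i] : IsProjectiveScheme (i ≫ s) := by
  obtain ⟨N, j, hj, rfl⟩ := h
  exact ⟨N, i ≫ j, inferInstance, Category.assoc _ _ _⟩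

variable {C X S : Scheme.{u}} (σ : S ⟶ Spec (.of k)) [IsSeparated σ] (t : C ⟶ S) (π : X ⟶ S)

/-- The two projective embeddings map the fibre product to a product of projective spaces by a
proper monomorphism, hence a closed immersion; the Segre map finishes. -/
theorem IsProjectiveScheme.pullback (hC : IsProjectiveScheme (t ≫ σ))
    (hX : IsProjectiveScheme (π ≫ σ)) :
    IsProjectiveScheme (pullback.fst t π ≫ t ≫ σ) := by
  have := hC.isProper
  have := hX.isProper
  have : IsProper π := .of_comp π σ
  obtain ⟨N, i, hi, his⟩ := hC
  obtain ⟨M, j, hj, hjs⟩ := hX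
  let q : Limits.pullback t π ⟶ Limits.pullback (ProjSpace.toSpec N k) (ProjSpace.toSpec M k) :=
    pullback.lift (pullback.fst t π ≫ i) (pullback.snd t π ≫ j) (by
      rw [Category.assoc, his, Category.assoc, hjs, pullback.condition_assoc])
  have hq1 : q ≫ pullback.fst _ _ = pullback.fst t π ≫ i := pullback.lift_fst _ _ _
  have hq2 : q ≫ pullback.snd _ _ = pullback.snd t π ≫ j := pullback.lift_snd _ _ _
  have hmono : Mono q := by
    refine ⟨fun {W} a b hab => pullback.hom_ext ?_ ?_⟩
    · rw [← cancel_mono i, Category.assoc, Category.assoc, ← hq1, reassoc_of% hab]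
    · rw [← cancel_mono j, Category.assoc, Category.assoc, ← hq2, reassoc_of% hab]
  have hproper : IsProper q := by
    have : IsProper (q ≫ pullback.fst _ _ ≫ ProjSpace.toSpec N k) := by
      rw [reassoc_of% hq1, his]
      infer_instance
    exact .of_comp q (pullback.fst _ _ ≫ ProjSpace.toSpec N k)
  have hcl : IsClosedImmersion q := (IsClosedImmersion.iff_isProper_and_mono q).mpr ⟨hproper, hmono⟩
  have hcard : (N + 1) * (M + 1) = (N * M + N + M) + 1 := by ring
  let e : Fin (N + 1) × Fin (M + 1) ≃ Fin (N * M + N + M + 1) :=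
    finProdFinEquiv.trans (finCongr hcard)
  refine ⟨N * M + N + M, q ≫ ProjSpace.segre N k M e, inferInstance, ?_⟩
  rw [Category.assoc, ProjSpace.segre_toSpec, reassoc_of% hq1, his]

/-- An embedding of `C` in `ℙᴺ` embeds the fibre product in `X × ℙᴺ` over `X`, again by a proper
monomorphism. -/
theorem isProjectiveMorphism_pullback_snd (hC : IsProjectiveScheme (t ≫ σ)) :
    IsProjectiveMorphism (π ≫ σ) (pullback.snd t π) := by
  have := hC.isProper
  have : IsProper t := .of_comp t σ
  obtain ⟨N, i, hi, his⟩ := hC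
  let q : Limits.pullback t π ⟶ Limits.pullback (π ≫ σ) (ProjSpace.toSpec N k) :=
    pullback.lift (pullback.snd t π) (pullback.fst t π ≫ i) (by
      rw [Category.assoc, his, pullback.condition_assoc])
  have hq1 : q ≫ pullback.fst _ _ = pullback.snd t π := pullback.lift_fst _ _ _
  have hq2 : q ≫ pullback.snd _ _ = pullback.fst t π ≫ i := pullback.lift_snd _ _ _
  have hmono : Mono q := by
    refine ⟨fun {W} a b hab => pullback.hom_ext ?_ ?_⟩
    · rw [← cancel_mono i, Category.assoc, Category.assoc, ← hq2, reassoc_of% hab]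
    · rw [← hq1, reassoc_of% hab]
  have hproper : IsProper q := by
    have : IsProper (q ≫ pullback.fst _ _) := by
      rw [hq1]
      infer_instance
    exact .of_comp q (pullback.fst _ _)
  exact ⟨N, q, (IsClosedImmersion.iff_isProper_and_mono q).mpr ⟨hproper, hmono⟩, hq1⟩

theorem IsProjectiveScheme.isVariety {X : Scheme.{u}} {s : X ⟶ Spec (.of k)}
    (h : IsProjectiveScheme s) (hg : GeometricallyIntegral s) : IsVariety s :=
  have := h.isProper
  ⟨hg, inferInstance, inferInstance, inferInstance⟩

end Projective

/-! ### Disjoint divisors have intersection number zero -/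

section Intersection

/-- Over affine opens of `Y`, the sections of the scheme-theoretic image embed in sections of the
reduced scheme `X`. -/
theorem isReduced_image {X Y : Scheme.{u}} (f : X ⟶ Y) [QuasiCompact f] [IsReduced X] :
    IsReduced f.image := by
  have : ∀ v : f.image, _root_.IsReduced (f.image.presheaf.stalk v) := by
    intro v
    obtain ⟨_, ⟨U, hU, rfl⟩, hvU, -⟩ := Y.isBasis_affineOpens.exists_subset_of_mem_open
      (Set.mem_univ (f.imageι v)) isOpen_univ
    have hU : IsAffineOpen U := hU
    have hW : IsAffineOpen (f.imageι ⁻¹ᵁ U) := hU.preimage f.imageι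
    have hvW : v ∈ f.imageι ⁻¹ᵁ U := hvU
    have hred : _root_.IsReduced Γ(f.image, f.imageι ⁻¹ᵁ U) :=
      isReduced_of_injective (f.toImage.app (f.imageι ⁻¹ᵁ U)).hom (f.toImage_app_injective ⟨U, hU⟩)
    let := TopCat.Presheaf.algebra_section_stalk f.image.presheaf (⟨v, hvW⟩ : f.imageι ⁻¹ᵁ U)
    have hloc := hW.isLocalization_stalk ⟨v, hvW⟩
    exact isReduced_localizationPreserves (hW.primeIdealOf ⟨v, hvW⟩).asIdeal.primeCompl _ hred
  exact isReduced_of_isReduced_stalk _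

/-- The reduced closed subscheme with a given generic point. -/
theorem exists_isIntegral_range_eq_closure (D : Scheme.{u}) (z : D) :
    ∃ (V : Scheme.{u}) (j : V ⟶ D), IsIntegral V ∧ IsClosedImmersion j ∧
      Set.range j = closure {z} := by
  let γ : Spec (.of (D.residueField z)) ⟶ D := D.fromSpecResidueField z
  have hγ : Set.range γ = {z} := D.range_fromSpecResidueField z
  have : QuasiCompact γ := quasiCompact_of_finite γ
  have hr : Set.range γ.imageι = closure {z} := by
    rw [← hγ, ← Scheme.Hom.support_ker]
    exact Scheme.IdealSheafData.range_subschemeι _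
  have := isReduced_image γ
  have hirr : IsIrreducible (Set.univ : Set γ.image) := by
    rw [← (Scheme.Hom.denseRange γ.toImage).closure_range, isIrreducible_iff_closure,
      ← Set.image_univ]
    exact (IrreducibleSpace.isIrreducible_univ _).image _ γ.toImage.continuous.continuousOn
  have : IrreducibleSpace γ.image :=
    { toPreirreducibleSpace := ⟨hirr.2⟩, toNonempty := ⟨hirr.1.some⟩ }
  exact ⟨γ.image, γ.imageι, isIntegral_of_irreducibleSpace_of_isReduced _, inferInstance, hr⟩

theorem isLocalEquation_one {E S : Scheme.{u}} (i : E ⟶ S) [QuasiCompact i]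
    (hi : IsClosed (Set.range i)) (x : S) (hx : x ∉ Set.range i) : IsLocalEquation i x 1 := by
  obtain ⟨_, ⟨U, hU, rfl⟩, hxU, hUE⟩ := S.isBasis_affineOpens.exists_subset_of_mem_open
    (show x ∈ (Set.range i)ᶜ from hx) hi.isOpen_compl
  refine ⟨⟨U, hU⟩, hxU, 1, one_mem _, ?_, map_one _⟩
  rw [Scheme.Hom.ker_apply, Ideal.span_singleton_one, Ideal.eq_top_iff_one, RingHom.mem_ker]
  have hempty : i ⁻¹ᵁ U = ⊥ := by
    ext e
    simp only [TopologicalSpace.Opens.coe_bot, Set.mem_empty_iff_false, iff_false]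
    exact fun he => hUE he ⟨e, rfl⟩
  have : Subsingleton Γ(E, i ⁻¹ᵁ U) := by
    rw [hempty]
    infer_instance
  exact Subsingleton.elim _ _

theorem ord_one {V : Scheme.{u}} [IsIntegral V] [IsLocallyNoetherian V] (x : V) :
    V.ord (1 : V.functionField) x = 0 := by
  have : Nonempty (⊤ : V.Opens) := ⟨⟨x, trivial⟩⟩
  have h := Scheme.ord_of_isUnit (X := V) (U := ⊤) (f := 1) isUnit_one (x := x) trivial
  rwa [map_one] at h

/-- Away from `E` the constant 1 is a local equation at every point of the curve, so the rational
section has no zeros or poles. -/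
theorem isDegreeOnCurve_zero {E S V : Scheme.{u}} (i : E ⟶ S) (j : V ⟶ S) [IsIntegral V]
    [IsLocallyNoetherian V] [QuasiCompact i] (hi : IsClosed (Set.range i))
    (hd : Disjoint (Set.range j) (Set.range i)) : IsDegreeOnCurve i j 0 := by
  have hx (x : V) : j x ∉ Set.range i := fun h => hd.le_bot ⟨⟨x, rfl⟩, h⟩
  refine ⟨1, fun _ => 1, isLocalEquation_one i hi _ (hx _),
    fun x => ⟨1, isLocalEquation_one i hi _ (hx x), ?_⟩, ?_⟩
  · rw [map_one, Units.val_one, one_mul]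
  · symm
    refine finsum_eq_zero_of_forall_eq_zero fun x => ?_
    rw [Units.val_one, map_one]
    exact ord_one x

/-- Each component of `D`, with its reduced structure, misses `E` and contributes degree 0. The
positivity hypothesis is contradicted by exhibiting this value. -/
theorem isIntersectionNumber_zero {D E S : Scheme.{u}} (i₁ : D ⟶ S) (i₂ : E ⟶ S)
    [IsLocallyNoetherian D] [QuasiCompact i₂] (hi : IsClosed (Set.range i₂))
    (hd : Disjoint (Set.range i₁) (Set.range i₂)) : IsIntersectionNumber i₁ i₂ 0 := by
  refine ⟨fun _ => 0, fun Z => ?_, by simp⟩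
  have hZ : IsIrreducible (Z : Set D) := Z.2.1
  have hZc : IsClosed (Z : Set D) := isClosed_of_mem_irreducibleComponents _ Z.2
  obtain ⟨V, j, hV, hj, hr⟩ := exists_isIntegral_range_eq_closure D hZ.genericPoint
  have hn : IsLocallyNoetherian V := LocallyOfFiniteType.isLocallyNoetherian j
  refine ⟨V, hV, hn, j, 0, hj, by rw [hr, hZ.closure_genericPoint hZc],
    isDegreeOnCurve_zero i₂ (j ≫ i₁) hi (hd.mono_left ?_), by simp⟩
  rintro _ ⟨x, rfl⟩
  exact ⟨j x, rfl⟩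

theorem isIntersectionNumber_fiber_zero {X S₁ S₂ : Scheme.{u}} (p : X ⟶ S₁) (q : X ⟶ S₂)
    [LocallyOfFiniteType p] (P : S₁) (Q : S₂) (hQ : IsClosed {Q})
    (h : ∀ x, p x = P → q x ≠ Q) : IsIntersectionNumber (p.fiberι P) (q.fiberι Q) 0 := by
  have : LocallyOfFiniteType (p.fiberToSpecResidueField P) :=
    inferInstanceAs (LocallyOfFiniteType (pullback.snd _ _))
  have : IsLocallyNoetherian (p.fiber P) :=
    LocallyOfFiniteType.isLocallyNoetherian (p.fiberToSpecResidueField P)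
  have : QuasiCompact (S₂.fromSpecResidueField Q) := quasiCompact_of_finite _
  have : QuasiCompact (q.fiberι Q) := inferInstanceAs (QuasiCompact (pullback.fst _ _))
  refine isIntersectionNumber_zero _ _ ?_ ?_
  · rw [Scheme.Hom.range_fiberι]
    exact hQ.preimage q.continuous
  · rw [Scheme.Hom.range_fiberι, Scheme.Hom.range_fiberι, Set.disjoint_left]
    exact fun x hx hx' => h x hx hx'

end Intersection

/-! ### Dominance from positivity, and the inductive step -/

section Main

variable {k : Type u} [Field k] {X : Scheme.{u}} {s : X ⟶ Spec (.of k)}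

theorem geomMap_fst {Y : Scheme.{u}} {t : Y ⟶ Spec (.of k)} {π : X ⟶ Y} (h : π ≫ t = s) :
    geomMap s t π h ≫ pullback.fst _ _ = pullback.fst _ _ ≫ π :=
  pullback.lift_fst _ _ _

theorem locallyOfFiniteType_geomMap [LocallyOfFiniteType s] {Y : Scheme.{u}}
    {t : Y ⟶ Spec (.of k)} {π : X ⟶ Y} (h : π ≫ t = s) :
    LocallyOfFiniteType (geomMap s t π h) := by
  have h1 : geomMap s t π h ≫ pullback.snd _ _ = pullback.snd s (specAlgClosure k) := by
    rw [geomMap, pullback.map, pullback.lift_snd, Category.comp_id]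
  have : LocallyOfFiniteType (geomMap s t π h ≫ pullback.snd _ _) := by
    rw [h1]
    infer_instance
  exact locallyOfFiniteType_of_comp _ (pullback.snd t (specAlgClosure k))

/-- If the fibres of two conic fibrations always meet, then a closed fibre of one of them dominates
the base of the other. -/
theorem FibersMeetPositively.isDominant [LocallyOfFiniteType s] {π₁ π₂ : X ⟶ ProjSpace 1 k}
    {h₁ : IsConicFibration s π₁} {h₂ : IsConicFibration s π₂} (hpos : FibersMeetPositively h₁ h₂)
    {C : Scheme.{u}} [IsIntegral C] (f : C ⟶ X) (y : ProjSpace 1 k) (hy : IsClosed {y})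
    (hf : Set.range f = π₁ ⁻¹' {y}) : IsDominant (f ≫ π₂) := by
  by_contra hdom
  let p := pullback.fst (ProjSpace.toSpec 1 k) (specAlgClosure k)
  have hp : Surjective p := by
    have : Surjective (specAlgClosure k) :=
      ⟨fun y => ⟨Classical.arbitrary (PrimeSpectrum (AlgebraicClosure k)), Subsingleton.elim _ _⟩⟩
    infer_instance
  have : JacobsonSpace ↥(pullback (ProjSpace.toSpec 1 k) (specAlgClosure k)) :=
    LocallyOfFiniteType.jacobsonSpace (pullback.snd _ _)
  let W : Set (ProjSpace 1 k) := closure (Set.range (f ≫ π₂))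
  have hW : (Wᶜ).Nonempty := by
    rw [Set.nonempty_compl]
    exact fun h => hdom ⟨dense_iff_closure_eq.mpr h⟩
  -- The geometric projective line is a Jacobson space, so a closed point `Q` exists over the
  -- complement of the closure of the image, and likewise a closed point `P` over `y`. A common
  -- point of the two geometric fibres would lie over the range of `f` and put `Q` over the image.
  obtain ⟨Q, hQW, hQ⟩ := nonempty_inter_closedPoints (hW.preimage p.surjective)
    (isClosed_closure.isOpen_compl.preimage p.continuous).isLocallyClosed
  obtain ⟨P, hPy, hP⟩ := nonempty_inter_closedPoints
    ((Set.singleton_nonempty y).preimage p.surjective) (hy.preimage p.continuous).isLocallyClosed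
  have := locallyOfFiniteType_geomMap h₁.comp_toSpec
  refine lt_irrefl (0 : ℤ) (hpos P Q hP hQ 0 (isIntersectionNumber_fiber_zero _ _ P Q hQ ?_))
  intro x hx₁ hx₂
  have e₁ : π₁ (pullback.fst s (specAlgClosure k) x) = p P := by
    rw [← hx₁, ← Scheme.Hom.comp_apply, ← Scheme.Hom.comp_apply, geomMap_fst]
  have e₂ : π₂ (pullback.fst s (specAlgClosure k) x) = p Q := by
    rw [← hx₂, ← Scheme.Hom.comp_apply, ← Scheme.Hom.comp_apply, geomMap_fst]
  have hmem : pullback.fst s (specAlgClosure k) x ∈ Set.range f := by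
    rw [hf]
    exact e₁.trans hPy
  obtain ⟨c, hc⟩ := hmem
  refine hQW (subset_closure ⟨c, ?_⟩)
  rw [← e₂, ← hc, Scheme.Hom.comp_apply]

variable (s) in
/-- A geometrically integral projective scheme over `X` which is rational of dimension `n`. -/
structure IsRationalStage {C : Scheme.{u}} (f : C ⟶ X) (n : ℕ) : Prop where
  isProjective : IsProjectiveScheme (f ≫ s)
  geometricallyIntegral : GeometricallyIntegral (f ≫ s)
  exists_flat_mono : ∃ g : Spec (.of (RatFunField k n)) ⟶ C, Flat g ∧ Mono g ∧
    g ≫ f ≫ s = Spec.map (CommRingCat.ofHom (algebraMap k (RatFunField k n)))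

namespace IsRationalStage

variable {C : Scheme.{u}} {f : C ⟶ X} {n : ℕ} {π : X ⟶ ProjSpace 1 k}

theorem isIntegral (h : IsRationalStage s f n) : IsIntegral C :=
  have := h.geometricallyIntegral
  GeometricallyIntegral.isIntegral_of_subsingleton (f ≫ s)

theorem isRationalOfDim_and_topologicalKrullDim_eq (h : IsRationalStage s f n) :
    IsRationalOfDim (f ≫ s) n ∧ topologicalKrullDim C = n := by
  obtain ⟨g, _, _, hg⟩ := h.exists_flat_mono
  have := h.isIntegral
  have := h.isProjective.isProper
  exact ConicFibrations.isRationalOfDim_and_topologicalKrullDim_eq (f ≫ s) g hg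

theorem isProper_comp (h : IsRationalStage s f n) (hπ : IsConicFibration s π) :
    IsProper (f ≫ π) := by
  have : IsProper ((f ≫ π) ≫ ProjSpace.toSpec 1 k) := by
    rw [Category.assoc, hπ.comp_toSpec]
    exact h.isProjective.isProper
  exact .of_comp _ (ProjSpace.toSpec 1 k)

/-- The only input beyond the previous stage is smoothness of the one fibre lying under the generic
point of `C`. -/
theorem pullback (h : IsRationalStage s f n) (hπ : IsConicFibration s π) [IsIntegral X]
    [IsIntegral C] (hX : IsProjectiveScheme s)
    (hsm : HasSmoothConicFiber π ((f ≫ π) (genericPoint C))) :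
    IsRationalStage s (pullback.snd (f ≫ π) π) (n + 1) := by
  have hcomp : pullback.snd (f ≫ π) π ≫ s = pullback.fst (f ≫ π) π ≫ f ≫ s := by
    rw [← hπ.comp_toSpec, ← pullback.condition_assoc, Category.assoc]
  have := hπ.flat
  have := h.geometricallyIntegral
  have hσ : (f ≫ π) ≫ ProjSpace.toSpec 1 k = f ≫ s := by rw [Category.assoc, hπ.comp_toSpec]
  refine ⟨?_, ?_, ?_⟩
  · rw [hcomp, ← hσ]
    refine IsProjectiveScheme.pullback (ProjSpace.toSpec 1 k) (f ≫ π) π ?_ ?_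
    · rw [hσ]
      exact h.isProjective
    · rw [hπ.comp_toSpec]
      exact hX
  · rw [hcomp]
    exact hsm.geometricallyIntegral_pullback (f ≫ s)
  · obtain ⟨g, _, _, hg⟩ := h.exists_flat_mono
    rw [hcomp]
    exact hsm.exists_flat_mono_pullback (f ≫ s) f g hg

/-- All three properties come by base change from `f ≫ π`, which is flat because it is dominant over
a Dedekind base, and surjective because it is dominant and proper. -/
theorem flat_and_isProjectiveMorphism_and_surjective (h : IsRationalStage s f n)
    (hπ : IsConicFibration s π) [IsDominant (f ≫ π)] :
    Flat (pullback.snd (f ≫ π) π) ∧ IsProjectiveMorphism s (pullback.snd (f ≫ π) π) ∧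
      Surjective (pullback.snd (f ≫ π) π) := by
  have := h.isIntegral
  have hflat : Flat (f ≫ π) := flat_of_isDominant (ProjSpace.isDedekindDomain_stalk k) _
  have hprop := h.isProper_comp hπ
  have hsurj : Surjective (f ≫ π) := by
    refine ⟨Set.range_eq_univ.mp ?_⟩
    rw [← (Scheme.Hom.isClosedMap (f ≫ π)).isClosed_range.closure_eq,
      (Scheme.Hom.denseRange (f ≫ π)).closure_range]
  refine ⟨inferInstance, ?_, inferInstance⟩
  have hC : IsProjectiveScheme ((f ≫ π) ≫ ProjSpace.toSpec 1 k) := by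
    rw [Category.assoc, hπ.comp_toSpec]
    exact h.isProjective
  have := isProjectiveMorphism_pullback_snd (ProjSpace.toSpec 1 k) (f ≫ π) π hC
  rwa [hπ.comp_toSpec] at this

end IsRationalStage

theorem isRationalStage_zero (hX : IsProjectiveScheme s) (P₀ : Spec (.of k) ⟶ X)
    (hP₀ : P₀ ≫ s = 𝟙 (Spec (.of k))) : IsRationalStage s P₀ 0 := by
  have := hX.isProper
  have hcl : IsClosedImmersion P₀ := by
    have : IsClosedImmersion (P₀ ≫ s) := by
      rw [hP₀]
      infer_instance
    exact .of_comp P₀ s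
  refine ⟨hX.comp_isClosedImmersion P₀, ?_, ?_⟩
  · rw [hP₀]
    refine ⟨fun K _ z Y fst snd hY => ?_⟩
    have : IsIso snd := hY.isIso_snd_of_isIso
    exact isIntegral_of_iso (asIso snd).symm
  · have hb := bijective_algebraMap_ratFunField_zero k
    have : IsIso (CommRingCat.ofHom (algebraMap k (RatFunField k 0))) :=
      (ConcreteCategory.isIso_iff_bijective _).mpr hb
    refine ⟨Spec.map (CommRingCat.ofHom (algebraMap k (RatFunField k 0))), inferInstance,
      inferInstance, ?_⟩
    rw [hP₀, Category.comp_id]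

end Main

/-! ### Induction along the tower -/

section Iteration

variable {k : Type u} [Field k] [CharZero k] {X : Scheme.{u}} {s : X ⟶ Spec (.of k)}
  {π₁ π₂ : X ⟶ ProjSpace 1 k}

/-- Dominance is carried along because it places the generic point of the next stage over the
generic point of the base, where the fibre is smooth. It fails at stage 0, so the first step uses
the smooth fibre through `P₀` and the second the positivity of intersection numbers. -/
theorem isRationalStage_and_isDominant (hX : IsSmoothProjectiveSurface s)
    (h₁ : IsConicFibration s π₁) (h₂ : IsConicFibration s π₂) (hpos : FibersMeetPositively h₁ h₂)
    (P₀ : Spec (.of k) ⟶ X) (hP₀ : P₀ ≫ s = 𝟙 (Spec (.of k)))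
    (hsmooth : Smooth (pullback.snd π₁ (P₀ ≫ π₁))) (n : ℕ) :
    IsRationalStage s (auxF π₁ π₂ P₀ n) n ∧
      (1 ≤ n → IsDominant (auxF π₁ π₂ P₀ n ≫ if Odd (n + 1) then π₁ else π₂)) := by
  have := hX.smooth
  have := hX.isVariety.geometricallyIntegral
  have := hX.isVariety.locallyOfFiniteType
  have : IsIntegral X := GeometricallyIntegral.isIntegral_of_subsingleton s
  have hfib (n : ℕ) : IsConicFibration s (if Odd (n + 1) then π₁ else π₂) := by
    split <;> assumption
  have hgen {C : Scheme.{u}} [IsIntegral C] {f : C ⟶ X} {π : X ⟶ ProjSpace 1 k}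
      (hπ : IsConicFibration s π) (hd : IsDominant (f ≫ π)) :
      HasSmoothConicFiber π ((f ≫ π) (genericPoint C)) := by
    rw [apply_genericPoint_of_isDominant (f ≫ π)]
    exact hπ.hasSmoothConicFiber_genericPoint
  have h0 := isRationalStage_zero hX.projective P₀ hP₀
  have hs0 (x : Spec (.of k)) : HasSmoothConicFiber π₁ ((P₀ ≫ π₁) x) :=
    h₁.hasSmoothConicFiber_of_smooth (P₀ ≫ π₁) (by
      rw [Category.assoc, h₁.comp_toSpec, hP₀]) hsmooth x
  have hstage1 : IsRationalStage s (pullback.snd (P₀ ≫ π₁) π₁) 1 :=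
    h0.pullback h₁ hX.projective (hs0 _)
  have hdom1 : IsDominant (pullback.snd (P₀ ≫ π₁) π₁ ≫ π₂) := by
    have := hstage1.isIntegral
    have hcl : IsClosedImmersion (P₀ ≫ π₁) := by
      have : IsClosedImmersion ((P₀ ≫ π₁) ≫ ProjSpace.toSpec 1 k) := by
        rw [Category.assoc, h₁.comp_toSpec, hP₀]
        infer_instance
      exact .of_comp _ (ProjSpace.toSpec 1 k)
    let x : Spec (.of k) := Classical.arbitrary (PrimeSpectrum k)
    have hr : Set.range (P₀ ≫ π₁) = {(P₀ ≫ π₁) x} := by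
      ext y
      constructor
      · rintro ⟨x', rfl⟩
        rw [Subsingleton.elim x' x]
        rfl
      · rintro rfl
        exact ⟨x, rfl⟩
    -- The image of `C_1` in `X` is the whole fibre of `π₁` over a rational point, and such a point
    -- is closed.
    refine hpos.isDominant (pullback.snd (P₀ ≫ π₁) π₁) ((P₀ ≫ π₁) x) ?_ ?_
    · rw [← hr]
      exact (P₀ ≫ π₁).isClosedEmbedding.isClosed_range
    · rw [Scheme.Pullback.range_snd, hr]
  induction n with
  | zero => exact ⟨h0, fun h => absurd h (by decide)⟩
  | succ n ih =>
    obtain ⟨hst, hd⟩ := ih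
    rcases n with _ | n
    · exact ⟨hstage1, fun _ => hdom1⟩
    · have hd := hd (Nat.succ_pos n)
      have := hst.isIntegral
      refine ⟨hst.pullback (hfib (n + 1)) hX.projective (hgen (hfib (n + 1)) hd), fun _ => ?_⟩
      -- From stage 2 on, `f` is surjective, so dominance over the base of either fibration is
      -- automatic.
      have h3 := (hst.flat_and_isProjectiveMorphism_and_surjective (hfib (n + 1))).2.2
      have h4 := (hfib (n + 2)).surjective
      have : Surjective (pullback.snd (auxF π₁ π₂ P₀ (n + 1) ≫
        if Odd (n + 1 + 1) then π₁ else π₂) (if Odd (n + 1 + 1) then π₁ else π₂) ≫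
          if Odd (n + 2 + 1) then π₁ else π₂) := inferInstance
      exact inferInstanceAs (IsDominant (pullback.snd (auxF π₁ π₂ P₀ (n + 1) ≫
        if Odd (n + 1 + 1) then π₁ else π₂) (if Odd (n + 1 + 1) then π₁ else π₂) ≫
          if Odd (n + 2 + 1) then π₁ else π₂))

end Iteration

end ConicFibrations

end

theorem proposition3p3 {k : Type u} [Field k] [CharZero k] {X : Scheme.{u}}
    (s : X ⟶ Spec (.of k)) (hX : ConicFibrations.IsSmoothProjectiveSurface s)
    (π₁ π₂ : X ⟶ ConicFibrations.ProjSpace 1 k)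
    (h₁ : ConicFibrations.IsConicFibration s π₁) (h₂ : ConicFibrations.IsConicFibration s π₂)
    (hpos : ConicFibrations.FibersMeetPositively h₁ h₂)
    (P₀ : Spec (.of k) ⟶ X) (hP₀ : P₀ ≫ s = 𝟙 (Spec (.of k)))
    (hsmooth : Smooth (pullback.snd π₁ (P₀ ≫ π₁))) :
    (∀ n : ℕ, 2 ≤ n →
      Flat (ConicFibrations.auxF π₁ π₂ P₀ n) ∧
      ConicFibrations.IsProjectiveMorphism s (ConicFibrations.auxF π₁ π₂ P₀ n) ∧
      Surjective (ConicFibrations.auxF π₁ π₂ P₀ n)) ∧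
    (∀ n : ℕ,
      GeometricallyIntegral (ConicFibrations.auxF π₁ π₂ P₀ n ≫ s) ∧
      topologicalKrullDim (ConicFibrations.auxC π₁ π₂ P₀ n) = n) ∧
    (∀ n : ℕ,
      ConicFibrations.IsVariety (ConicFibrations.auxF π₁ π₂ P₀ n ≫ s) ∧
      ConicFibrations.IsProjectiveScheme (ConicFibrations.auxF π₁ π₂ P₀ n ≫ s) ∧
      ConicFibrations.IsRationalOfDim (ConicFibrations.auxF π₁ π₂ P₀ n ≫ s) n) := by
  have key := ConicFibrations.isRationalStage_and_isDominant hX h₁ h₂ hpos P₀ hP₀ hsmooth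
  refine ⟨fun n hn => ?_, fun n => ⟨(key n).1.geometricallyIntegral,
    (key n).1.isRationalOfDim_and_topologicalKrullDim_eq.2⟩,
    fun n => ⟨(key n).1.isProjective.isVariety (key n).1.geometricallyIntegral,
      (key n).1.isProjective, (key n).1.isRationalOfDim_and_topologicalKrullDim_eq.1⟩⟩
  -- The bound `2 ≤ n` makes the preceding stage have index at least 1, where dominance is known.
  obtain ⟨m, rfl⟩ : ∃ m, n = m + 1 + 1 := ⟨n - 2, by omega⟩
  have hfib : ConicFibrations.IsConicFibration s (if Odd (m + 1 + 1) then π₁ else π₂) := by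
    split <;> assumption
  have := (key (m + 1)).2 (Nat.succ_pos m)
  exact (key (m + 1)).1.flat_and_isProjectiveMorphism_and_surjective hfib
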